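/- **Setting.** Let $U\subseteq\mathbb C$ be open, $\Gamma=\mathbb Z\gamma_1\oplus\mathbb Z\gamma_2$ with the antisymmetric pairing $\langle\gamma_1,\gamma_2\rangle=1$ and a norm $\|\cdot\|$, let $\gamma\mapsto Z_\gamma$ be a homomorphism from $\Gamma$ to the holomorphic functions on $U$, and for $a\in U$ let $\Omega(\cdot\,;a):\Gamma\to\mathbb Z$ satisfy $\Omega(-\gamma;a)=\Omega(\gamma;a)$. Assume that there are $c>0$ and $A,B$ such that for all $a\in U$, $\gamma\in\Gamma$: $|Z_\gamma(a)|>c\|\gamma\|$ whenever $\Omega(\gamma;a)\ne0$, and $|\Omega(\gamma;a)|\le Ae^{B\|\gamma\|}$. Put $\ell_\gamma(a)=\{-tZ_\gamma(a):t>0\}$. Let $r,-r$ be opposite rays from $0$ that are admissible: there is an angle $\alpha_0<\pi/2$ such that for all $a\in U$ every $\ell_\gamma(a)$ with $\Omega(\gamma;a)\neq0$ makes an angle at most $\alpha_0$ with $r$ or with $-r$. Let $\mathcal K_\gamma$ be the transformation $X_{\gamma'}\mapsto X_{\gamma'}(1-X_\gamma)^{\langle\gamma',\gamma\rangle}$ of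 formal monomials $X_{\gamma'}$, $\gamma'\in\Gamma$, and let $S_{r}$ (resp. $S_{-r}$) be the product, in the counterclockwise order of the rays $\ell_\gamma(a)$, of the $\mathcal K_\gamma^{\Omega(\gamma;a)}$ over all $\gamma$ with $\ell_\gamma(a)$ at an acute angle with $r$ (resp. $-r$). It is defined at the generic $a$, for which all $\gamma$ with $\Omega(\gamma;a)\ne 0$ and the same ray are proportional. Assume that the generic $a$ are dense in $U$ and that $S_{\pm r}$ do not depend on $a$. Let $f_{\pm,k}^{\gamma'}\in\mathbb Q$ be the coefficients of the formal expansions $\log(S_{\pm r}X_{\gamma_k}/X_{\gamma_k})=\sum_{\gamma'}f_{\pm,k}^{\gamma'}X_{\gamma'}$, $k=1,2$. For $R>0$, $v\in\mathbb C^2$ and $\gamma=p\gamma_1+q\gamma_2$ put $v_\gamma=pv_1+qv_2$ and $\mathcal X^{\rm sf}_\gamma(a,\zeta,v)=\exp(\pi RZ_\gamma(a)/\zeta+iv_\gamma+\pi R\zeta\overline{Z_\gamma(a)})$. For $\Phi=\Phi(a,\theta,\zeta)\in\mathbb C^2$, with $a\in U$, $\theta=(\theta_1,\theta_2)\in\mathbb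 R^2$ and $\zeta\in\mathbb P^1$, define $T\Phi$ for $\zeta\notin r\cup -r$ by $$(T\Phi)_k=\theta_k-\frac1{4\pi}\Big\{\sum_{\gamma'}f_{+,k}^{\gamma'}\int_r\frac{d\zeta'}{\zeta'}\frac{\zeta'+\zeta}{\zeta'-\zeta}\mathcal X^{\rm sf}_{\gamma'}(a,\zeta',\Phi(\zeta'))+\sum_{\gamma'}f_{-,k}^{\gamma'}\int_{-r}\frac{d\zeta'}{\zeta'}\frac{\zeta'+\zeta}{\zeta'-\zeta}\mathcal X^{\rm sf}_{\gamma'}(a,\zeta',\Phi(\zeta'))\Big\},$$ and for $\zeta\in r\cup -r$ as the limit from the right-hand (clockwise) side of the ray. Let $\Theta^{(0)}=\theta$ and $\Theta^{(\nu+1)}=T\Theta^{(\nu)}$. Let $\mathscr X$ be the completion, in the sup norm, of the space of bounded functions $U\times(\mathbb R/2\pi\mathbb Z)^2\times\mathbb P^1\to\mathbb C^2$ that are smooth on $U\times(\mathbb R/2\pi\mathbb Z)^2$ for each $\zeta\in\mathbb P^1$; $\mathbb C^2$ has the maximum norm. For $\varepsilon>0$ let $\mathscr B_\varepsilon$ be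 the set of all $\Phi$ with $\sup\|\Phi-\theta\|\le\varepsilon$ that, for each $a$ and $\theta$, are holomorphic in $\zeta$ on the two open half-planes bounded by $r\cup-r$ and are continuous up to each of the rays $r$, $-r$ from its clockwise side. **Theorem.** Let $0<\varepsilon\le\log 2$. There is $R_0>0$ such that for all $R\ge R_0$: 1. for $\Phi\in\mathscr B_\varepsilon$ all integrals and sums in the definition of $T\Phi$ converge absolutely for $\zeta\notin r\cup-r$; $T$ maps $\mathscr B_\varepsilon$ to itself and is a contraction in the sup norm: there is $q<1$ with $\sup\|T\Phi-T\Psi\|\le q\,\sup\|\Phi-\Psi\|$ for $\Phi,\Psi\in\mathscr B_\varepsilon$; 2. all $\Theta^{(\nu)}$ lie in $\mathscr B_\varepsilon$, all $\Theta^{(\nu)}-\theta$ lie in $\mathscr X$, and they converge in $\mathscr X$; that is, $\Theta^{(\nu)}\to\Theta$, where $\Theta-\theta\in\mathscr X$. Moreover $\Theta\in\mathscr B_\varepsilon$ and $T\Theta=\Theta$; 3. $\Theta$ is holomorphic in $\zeta$ on each of the two open half-planes bounded by $r\cup -r$, and its restriction to each of them extends continuously to the closed half-plane in $\mathbb P^1$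 (including $0$ and $\infty$), where this extension agrees with $\Theta$ except possibly on the one boundary ray whose counterclockwise side is that half-plane; 4. for every $\zeta\in\mathbb P^1$, $\Theta$ is $C^\infty$ in $(a,\bar a,\theta_1,\theta_2)$ on $U\times\mathbb R^2$, and so are the extensions of item 3 for every $\zeta$ in the respective closed half-plane. -/

import Mathlib

open scoped ContDiff Topology ComplexConjugate

noncomputable section

namespace StokesRH

/-! ### The lattice -/

/-- The charge lattice `ℤγ₁ ⊕ ℤγ₂`; `(p, q)` stands for `pγ₁ + qγ₂`. It carries the norm
`max |p| |q|` (all norms on `ℤ²` are equivalent). -/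
abbrev Charge : Type := ℤ × ℤ

/-- The antisymmetric pairing with `⟨γ₁, γ₂⟩ = 1`. -/
def pairing (γ δ : Charge) : ℤ := γ.1 * δ.2 - γ.2 * δ.1

/-- The basis `γ₁, γ₂`. -/
def basis (k : Fin 2) : Charge := if k = 0 then (1, 0) else (0, 1)

/-- Extension of a pair of numbers to a homomorphism: `v_γ = p v₁ + q v₂` for `γ = pγ₁ + qγ₂`. -/
def lin (γ : Charge) (v : Fin 2 → ℂ) : ℂ := (γ.1 : ℂ) * v 0 + (γ.2 : ℂ) * v 1

/-! ### Formal series in the monomials `X_γ` and formal automorphisms -/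

/-- Formal series `∑ F γ X_γ`. Below only series occur for which all the sums over the lattice
are finite. -/
abbrev Series : Type := Charge → ℚ

/-- Product of formal series, `X_γ X_δ = X_{γ+δ}`. -/
def smulS (F G : Series) : Series := fun γ => ∑ᶠ δ : Charge, F δ * G (γ - δ)

/-- Powers of a formal series. -/
def spow (F : Series) : ℕ → Series
  | 0 => Pi.single 0 1
  | n + 1 => smulS F (spow F n)

/-- Exponential of a formal series. -/
def sexp (F : Series) : Series := fun γ => ∑ᶠ n : ℕ, spow F n γ / (n.factorial : ℚ)

/-- `log (1 - X_γ) = - ∑_{j ≥ 1} X_{jγ} / j`. -/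
def logOneSub (γ : Charge) : Series :=
  fun δ => - ∑ᶠ (j : ℕ) (_ : 0 < j ∧ j • γ = δ), (1 / (j : ℚ))

/-- A formal automorphism `X_γ ↦ X_γ exp (E γ)`, given by its logarithm `γ ↦ E γ`. -/
abbrev Aut : Type := Charge → Series

/-- The automorphism `E` applied to a series: `∑ F δ X_δ ↦ ∑ F δ X_δ exp (E δ)`. -/
def Aut.app (E : Aut) (F : Series) : Series := fun γ => ∑ᶠ δ : Charge, F δ * sexp (E δ) (γ - δ)

/-- Composition of automorphisms: `X_γ ↦ E (X_γ exp (E' γ)) = X_γ exp (E γ + E (E' γ))`. -/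
def Aut.comp (E E' : Aut) : Aut := fun γ => E γ + E.app (E' γ)

/-- The power `K_γ ^ n` of the transformation `K_γ X_{γ'} = X_{γ'} (1 - X_γ) ^ ⟨γ', γ⟩`. -/
def K (γ : Charge) (n : ℤ) : Aut := fun γ' => ((n * pairing γ' γ : ℤ) : ℚ) • logOneSub γ

/-- The ordered product `K_{γ₁}^{Ω γ₁} ∘ (K_{γ₂}^{Ω γ₂} ∘ ⋯)` along a list. -/
def prodK (Ω : Charge → ℤ) : List Charge → Aut
  | [] => 0
  | γ :: L => (K γ (Ω γ)).comp (prodK Ω L)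

/-! ### Half-planes and rays -/

/-- The ray `{s e : s > 0}`. -/
def ray (e : ℂ) : Set ℂ := {ζ | ∃ s : ℝ, 0 < s ∧ ζ = s * e}

/-- The open half-plane to the left of the ray through `e` (its counterclockwise side). The
clockwise side is `halfPlane (-e)`. -/
def halfPlane (e : ℂ) : Set ℂ := {ζ | 0 < (ζ * conj e).im}

/-- The closure of `halfPlane e` in the Riemann sphere. -/
def closedHalfPlane (e : ℂ) : Set (OnePoint ℂ) :=
  {OnePoint.infty} ∪ ((↑) : ℂ → OnePoint ℂ) '' {ζ | 0 ≤ (ζ * conj e).im}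

/-! ### Monodromy data -/

/-- Monodromy data over `U ⊆ ℂ`. The integers `Ω a γ` may depend on `a`. -/
structure MonodromyData (U : Set ℂ) where
  /-- the homomorphism `γ ↦ Z_γ` into the holomorphic functions on `U` -/
  Z : Charge →+ (ℂ → ℂ)
  Z_holo : ∀ γ, DifferentiableOn ℂ (Z γ) U
  /-- the integers `Ω(γ; a)` -/
  Ω : ℂ → Charge → ℤ
  Ω_neg : ∀ a ∈ U, ∀ γ, Ω a (-γ) = Ω a γ
  /-- support property -/
  support : ∃ c : ℝ, 0 < c ∧ ∀ a ∈ U, ∀ γ, Ω a γ ≠ 0 → c * ‖γ‖ < ‖Z γ a‖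
  /-- tameness: at most exponential growth -/
  tame : ∃ A B : ℝ, ∀ a ∈ U, ∀ γ, |(Ω a γ : ℝ)| ≤ A * Real.exp (B * ‖γ‖)

variable {U : Set ℂ}

/-- `r = ray e` and `-r = ray (-e)` are admissible rays: for all `a ∈ U`, every ray
`ℓ_γ(a) = {-t Z_γ(a) : t > 0}` with `Ω(γ; a) ≠ 0` makes with `r` or with `-r` an acute angle,
which is bounded away from a right angle. -/
def MonodromyData.AdmissibleRay (D : MonodromyData U) (e : ℂ) : Prop :=
  ‖e‖ = 1 ∧ ∃ κ : ℝ, 0 < κ ∧ ∀ a ∈ U, ∀ γ, D.Ω a γ ≠ 0 →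
    κ * ‖D.Z γ a‖ ≤ |(D.Z γ a * conj e).re|

/-- `a` is generic (lies on no wall): the `γ` with `Ω(γ; a) ≠ 0` that define the same ray
`ℓ_γ(a)` are proportional to each other. -/
def MonodromyData.Generic (D : MonodromyData U) (a : ℂ) : Prop :=
  ∀ γ δ, D.Ω a γ ≠ 0 → D.Ω a δ ≠ 0 → SameRay ℝ (D.Z γ a) (D.Z δ a) → pairing γ δ = 0

/-- `L` lists the `γ` with `‖γ‖ ≤ N`, `Ω(γ; a) ≠ 0` and `ℓ_γ(a)` in the half-plane of the vectors
that make an acute angle with `e`, in the counterclockwise order of the rays `ℓ_γ(a)`. -/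
def MonodromyData.IsRayList (D : MonodromyData U) (a e : ℂ) (N : ℕ) (L : List Charge) : Prop :=
  L.Nodup ∧
  (∀ γ, γ ∈ L ↔ ‖γ‖ ≤ (N : ℝ) ∧ D.Ω a γ ≠ 0 ∧ 0 < (-D.Z γ a * conj e).re) ∧
  L.Pairwise fun γ δ => 0 ≤ (conj (D.Z γ a) * D.Z δ a).im

/-- `f` is the formal expansion of the jump along `ray e` at the parameter `a`:
`log (S X_k / X_k) = ∑ f k γ X_γ`, `k = 1, 2`, where `S` is the product of the `K_γ ^ Ω(γ; a)` with
`ℓ_γ(a)` at an acute angle with `e`, in counterclockwise order. If the product is infinite, it is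
the limit, coefficient by coefficient, of its finite subproducts over `‖γ‖ ≤ N`. -/
def MonodromyData.IsJumpExpansion (D : MonodromyData U) (a e : ℂ) (f : Fin 2 → Charge → ℚ) : Prop :=
  ∀ k γ, ∀ᶠ N : ℕ in Filter.atTop, ∀ L, D.IsRayList a e N L →
    prodK (D.Ω a) L (basis k) γ = f k γ

/-- The jumps along `ray e` and `ray (-e)` do not depend on the parameter, and `fp`, `fm` are the
coefficients of their expansions. The product that defines a jump makes sense at the generic
parameters, which are dense. -/
def MonodromyData.Isomonodromic (D : MonodromyData U) (e : ℂ) (fp fm : Fin 2 → Charge → ℚ) : Prop :=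
  U ⊆ closure {a | a ∈ U ∧ D.Generic a} ∧
  ∀ a ∈ U, D.Generic a → D.IsJumpExpansion a e fp ∧ D.IsJumpExpansion a (-e) fm

/-! ### The integral equation -/

/-- Functions of `a`, of (lifts to `ℝ` of) the torus coordinates `θ₁, θ₂`, and of `ζ ∈ ℙ¹`. -/
abbrev Field : Type := ℂ → (ℝ × ℝ) → OnePoint ℂ → (Fin 2 → ℂ)

/-- The field `Θ = θ`. -/
def theta : Field := fun _ θ _ k => if k = 0 then (θ.1 : ℂ) else (θ.2 : ℂ)

/-- The semiflat function `exp (π R Z_γ / ζ + i v_γ + π R ζ conj Z_γ)`. -/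
def MonodromyData.Xsf (D : MonodromyData U) (R : ℝ) (γ : Charge) (a : ℂ) (v : Fin 2 → ℂ) (ζ : ℂ) : ℂ :=
  Complex.exp (Real.pi * R * D.Z γ a / ζ + Complex.I * lin γ v
    + Real.pi * R * ζ * conj (D.Z γ a))

/-- `(ζ' + ζ) / (ζ' - ζ)`, with the value `-1` at `ζ = ∞`. -/
def kernel (ζ' : ℂ) (ζ : OnePoint ℂ) : ℂ :=
  ζ.elim (-1) fun z => (ζ' + z) / (ζ' - z)

/-- The integrand, at `ζ' = s e` with `dζ' / ζ' = ds / s`. -/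
def MonodromyData.integrand (D : MonodromyData U) (R : ℝ) (Φ : Field) (a : ℂ) (θ : ℝ × ℝ)
    (ζ : OnePoint ℂ) (γ : Charge) (e : ℂ) (s : ℝ) : ℂ :=
  kernel (s * e) ζ * D.Xsf R γ a (Φ a θ ((s * e : ℂ) : OnePoint ℂ)) (s * e) / s

/-- `f^γ ∫ K(ζ, ζ') X^sf_γ(a, ζ', Φ)` along `ray e`. -/
def MonodromyData.term (D : MonodromyData U) (R : ℝ) (Φ : Field) (a : ℂ) (θ : ℝ × ℝ)
    (ζ : OnePoint ℂ) (f : Charge → ℚ) (e : ℂ) (γ : Charge) : ℂ :=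
  (f γ : ℂ) * ∫ s in Set.Ioi (0 : ℝ), D.integrand R Φ a θ ζ γ e s

/-- The right-hand side of the integral equation, for `ζ` off the two rays. -/
def MonodromyData.rhs (D : MonodromyData U) (e : ℂ) (fp fm : Fin 2 → Charge → ℚ) (R : ℝ) (Φ : Field)
    (a : ℂ) (θ : ℝ × ℝ) (ζ : OnePoint ℂ) : Fin 2 → ℂ :=
  fun k => theta a θ ζ k - 1 / (4 * Real.pi) *
    (∑' γ, D.term R Φ a θ ζ (fp k) e γ + ∑' γ, D.term R Φ a θ ζ (fm k) (-e) γ)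

open Classical in
/-- The map whose iterates are considered. On the rays `r = ray e` and `-r = ray (-e)`, where the
right-hand side jumps, the value is the limit `Θ⁻` from the right-hand (clockwise) side; this is
the boundary value that enters the jump condition `Y⁺ = S Y⁻`, and hence the integrals. -/
def MonodromyData.step (D : MonodromyData U) (e : ℂ) (fp fm : Fin 2 → Charge → ℚ) (R : ℝ) (Φ : Field) :
    Field := fun a θ ζ =>
  if ζ ∈ ((↑) : ℂ → OnePoint ℂ) '' ray e then
    Filter.limUnder (𝓝[((↑) : ℂ → OnePoint ℂ) '' halfPlane (-e)] ζ) (D.rhs e fp fm R Φ a θ)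
  else if ζ ∈ ((↑) : ℂ → OnePoint ℂ) '' ray (-e) then
    Filter.limUnder (𝓝[((↑) : ℂ → OnePoint ℂ) '' halfPlane e] ζ) (D.rhs e fp fm R Φ a θ)
  else D.rhs e fp fm R Φ a θ ζ

/-- The iterates `Θ^{(ν)}`, starting from `Θ^{(0)} = θ`. -/
def MonodromyData.iter (D : MonodromyData U) (e : ℂ) (fp fm : Fin 2 → Charge → ℚ) (R : ℝ) : ℕ → Field
  | 0 => theta
  | ν + 1 => D.step e fp fm R (D.iter e fp fm R ν)

/-! ### Function spaces -/

/-- The points of `U × T² × ℙ¹`. -/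
abbrev Pts (U : Set ℂ) : Type := U × (Real.Angle × Real.Angle) × OnePoint ℂ

/-- The bounded functions `U × T² × ℙ¹ → ℂ²` with the sup norm. -/
abbrev Bdd (U : Set ℂ) : Type := lp (fun _ : Pts U => Fin 2 → ℂ) ⊤

/-- The bounded functions that are smooth on `U × T²`, for every `ζ`. -/
def smoothBdd (U : Set ℂ) : Submodule ℂ (Bdd U) where
  carrier := {u | ∀ ζ : OnePoint ℂ, ∃ F : ℂ × (ℝ × ℝ) → (Fin 2 → ℂ),
    ContDiffOn ℝ ∞ F (U ×ˢ Set.univ) ∧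
    ∀ (a : U) (θ : ℝ × ℝ), F (a, θ) = u (a, ((θ.1 : Real.Angle), (θ.2 : Real.Angle)), ζ)}
  add_mem' := by
    intro u v hu hv ζ
    obtain ⟨F, hF, hFu⟩ := hu ζ
    obtain ⟨G, hG, hGv⟩ := hv ζ
    exact ⟨F + G, hF.add hG, fun a θ => by simp [hFu, hGv]⟩
  zero_mem' := fun ζ => ⟨0, contDiffOn_const, fun a θ => by simp⟩
  smul_mem' := by
    intro c u hu ζ
    obtain ⟨F, hF, hFu⟩ := hu ζ
    exact ⟨c • F, hF.const_smul c, fun a θ => by simp [hFu]⟩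

/-- The Banach space `𝒳`: the completion of `smoothBdd U` in the sup norm, that is, its closure in
the complete space of the bounded functions. -/
def XSpace (U : Set ℂ) : Submodule ℂ (Bdd U) := (smoothBdd U).topologicalClosure

/-- `Φ - θ` is the function `u` on `U × T² × ℙ¹`. -/
def Represents (Φ : Field) (u : Bdd U) : Prop :=
  ∀ (a : U) (θ : ℝ × ℝ) (ζ : OnePoint ℂ),
    u (a, ((θ.1 : Real.Angle), (θ.2 : Real.Angle)), ζ) = Φ a θ ζ - theta a θ ζ

/-- The fields on which the map acts: `‖Φ - θ‖ ≤ ε`, and `Φ` is holomorphic in `ζ` on the two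
half-planes cut out by `ray e` and `ray (-e)`, and continuous up to either ray from the right-hand
(clockwise) side. -/
def InBall (U : Set ℂ) (e : ℂ) (ε : ℝ) (Φ : Field) : Prop :=
  ∀ a ∈ U, ∀ θ : ℝ × ℝ,
    (∀ ζ, ‖Φ a θ ζ - theta a θ ζ‖ ≤ ε) ∧
    ∀ σ : ℂ, σ = e ∨ σ = -e →
      DifferentiableOn ℂ (fun ζ : ℂ => Φ a θ ζ) (halfPlane σ) ∧
      ContinuousOn (fun ζ : ℂ => Φ a θ ζ) (halfPlane (-σ) ∪ ray σ)

/-- All the integrals and sums in the right-hand side of the integral equation converge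
absolutely, for every `ζ` off the two rays. -/
def MonodromyData.Converges (D : MonodromyData U) (e : ℂ) (fp fm : Fin 2 → Charge → ℚ) (R : ℝ)
    (Φ : Field) : Prop :=
  ∀ a ∈ U, ∀ θ : ℝ × ℝ, ∀ ζ : OnePoint ℂ, ζ ∉ ((↑) : ℂ → OnePoint ℂ) '' (ray e ∪ ray (-e)) →
    ∀ k,
      (∀ γ, fp k γ ≠ 0 →
        MeasureTheory.IntegrableOn (D.integrand R Φ a θ ζ γ e) (Set.Ioi 0)) ∧
      (∀ γ, fm k γ ≠ 0 →
        MeasureTheory.IntegrableOn (D.integrand R Φ a θ ζ γ (-e)) (Set.Ioi 0)) ∧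
      Summable (D.term R Φ a θ ζ (fp k) e) ∧ Summable (D.term R Φ a θ ζ (fm k) (-e))

end StokesRH

end

/-! The integral equation is a fixed point problem whose data are the jump functions `log (S X_k /
X_k)` on the two rays. The proof has three ingredients.

Coefficients. The `f k γ` grow at most exponentially in `‖γ‖` and vanish unless `Z_γ(a)` lies, for
every `a ∈ U`, in a fixed closed sector around the direction opposite to the ray. Formal series are
measured by a weighted `ℓ¹` norm with weight `exp (-ρ h γ)`, `h γ = -Re (Z_γ(a) conj σ)`, on a cone
of charges and weight `⊤` off it. Applying one factor of the product costs an increase of `ρ`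
proportional to the size of that factor. Support property and tameness make the sizes summable once
the initial `ρ` is large, so the finite products are bounded uniformly (`wnorm_prodK_le`,
`jump_bounds_at`). Since `f` does not depend on `a`, the sector condition passes from the dense
generic parameters to all of `U` by continuity.

The operator. The semiflat functions decay not only on the ray but in a thin sector on its clockwise
side, where the fields of the ball are holomorphic; hence so are the jump functions. The Cauchy
integral over the ray can therefore be moved to the other edge of the sector. If the pole `ζ` is not
crossed, nothing changes (`rayInt_eq_of_notMem`); if it is, the residue contributes `-4πi h(ζ)`
(`rayInt_eq_of_mem`). Near the ray the kernel on the new contour is bounded, so one obtains boundary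
values from both sides, continuity up to the closed half-planes including `0` and `∞`, and a bound
in the sup norm (`norm_rightInt_le`). The Cauchy operator is not bounded in the sup norm for general
densities; holomorphy in the sector replaces Hölder estimates. For large `R` the jump functions and
their Lipschitz constants are so small that the map preserves the ball and contracts by `1/2`.

Smoothness. Replace `(a, conj a, θ₁, θ₂)` by independent complex variables, with `conj Z_γ(conj b)`
in place of `conj Z_γ(a)`. The two points `a` and `conj b` lie in `U` separately and satisfy the
same sector bounds, so all estimates persist with the same constants. The iterates are holomorphic
in the complexified parameters, and so is their uniform limit; restricted to the real parameters it
is smooth. Thus the equation never has to be differentiated. The limit on either closed half-plane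
is smooth for the same reason, because the boundary values are given by integrals over rotated rays.

Translating `θ` by a period translates every iterate by it, as the semiflat functions do not change;
hence `Θ - θ` lives on the torus. -/

namespace StokesRH

open Filter Metric Set MeasureTheory
open scoped ENNReal

/-! ### Holomorphic functions of several variables: Cauchy estimates, limits, integrals, smoothness.
-/

section SeveralVariables

variable {E F : Type*} [NormedAddCommGroup E] [NormedSpace ℂ E]
  [NormedAddCommGroup F] [NormedSpace ℂ F]

/-- Cauchy's estimate for the Fréchet derivative, with a non-optimal constant. -/
theorem norm_fderiv_le_of_forall_mem_ball {f : E → F} {x : E} {r M : ℝ} (hr : 0 < r)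
    (hf : DifferentiableOn ℂ f (ball x r)) (hM : ∀ y ∈ ball x r, ‖f y‖ ≤ M) :
    ‖fderiv ℂ f x‖ ≤ 2 * M / r := by
  have hM0 : 0 ≤ M := (norm_nonneg _).trans (hM x (mem_ball_self hr))
  refine ContinuousLinearMap.opNorm_le_bound _ (by positivity) fun v => ?_
  rcases eq_or_ne v 0 with rfl | hv
  · simp
  have hv' : 0 < ‖v‖ := norm_pos_iff.2 hv
  -- Half the admissible radius, so that the closed disc `x + z v`, `‖z‖ ≤ s`, stays inside the open
  -- ball; this is the source of the factor 2.
  set s : ℝ := r / (2 * ‖v‖) with hs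
  have hs0 : 0 < s := by positivity
  have hmem : ∀ z ∈ closedBall (0 : ℂ) s, x + z • v ∈ ball x r := by
    intro z hz
    rw [mem_ball, dist_self_add_left, norm_smul]
    have : ‖z‖ ≤ s := by simpa using hz
    calc ‖z‖ * ‖v‖ ≤ s * ‖v‖ := by gcongr
      _ = r / 2 := by rw [hs]; field_simp
      _ < r := by linarith
  have hd : DifferentiableOn ℂ (fun z : ℂ => f (x + z • v)) (closedBall 0 s) :=
    hf.comp (by fun_prop) hmem
  have h1 := Complex.norm_deriv_le_of_forall_mem_sphere_norm_le (f := fun z : ℂ => f (x + z • v))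
    (C := M) hs0 (hd.diffContOnCl_ball subset_rfl)
    (fun z hz => hM _ (hmem z (sphere_subset_closedBall hz)))
  have h2 : HasDerivAt (fun z : ℂ => f (x + z • v)) (fderiv ℂ f x v) 0 := by
    have h3 : HasFDerivAt f (fderiv ℂ f x) (x + (0 : ℂ) • v) := by
      rw [zero_smul, add_zero]
      exact ((hf x (mem_ball_self hr)).differentiableAt (ball_mem_nhds x hr)).hasFDerivAt
    have h4 : HasDerivAt (fun z : ℂ => x + z • v) v 0 := by
      simpa using ((hasDerivAt_id (0 : ℂ)).smul_const v).const_add x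
    exact h3.comp_hasDerivAt (0 : ℂ) h4
  rw [h2.deriv] at h1
  refine h1.trans (le_of_eq ?_)
  rw [hs]; field_simp

/-- A uniform limit of holomorphic functions of several variables is holomorphic. -/
theorem differentiableOn_of_tendstoUniformlyOn [CompleteSpace F] {ι : Type*} {l : Filter ι}
    [l.NeBot] {f : ι → E → F} {g : E → F} {W : Set E} (hW : IsOpen W)
    (hf : ∀ n, DifferentiableOn ℂ (f n) W) (h : TendstoUniformlyOn f g l W) :
    DifferentiableOn ℂ g W := by
  intro x hx
  obtain ⟨r, hr, hrW⟩ : ∃ r > 0, ball x (r + r) ⊆ W := by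
    obtain ⟨r, hr, hrW⟩ := Metric.isOpen_iff.1 hW x hx
    exact ⟨r / 2, half_pos hr, by rwa [add_halves]⟩
  have hsub : ∀ y ∈ ball x r, ball y r ⊆ W := fun y hy =>
    (ball_subset_ball' (by rw [mem_ball] at hy; linarith)).trans hrW
  have hyW : ∀ y ∈ ball x r, y ∈ W := fun y hy => hsub y hy (mem_ball_self hr)
  -- Cauchy's estimate on balls of radius `r` around the points of `ball x r` turns a uniform bound
  -- for `f m - f n` into one for the derivatives; the tolerance `ε r / 4` gives `ε / 2`.
  have hC : UniformCauchySeqOn (fun n => fderiv ℂ (f n)) l (ball x r) := by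
    intro u hu
    obtain ⟨ε, hε, hεu⟩ := Metric.mem_uniformity_dist.1 hu
    have := h.uniformCauchySeqOn _ (Metric.dist_mem_uniformity (show 0 < ε * r / 4 by positivity))
    filter_upwards [this] with m hm y hy
    apply hεu
    rw [dist_eq_norm]
    have hd : ∀ n, DifferentiableAt ℂ (f n) y := fun n =>
      (hf n y (hyW y hy)).differentiableAt (hW.mem_nhds (hyW y hy))
    have := norm_fderiv_le_of_forall_mem_ball (f := f m.1 - f m.2) (x := y) (M := ε * r / 4) hr
      (((hf _).sub (hf _)).mono (hsub y hy))
      (fun z hz => by simpa [dist_eq_norm] using (hm z (hsub y hy hz)).le)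
    rw [fderiv_sub (hd _) (hd _)] at this
    refine this.trans_lt ?_
    rw [show 2 * (ε * r / 4) / r = ε / 2 by field_simp; ring]
    linarith
  have hlim : ∀ y : E, ∃ L : E →L[ℂ] F, y ∈ ball x r →
      Tendsto (fun n => fderiv ℂ (f n) y) l (𝓝 L) := by
    intro y
    by_cases hy : y ∈ ball x r
    · obtain ⟨L, hL⟩ := CompleteSpace.complete (hC.cauchy_map hy)
      exact ⟨L, fun _ => hL⟩
    · exact ⟨0, fun h => absurd h hy⟩
  choose g' hg' using hlim
  have := hasFDerivAt_of_tendstoUniformlyOn (𝕜 := ℂ) isOpen_ball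
    (hC.tendstoUniformlyOn_of_tendsto fun y hy => hg' y hy)
    (fun n y hy => ((hf n y (hyW y hy)).differentiableAt (hW.mem_nhds (hyW y hy))).hasFDerivAt)
    (fun y hy => h.tendsto_at (hyW y hy)) (mem_ball_self hr)
  exact this.differentiableAt.differentiableWithinAt

/-- A normally convergent series of holomorphic functions of several variables is holomorphic. -/
theorem differentiableOn_tsum_of_norm_le [CompleteSpace F] {ι : Type*} {f : ι → E → F}
    {u : ι → ℝ} (hu : Summable u) {W : Set E} (hW : IsOpen W)
    (hf : ∀ n, DifferentiableOn ℂ (f n) W) (h : ∀ n, ∀ x ∈ W, ‖f n x‖ ≤ u n) :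
    DifferentiableOn ℂ (fun x => ∑' n, f n x) W := by
  refine differentiableOn_of_tendstoUniformlyOn hW (fun s => ?_)
    (tendstoUniformlyOn_tsum hu h)
  exact DifferentiableOn.fun_sum fun n _ => hf n

/-- The derivatives of a holomorphic function in constant directions are holomorphic. -/
theorem differentiableOn_fderiv_apply [CompleteSpace F] {f : E → F} {W : Set E} (hW : IsOpen W)
    (hf : DifferentiableOn ℂ f W) (v : E) : DifferentiableOn ℂ (fun x => fderiv ℂ f x v) W := by
  intro x hx
  obtain ⟨r, hr, hrW, hrM⟩ : ∃ r > 0, ball x (4 * r) ⊆ W ∧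
      ∀ y ∈ ball x (4 * r), ‖f y‖ ≤ ‖f x‖ + 1 := by
    have hc := ((hf x hx).differentiableAt (hW.mem_nhds hx)).continuousAt.norm
    have h1 : ∀ᶠ y in 𝓝 x, ‖f y‖ < ‖f x‖ + 1 :=
      hc.eventually (gt_mem_nhds (by linarith))
    obtain ⟨r, hr, h⟩ := Metric.eventually_nhds_iff_ball.1 (h1.and (hW.mem_nhds hx))
    refine ⟨r / 4, by positivity, fun y hy => (h y ?_).2, fun y hy => (h y ?_).1.le⟩ <;>
    · convert hy using 2; ring
  set M := ‖f x‖ + 1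
  have hM0 : 0 ≤ M := by positivity
  have hdiff : ∀ y ∈ ball x (4 * r), DifferentiableAt ℂ f y := fun y hy =>
    (hf y (hrW hy)).differentiableAt (hW.mem_nhds (hrW hy))
  have hB : ∀ y ∈ ball x (3 * r), ‖fderiv ℂ f y‖ ≤ 2 * M / r := fun y hy => by
    have hs : ball y r ⊆ ball x (4 * r) := ball_subset_ball' (by rw [mem_ball] at hy; linarith)
    exact norm_fderiv_le_of_forall_mem_ball hr (hf.mono (hs.trans hrW)) fun z hz => hrM z (hs hz)
  have hLip : ∀ y ∈ ball x (3 * r), ∀ z ∈ ball x (3 * r),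
      ‖f z - f y‖ ≤ 2 * M / r * ‖z - y‖ := fun y hy z hz =>
    (convex_ball x (3 * r)).norm_image_sub_le_of_norm_fderiv_le (𝕜 := ℂ)
      (fun w hw => hdiff w (ball_subset_ball (by linarith) hw)) hB hy hz
  -- The derivative is Lipschitz: Cauchy's estimate applies to the holomorphic function `f (· + w) -
  -- f`, which is `O(‖w‖)` by `hLip`.
  have hLip2 : ∀ y ∈ ball x r, ∀ w : E, ‖w‖ < r →
      ‖fderiv ℂ f (y + w) - fderiv ℂ f y‖ ≤ 2 * (2 * M / r * ‖w‖) / r := by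
    intro y hy w hw
    rw [mem_ball] at hy
    have hin : ∀ z ∈ ball y r, z ∈ ball x (3 * r) ∧ z + w ∈ ball x (3 * r) := by
      intro z hz
      rw [mem_ball] at hz
      have h1 : dist z x ≤ dist z y + dist y x := dist_triangle _ _ _
      have h2 : dist (z + w) x ≤ dist (z + w) z + dist z x := dist_triangle _ _ _
      rw [dist_self_add_left] at h2
      exact ⟨by rw [mem_ball]; linarith, by rw [mem_ball]; linarith⟩
    have h4 : ball x (3 * r) ⊆ ball x (4 * r) := ball_subset_ball (by linarith)
    have hcomp : DifferentiableOn ℂ (fun z => f (z + w)) (ball y r) := fun z hz =>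
      ((hdiff _ (h4 (hin z hz).2)).comp z (by fun_prop)).differentiableWithinAt
    have hy' := hin y (mem_ball_self hr)
    have := norm_fderiv_le_of_forall_mem_ball (f := fun z => f (z + w) - f z)
      (M := 2 * M / r * ‖w‖) hr
      (hcomp.sub (hf.mono fun z hz => hrW (h4 (hin z hz).1)))
      (fun z hz => by simpa using hLip z (hin z hz).1 (z + w) (hin z hz).2)
    rwa [fderiv_fun_sub ((hcomp y (mem_ball_self hr)).differentiableAt (ball_mem_nhds y hr))
      (hdiff _ (h4 hy'.1)), fderiv_comp_add_right] at this
  set K := 2 * (2 * M / r) / r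
  -- Step lengths tending to `0` with `t n * ‖v‖ < r`. The difference quotients along `v` are
  -- holomorphic and converge uniformly to the directional derivative, with error `O(t n)` by the
  -- Lipschitz bound for the derivative.
  set t : ℕ → ℝ := fun n => r / (‖v‖ + 1) * (1 / ((n : ℝ) + 2)) with ht
  have ht0 : ∀ n, 0 < t n := fun n => by positivity
  have htv : ∀ n, t n * ‖v‖ < r := fun n => by
    have h1 : ‖v‖ / (‖v‖ + 1) ≤ 1 := (div_le_one (by positivity)).2 (by linarith)
    have h2 : (1 : ℝ) / ((n : ℝ) + 2) < 1 := (div_lt_one (by positivity)).2 (by have := n.cast_nonneg (α := ℝ); linarith)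
    calc t n * ‖v‖ = r * (‖v‖ / (‖v‖ + 1)) * (1 / ((n : ℝ) + 2)) := by rw [ht]; field_simp
      _ ≤ r * 1 * (1 / ((n : ℝ) + 2)) := by gcongr
      _ < r * 1 * 1 := by gcongr
      _ = r := by ring
  have htlim : Tendsto t atTop (𝓝 0) := by
    have : Tendsto (fun n : ℕ => 1 / ((n : ℝ) + 2)) atTop (𝓝 0) :=
      (tendsto_const_nhds (x := (1 : ℝ))).div_atTop
        (tendsto_atTop_add_const_right _ _ tendsto_natCast_atTop_atTop)
    simpa [ht] using this.const_mul (r / (‖v‖ + 1))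
  have hquot : ∀ n, ∀ y ∈ ball x r,
      ‖((t n : ℂ)⁻¹ • (f (y + (t n : ℂ) • v) - f y)) - fderiv ℂ f y v‖ ≤ K * ‖v‖ * ‖v‖ * t n := by
    intro n y hy
    have hseg : ∀ z ∈ segment ℝ y (y + (t n : ℂ) • v), ∃ w : E, z = y + w ∧ ‖w‖ ≤ t n * ‖v‖ := by
      intro z hz
      refine ⟨z - y, by abel, ?_⟩
      have := norm_sub_le_of_mem_segment hz
      simpa [norm_smul, abs_of_pos (ht0 n)] using this
    have hball : ∀ w : E, ‖w‖ ≤ t n * ‖v‖ → y + w ∈ ball x (4 * r) := by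
      intro w hw
      have h2 : dist (y + w) x ≤ dist (y + w) y + dist y x := dist_triangle _ _ _
      rw [dist_self_add_left] at h2
      have := htv n
      rw [mem_ball] at hy ⊢
      linarith
    have := (convex_segment (𝕜 := ℝ) y (y + (t n : ℂ) • v)).norm_image_sub_le_of_norm_fderiv_le'
      (𝕜 := ℂ) (f := f) (φ := fderiv ℂ f y) (C := K * (t n * ‖v‖))
      (fun z hz => by
        obtain ⟨w, rfl, hw⟩ := hseg z hz
        exact hdiff _ (hball w hw))
      (fun z hz => by
        obtain ⟨w, rfl, hw⟩ := hseg z hz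
        refine (hLip2 y hy w (hw.trans_lt (htv n))).trans ?_
        calc 2 * (2 * M / r * ‖w‖) / r = K * ‖w‖ := by simp only [K]; ring
          _ ≤ K * (t n * ‖v‖) := by gcongr)
      (left_mem_segment ℝ _ _) (right_mem_segment ℝ _ _)
    have htc : (t n : ℂ) ≠ 0 := by exact_mod_cast (ht0 n).ne'
    have heq : ((t n : ℂ)⁻¹ • (f (y + (t n : ℂ) • v) - f y)) - fderiv ℂ f y v
        = (t n : ℂ)⁻¹ • (f (y + (t n : ℂ) • v) - f y -
            fderiv ℂ f y (y + (t n : ℂ) • v - y)) := by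
      rw [add_sub_cancel_left, map_smul, smul_sub _ _ ((t n : ℂ) • _), inv_smul_smul₀ htc]
    rw [heq, norm_smul, norm_inv, Complex.norm_real, Real.norm_of_nonneg (ht0 n).le,
      inv_mul_le_iff₀ (ht0 n)]
    refine this.trans (le_of_eq ?_)
    rw [add_sub_cancel_left, norm_smul, Complex.norm_real, Real.norm_of_nonneg (ht0 n).le]
    ring
  have hunif : TendstoUniformlyOn
      (fun n y => (t n : ℂ)⁻¹ • (f (y + (t n : ℂ) • v) - f y))
      (fun y => fderiv ℂ f y v) atTop (ball x r) := by
    rw [Metric.tendstoUniformlyOn_iff]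
    intro ε hε
    have h0 : Tendsto (fun n => K * ‖v‖ * ‖v‖ * t n) atTop (𝓝 0) := by
      simpa using htlim.const_mul (K * ‖v‖ * ‖v‖)
    filter_upwards [h0.eventually (gt_mem_nhds hε)] with n hn y hy
    rw [dist_comm, dist_eq_norm]
    exact (hquot n y hy).trans_lt hn
  refine (differentiableOn_of_tendstoUniformlyOn isOpen_ball (fun n => ?_) hunif x
    (mem_ball_self hr)).differentiableAt (ball_mem_nhds x hr) |>.differentiableWithinAt
  intro y hy
  have hy2 : y + (t n : ℂ) • v ∈ ball x (4 * r) := by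
    have h2 : dist (y + (t n : ℂ) • v) x ≤ dist (y + (t n : ℂ) • v) y + dist y x :=
      dist_triangle _ _ _
    rw [dist_self_add_left, norm_smul, Complex.norm_real, Real.norm_of_nonneg (ht0 n).le] at h2
    have := htv n
    rw [mem_ball] at hy ⊢
    linarith
  have hy1 : y ∈ ball x (4 * r) := ball_subset_ball (by linarith) hy
  exact ((((hdiff _ hy2).comp y (by fun_prop)).sub (hdiff y hy1)).const_smul _).differentiableWithinAt

/-- A holomorphic function of several variables is smooth. -/
theorem contDiffOn_of_differentiableOn [CompleteSpace F] [FiniteDimensional ℂ E] {f : E → F}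
    {W : Set E} (hW : IsOpen W) (hf : DifferentiableOn ℂ f W) : ContDiffOn ℂ ∞ f W := by
  rw [contDiffOn_infty]
  intro n
  induction n generalizing f with
  | zero => exact contDiffOn_zero.2 hf.continuousOn
  | succ n ih =>
    push_cast
    refine contDiffOn_succ_of_fderiv_apply hf (fun h => absurd h (by simp)) fun y => ?_
    refine (ih (differentiableOn_fderiv_apply hW hf y)).congr fun x hx => ?_
    rw [fderivWithin_of_isOpen hW hx]

/-- A dominated integral of holomorphic functions of several variables is holomorphic. -/
theorem differentiableOn_integral_of_norm_le [CompleteSpace F] [FiniteDimensional ℂ E]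
    {α : Type*} [MeasurableSpace α] {μ : Measure α} {f : E → α → F} {W : Set E} (hW : IsOpen W)
    (hm : ∀ x ∈ W, AEStronglyMeasurable (f x) μ) {bound : α → ℝ} (hb : Integrable bound μ)
    (hle : ∀ x ∈ W, ∀ a, ‖f x a‖ ≤ bound a)
    (hf : ∀ a, DifferentiableOn ℂ (fun x => f x a) W) :
    DifferentiableOn ℂ (fun x => ∫ a, f x a ∂μ) W := by
  intro x hx
  obtain ⟨r, hr, hrW⟩ : ∃ r > 0, ball x (r + r) ⊆ W := by
    obtain ⟨r, hr, hrW⟩ := Metric.isOpen_iff.1 hW x hx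
    exact ⟨r / 2, half_pos hr, by rwa [add_halves]⟩
  have hsub : ∀ y ∈ ball x r, ball y r ⊆ W := fun y hy =>
    (ball_subset_ball' (by rw [mem_ball] at hy; linarith)).trans hrW
  have hyW : ∀ y ∈ ball x r, y ∈ W := fun y hy => hsub y hy (mem_ball_self hr)
  have hfd : ∀ a, ∀ y ∈ ball x r, HasFDerivAt (fun x => f x a) (fderiv ℂ (fun x => f x a) y) y :=
    fun a y hy => ((hf a y (hyW y hy)).differentiableAt (hW.mem_nhds (hyW y hy))).hasFDerivAt
  -- Measurability of the derivative in the integration variable is not assumed: each directional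
  -- derivative is a pointwise limit of measurable difference quotients, and a finite basis of `E`
  -- assembles them into the full derivative.
  have hv : ∀ v : E, AEStronglyMeasurable (fun a => fderiv ℂ (fun x => f x a) x v) μ := by
    intro v
    set t : ℕ → ℂ := fun n => ((r / (‖v‖ + 1) * (1 / ((n : ℝ) + 2)) : ℝ) : ℂ) with ht
    have htn : ∀ n, ‖t n‖ = r / (‖v‖ + 1) * (1 / ((n : ℝ) + 2)) := fun n => by
      rw [ht, Complex.norm_real, Real.norm_of_nonneg (by positivity)]
    have ht0 : ∀ n, t n ≠ 0 := fun n => by rw [← norm_pos_iff, htn]; positivity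
    have htv : ∀ n, x + t n • v ∈ ball x r := fun n => by
      have h1 : ‖v‖ / (‖v‖ + 1) ≤ 1 := (div_le_one (by positivity)).2 (by linarith)
      have h2 : (1 : ℝ) / ((n : ℝ) + 2) < 1 := (div_lt_one (by positivity)).2
        (by have := n.cast_nonneg (α := ℝ); linarith)
      rw [mem_ball, dist_self_add_left, norm_smul, htn]
      calc r / (‖v‖ + 1) * (1 / ((n : ℝ) + 2)) * ‖v‖
          = r * (‖v‖ / (‖v‖ + 1)) * (1 / ((n : ℝ) + 2)) := by field_simp
        _ ≤ r * 1 * (1 / ((n : ℝ) + 2)) := by gcongr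
        _ < r * 1 * 1 := by gcongr
        _ = r := by ring
    have htlim : Tendsto t atTop (𝓝[≠] 0) := by
      rw [tendsto_nhdsWithin_iff]
      refine ⟨?_, Eventually.of_forall ht0⟩
      rw [tendsto_zero_iff_norm_tendsto_zero]
      simp_rw [htn]
      have : Tendsto (fun n : ℕ => 1 / ((n : ℝ) + 2)) atTop (𝓝 0) :=
        (tendsto_const_nhds (x := (1 : ℝ))).div_atTop
          (tendsto_atTop_add_const_right _ _ tendsto_natCast_atTop_atTop)
      simpa using this.const_mul (r / (‖v‖ + 1))
    refine aestronglyMeasurable_of_tendsto_ae atTop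
      (f := fun n a => (t n)⁻¹ • (f (x + t n • v) a - f x a)) (fun n => ?_) ?_
    · exact ((hm _ (hyW _ (htv n))).sub (hm x hx)).const_smul _
    · refine Eventually.of_forall fun a => ?_
      have h4 : HasDerivAt (fun z : ℂ => x + z • v) v 0 := by
        simpa using ((hasDerivAt_id (0 : ℂ)).smul_const v).const_add x
      have h3 : HasFDerivAt (fun x => f x a) (fderiv ℂ (fun x => f x a) x) (x + (0 : ℂ) • v) := by
        rw [zero_smul, add_zero]; exact hfd a x (mem_ball_self hr)
      have := (h3.comp_hasDerivAt (0 : ℂ) h4).tendsto_slope_zero.comp htlim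
      simpa [Function.comp_def] using this
  have hF' : AEStronglyMeasurable (fun a => fderiv ℂ (fun x => f x a) x) μ := by
    set b := Module.finBasis ℂ E
    have : (fun a => fderiv ℂ (fun x => f x a) x) = fun a => ∑ i,
        ContinuousLinearMap.smulRightL ℂ E F (LinearMap.toContinuousLinearMap (b.coord i))
          (fderiv ℂ (fun x => f x a) x (b i)) := by
      funext a
      ext v
      conv_lhs => rw [← b.sum_repr v, map_sum]
      simp
    rw [this]
    refine Finset.aestronglyMeasurable_fun_sum _ fun i _ => ?_
    exact (ContinuousLinearMap.continuous _).comp_aestronglyMeasurable (hv (b i))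
  have := hasFDerivAt_integral_of_dominated_of_fderiv_le (𝕜 := ℂ) (μ := μ) (F := f) (x₀ := x)
    (F' := fun y a => fderiv ℂ (fun x => f x a) y) (bound := fun a => 2 * bound a / r)
    (ball_mem_nhds x hr) (by filter_upwards [hW.mem_nhds hx] with y hy using hm y hy)
    (hb.mono' (hm x hx) (Eventually.of_forall (hle x hx))) hF'
    (Eventually.of_forall fun a y hy => norm_fderiv_le_of_forall_mem_ball hr
      ((hf a).mono (hsub y hy)) fun z hz => hle z (hsub y hy hz) a)
    ((hb.const_mul 2).div_const r)
    (Eventually.of_forall fun a y hy => hfd a y hy)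
  exact this.differentiableAt.differentiableWithinAt

end SeveralVariables

/-! ### Weighted `ℓ¹` norms of formal series. -/

section FormalSeries

/-- A `finsum` with infinite support is `0` by default, so the bound needs no finiteness. This lets
all estimates of formal products and exponentials be made without first showing that the lattice
sums are finite. -/
theorem enorm_finsum_le {ι : Type*} (f : ι → ℚ) : ‖∑ᶠ i, f i‖ₑ ≤ ∑' i, ‖f i‖ₑ := by
  by_cases h : (Function.support f).Finite
  · rw [finsum_eq_sum _ h]
    exact (enorm_sum_le _ _).trans (ENNReal.sum_le_tsum _)
  · rw [finsum_of_infinite_support h]; simp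

/-- The weighted `ℓ¹` norm of a formal series. -/
noncomputable def wnorm (w : Charge → ℝ≥0∞) (F : Series) : ℝ≥0∞ := ∑' γ, ‖F γ‖ₑ * w γ

theorem le_wnorm (w : Charge → ℝ≥0∞) (F : Series) (γ : Charge) : ‖F γ‖ₑ * w γ ≤ wnorm w F :=
  ENNReal.le_tsum γ

theorem wnorm_add_le (w : Charge → ℝ≥0∞) (F G : Series) :
    wnorm w (F + G) ≤ wnorm w F + wnorm w G := by
  rw [wnorm, wnorm, wnorm, ← ENNReal.tsum_add]
  refine ENNReal.tsum_le_tsum fun γ => ?_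
  rw [← add_mul]
  gcongr
  exact enorm_add_le _ _

theorem wnorm_smul (w : Charge → ℝ≥0∞) (q : ℚ) (F : Series) :
    wnorm w (q • F) = ‖q‖ₑ * wnorm w F := by
  rw [wnorm, wnorm, ← ENNReal.tsum_mul_left]
  congr 1; funext γ
  rw [Pi.smul_apply, smul_eq_mul, enorm_mul, mul_assoc]

variable {w : Charge → ℝ≥0∞}

/-- Submultiplicativity of the weight and interchange of the sums. A constant family `G` gives
products of series; `G δ = sexp (E δ)` gives the action of an automorphism. -/
theorem wnorm_shift_le (hw : ∀ γ δ, w (γ + δ) ≤ w γ * w δ) (a : Charge → ℚ)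
    (G : Charge → Series) :
    wnorm w (fun γ => ∑ᶠ δ, a δ * G δ (γ - δ)) ≤ ∑' δ, ‖a δ‖ₑ * w δ * wnorm w (G δ) := by
  calc wnorm w (fun γ => ∑ᶠ δ, a δ * G δ (γ - δ))
      ≤ ∑' γ, ∑' δ, ‖a δ‖ₑ * w δ * (‖G δ (γ - δ)‖ₑ * w (γ - δ)) := by
        refine ENNReal.tsum_le_tsum fun γ => ?_
        refine (mul_le_mul_left (enorm_finsum_le _) _).trans ?_
        rw [← ENNReal.tsum_mul_right]
        refine ENNReal.tsum_le_tsum fun δ => ?_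
        rw [enorm_mul]
        calc ‖a δ‖ₑ * ‖G δ (γ - δ)‖ₑ * w γ
            ≤ ‖a δ‖ₑ * ‖G δ (γ - δ)‖ₑ * (w δ * w (γ - δ)) := by
              gcongr
              simpa using hw δ (γ - δ)
          _ = _ := by ring
    _ = ∑' δ, ‖a δ‖ₑ * w δ * wnorm w (G δ) := by
        rw [ENNReal.tsum_comm]
        congr 1; funext δ
        rw [ENNReal.tsum_mul_left]
        congr 1
        exact (Equiv.subRight δ).tsum_eq (fun γ => ‖G δ γ‖ₑ * w γ)

theorem wnorm_smulS_le (hw : ∀ γ δ, w (γ + δ) ≤ w γ * w δ) (F G : Series) :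
    wnorm w (smulS F G) ≤ wnorm w F * wnorm w G := by
  refine (wnorm_shift_le hw F fun _ => G).trans (le_of_eq ?_)
  rw [ENNReal.tsum_mul_right, wnorm, wnorm]

theorem wnorm_spow_le (hw : ∀ γ δ, w (γ + δ) ≤ w γ * w δ) (h0 : w 0 ≤ 1) (F : Series) (n : ℕ) :
    wnorm w (spow F n) ≤ wnorm w F ^ n := by
  induction n with
  | zero =>
    rw [pow_zero, spow, wnorm, tsum_eq_single 0]
    · simpa using h0
    · intro γ hγ; simp [hγ]
  | succ n ih =>
    rw [pow_succ', spow]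
    exact (wnorm_smulS_le hw _ _).trans (by gcongr)

theorem wnorm_sexp_le (hw : ∀ γ δ, w (γ + δ) ≤ w γ * w δ) (h0 : w 0 ≤ 1) {F : Series} {r : ℝ}
    (hr : 0 ≤ r) (hF : wnorm w F ≤ ENNReal.ofReal r) :
    wnorm w (sexp F) ≤ ENNReal.ofReal (Real.exp r) := by
  calc wnorm w (sexp F) ≤ ∑' γ, ∑' n : ℕ, ‖spow F n γ‖ₑ * ‖(n.factorial : ℚ)⁻¹‖ₑ * w γ := by
        refine ENNReal.tsum_le_tsum fun γ => ?_
        refine (mul_le_mul_left (enorm_finsum_le _) _).trans (le_of_eq ?_)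
        rw [← ENNReal.tsum_mul_right]
        simp_rw [div_eq_mul_inv, enorm_mul]
    _ = ∑' n : ℕ, ‖(n.factorial : ℚ)⁻¹‖ₑ * wnorm w (spow F n) := by
        rw [ENNReal.tsum_comm]
        congr 1; funext n
        rw [wnorm, ← ENNReal.tsum_mul_left]
        congr 1; funext γ; ring
    _ ≤ ∑' n : ℕ, ENNReal.ofReal (r ^ n / n.factorial) := by
        refine ENNReal.tsum_le_tsum fun n => ?_
        have h1 : ‖(n.factorial : ℚ)⁻¹‖ₑ = ENNReal.ofReal ((n.factorial : ℝ)⁻¹) := by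
          rw [← ofReal_norm, ← Rat.norm_cast_real]
          push_cast
          rw [Real.norm_of_nonneg (by positivity)]
        rw [h1, div_eq_inv_mul, ENNReal.ofReal_mul (by positivity), ENNReal.ofReal_pow hr]
        gcongr
        exact (wnorm_spow_le hw h0 F n).trans (by gcongr)
    _ = ENNReal.ofReal (Real.exp r) := by
        rw [← ENNReal.ofReal_tsum_of_nonneg (fun n => by positivity)
          (Real.summable_pow_div_factorial r), Real.exp_eq_exp_ℝ, NormedSpace.exp_eq_tsum_div]

/-- The coefficients `1 / j` are at most 1 and `w (j • γ) ≤ w γ ^ j`, so the geometric series `w γ /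
(1 - w γ)` is a majorant; the ratio is at most `1/2`. -/
theorem wnorm_logOneSub_le (hw : ∀ γ δ, w (γ + δ) ≤ w γ * w δ) (h0 : w 0 ≤ 1) {γ : Charge}
    (hγ : w γ ≤ 1 / 2) : wnorm w (logOneSub γ) ≤ 2 * w γ := by
  have hpow : ∀ j : ℕ, w (j • γ) ≤ w γ ^ j := by
    intro j
    induction j with
    | zero => simpa using h0
    | succ j ih =>
      rw [succ_nsmul, pow_succ]
      exact (hw _ _).trans (by gcongr)
  classical
  calc wnorm w (logOneSub γ)
      ≤ ∑' δ, ∑' j : ℕ, (if 0 < j ∧ j • γ = δ then w δ else 0) := by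
        refine ENNReal.tsum_le_tsum fun δ => ?_
        rw [logOneSub, enorm_neg]
        refine (mul_le_mul_left (enorm_finsum_le _) _).trans ?_
        rw [← ENNReal.tsum_mul_right]
        refine ENNReal.tsum_le_tsum fun j => ?_
        split_ifs with h
        · rw [finsum_eq_if, if_pos h, ← ofReal_norm]
          refine mul_le_of_le_one_left' ?_
          rw [ENNReal.ofReal_le_one, ← Rat.norm_cast_real]
          push_cast
          rw [Real.norm_of_nonneg (by positivity)]
          exact div_le_one_of_le₀ (by exact_mod_cast h.1) (by positivity)
        · rw [finsum_eq_if, if_neg h]; simp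
    _ = ∑' j : ℕ, ∑' δ, (if 0 < j ∧ j • γ = δ then w δ else 0) := ENNReal.tsum_comm
    _ = ∑' j : ℕ, (if 0 < j then w (j • γ) else 0) := by
        congr 1; funext j
        rw [tsum_eq_single (j • γ)]
        · simp
        · intro δ hδ; exact if_neg fun h => hδ h.2.symm
    _ = ∑' j : ℕ, w ((j + 1) • γ) := by
        rw [tsum_eq_zero_add' ENNReal.summable]; simp
    _ ≤ ∑' j : ℕ, w γ ^ (j + 1) := ENNReal.tsum_le_tsum fun j => hpow _
    _ = w γ * (1 - w γ)⁻¹ := by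
        simp_rw [pow_succ']
        rw [ENNReal.tsum_mul_left, ENNReal.tsum_geometric]
    _ ≤ 2 * w γ := by
        rw [mul_comm]
        gcongr
        rw [ENNReal.inv_le_iff_inv_le]
        calc (2 : ℝ≥0∞)⁻¹ = 1 - 1 / 2 := by rw [one_div, ENNReal.one_sub_inv_two]
          _ ≤ 1 - w γ := by gcongr

theorem wnorm_app_le (hw : ∀ γ δ, w (γ + δ) ≤ w γ * w δ) (E : Aut) (F : Series) :
    wnorm w (E.app F) ≤ ∑' δ, ‖F δ‖ₑ * w δ * wnorm w (sexp (E δ)) :=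
  wnorm_shift_le hw F fun δ => sexp (E δ)

theorem norm_basis (k : Fin 2) : ‖basis k‖ = 1 := by
  fin_cases k <;> simp [basis, Prod.norm_def]

theorem one_le_norm_of_ne_zero {γ : Charge} (h : γ ≠ 0) : 1 ≤ ‖γ‖ := by
  rw [Prod.norm_def, le_max_iff]
  by_contra! h'
  apply h
  have : ∀ n : ℤ, ‖n‖ < 1 → n = 0 := fun n hn => by
    rw [Int.norm_eq_abs] at hn
    have : |n| < 1 := by exact_mod_cast hn
    exact Int.abs_lt_one_iff.1 this
  exact Prod.ext (this _ h'.1) (this _ h'.2)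

theorem abs_pairing_le (γ δ : Charge) : |(pairing γ δ : ℝ)| ≤ 2 * ‖γ‖ * ‖δ‖ := by
  have h : ∀ γ : Charge, |(γ.1 : ℝ)| ≤ ‖γ‖ ∧ |(γ.2 : ℝ)| ≤ ‖γ‖ := fun γ => by
    rw [Prod.norm_def, Int.norm_eq_abs, Int.norm_eq_abs]
    exact ⟨le_max_left _ _, le_max_right _ _⟩
  rw [pairing]
  push_cast
  calc |(γ.1 : ℝ) * δ.2 - γ.2 * δ.1| ≤ |(γ.1 : ℝ) * δ.2| + |(γ.2 : ℝ) * δ.1| := abs_sub _ _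
    _ = |(γ.1 : ℝ)| * |(δ.2 : ℝ)| + |(γ.2 : ℝ)| * |(δ.1 : ℝ)| := by rw [abs_mul, abs_mul]
    _ ≤ ‖γ‖ * ‖δ‖ + ‖γ‖ * ‖δ‖ := by
      gcongr
      exacts [(h γ).1, (h δ).2, (h γ).2, (h δ).1]
    _ = _ := by ring

/-- Since `2 max |p| |q| ≥ |p| + |q|`, the threshold 2 allows comparison with a product of two
one-dimensional series. -/
theorem summable_exp_neg_norm {t : ℝ} (ht : 2 ≤ t) :
    Summable fun γ : Charge => Real.exp (-t * ‖γ‖) := by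
  have h1 : Summable fun n : ℤ => Real.exp (-1 * |(n : ℝ)|) := by
    have h2 : Summable fun n : ℕ => Real.exp (-1 * |((n : ℤ) : ℝ)|) := by
      simpa [mul_comm] using Real.summable_exp_neg_nat
    exact Summable.of_nat_of_neg h2 (by simpa using h2)
  refine (h1.mul_of_nonneg h1 (fun _ => (Real.exp_pos _).le) (fun _ => (Real.exp_pos _).le)).of_nonneg_of_le
    (fun _ => (Real.exp_pos _).le) fun γ => ?_
  rw [← Real.exp_add, Real.exp_le_exp]
  have h3 : |(γ.1 : ℝ)| ≤ ‖γ‖ := by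
    rw [Prod.norm_def, ← Int.norm_eq_abs]; exact le_max_left _ _
  have h4 : |(γ.2 : ℝ)| ≤ ‖γ‖ := by
    rw [Prod.norm_def, ← Int.norm_eq_abs]; exact le_max_right _ _
  nlinarith [norm_nonneg γ]

end FormalSeries

/-! ### Exponential weights on a cone and bounds for ordered products. -/

section ConeWeights

variable (P : AddSubmonoid Charge) (h : Charge →+ ℝ)

open Classical in
/-- The exponential weight on a cone, infinite off the cone. -/
noncomputable def coneWeight (ρ : ℝ) (γ : Charge) : ℝ≥0∞ :=
  if γ ∈ P then ENNReal.ofReal (Real.exp (-(ρ * h γ))) else ⊤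

theorem coneWeight_of_mem (ρ : ℝ) {γ : Charge} (hγ : γ ∈ P) :
    coneWeight P h ρ γ = ENNReal.ofReal (Real.exp (-(ρ * h γ))) := if_pos hγ

theorem coneWeight_of_notMem (ρ : ℝ) {γ : Charge} (hγ : γ ∉ P) : coneWeight P h ρ γ = ⊤ :=
  if_neg hγ

theorem coneWeight_ne_zero (ρ : ℝ) (γ : Charge) : coneWeight P h ρ γ ≠ 0 := by
  by_cases hγ : γ ∈ P
  · rw [coneWeight_of_mem P h ρ hγ]
    simpa using Real.exp_pos _
  · rw [coneWeight_of_notMem P h ρ hγ]; simp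

theorem coneWeight_zero (ρ : ℝ) : coneWeight P h ρ 0 ≤ 1 := by
  rw [coneWeight_of_mem P h ρ P.zero_mem]; simp

/-- Equality on the cone, because `h` is additive. If a summand is off the cone, the right-hand side
is infinite, since the weight never vanishes. -/
theorem coneWeight_add_le (ρ : ℝ) (γ δ : Charge) :
    coneWeight P h ρ (γ + δ) ≤ coneWeight P h ρ γ * coneWeight P h ρ δ := by
  by_cases hγ : γ ∈ P
  · by_cases hδ : δ ∈ P
    · rw [coneWeight_of_mem P h ρ hγ, coneWeight_of_mem P h ρ hδ,
        coneWeight_of_mem P h ρ (P.add_mem hγ hδ), ← ENNReal.ofReal_mul (Real.exp_pos _).le,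
        ← Real.exp_add, map_add]
      refine le_of_eq ?_
      ring_nf
    · rw [coneWeight_of_notMem P h ρ hδ, ENNReal.mul_top (coneWeight_ne_zero _ _ _ _)]
      exact le_top
  · rw [coneWeight_of_notMem P h ρ hγ, ENNReal.top_mul (coneWeight_ne_zero _ _ _ _)]
    exact le_top

variable {P h}

/-- The infinite weight off the cone makes a single norm bound control the support as well as the
size. -/
theorem mem_of_wnorm_coneWeight_lt_top {ρ : ℝ} {F : Series} (hF : wnorm (coneWeight P h ρ) F < ⊤)
    {γ : Charge} (hγ : F γ ≠ 0) : γ ∈ P := by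
  by_contra hP
  have := (le_wnorm (coneWeight P h ρ) F γ).trans_lt hF
  rw [coneWeight_of_notMem P h ρ hP, ENNReal.mul_top (by simpa using hγ)] at this
  exact lt_irrefl _ this

variable {c : ℝ}

/-- The 4 is the 2 of `abs_pairing_le` times the 2 of `wnorm_logOneSub_le`. What matters is that the
bound is linear in `‖δ‖`: its exponential can be absorbed into the weight of `X_δ`. -/
theorem wnorm_K_le {ρ : ℝ} {γ : Charge} (hγP : γ ∈ P) (hγ : Real.exp (-(ρ * h γ)) ≤ 1 / 2)
    (n : ℤ) (δ : Charge) :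
    wnorm (coneWeight P h ρ) (K γ n δ) ≤
      ENNReal.ofReal (4 * |(n : ℝ)| * ‖γ‖ * Real.exp (-(ρ * h γ)) * ‖δ‖) := by
  rw [K, wnorm_smul]
  have h1 : ‖((n * pairing δ γ : ℤ) : ℚ)‖ₑ ≤ ENNReal.ofReal (|(n : ℝ)| * (2 * ‖δ‖ * ‖γ‖)) := by
    rw [← ofReal_norm, ← Rat.norm_cast_real]
    push_cast
    rw [norm_mul, Real.norm_eq_abs, Real.norm_eq_abs]
    gcongr
    exact abs_pairing_le δ γ
  have h2 := wnorm_logOneSub_le (coneWeight_add_le P h ρ) (coneWeight_zero P h ρ) (γ := γ) (by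
    rw [coneWeight_of_mem P h ρ hγP]
    refine (ENNReal.ofReal_le_ofReal hγ).trans (le_of_eq ?_)
    rw [ENNReal.ofReal_div_of_pos (by norm_num)]; simp)
  rw [coneWeight_of_mem P h ρ hγP] at h2
  refine (mul_le_mul' h1 h2).trans (le_of_eq ?_)
  rw [show (2 : ℝ≥0∞) = ENNReal.ofReal 2 by simp, ← ENNReal.ofReal_mul (by norm_num),
    ← ENNReal.ofReal_mul (by positivity)]
  congr 1; ring

theorem logOneSub_zero {γ : Charge} (hγ : γ ≠ 0) : logOneSub γ 0 = 0 := by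
  have : ∀ j : ℕ, ∑ᶠ (_ : 0 < j ∧ j • γ = 0), (1 / (j : ℚ)) = 0 := fun j => by
    rw [finsum_eq_if, if_neg]
    rintro ⟨hj, h0⟩
    rcases smul_eq_zero.1 h0 with h | h
    · omega
    · exact hγ h
  rw [logOneSub, finsum_eq_zero_of_forall_eq_zero this, neg_zero]

/-- The size of `log (K_γ ^ n)` in the weighted norm. -/
noncomputable def factorSize (h : Charge →+ ℝ) (ρ : ℝ) (Ω : Charge → ℤ) (γ : Charge) : ℝ :=
  4 * |(Ω γ : ℝ)| * ‖γ‖ * Real.exp (-(ρ * h γ))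

theorem factorSize_nonneg (ρ : ℝ) (Ω : Charge → ℤ) (γ : Charge) : 0 ≤ factorSize h ρ Ω γ := by
  unfold factorSize; positivity

/-- A factor of size `η` multiplies `X_δ` by a series of norm at most `exp (η ‖δ‖) ≤ exp ((η / c) h
δ)`, so applying it is bounded from the norm with `ρ - η / c` to the norm with `ρ`. The logarithms
add under composition. Hence the norm of the product is at most the sum of the sizes, provided `ρ`
exceeds `ρ₀` by that sum over `c`, whatever the length or order of the list. -/
theorem wnorm_prodK_le (hc : 0 < c) (hP : ∀ γ ∈ P, c * ‖γ‖ ≤ h γ) {ρ₀ : ℝ}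
    (hρ₀ : 1 ≤ ρ₀ * c) (Ω : Charge → ℤ) (k : Fin 2) (L : List Charge)
    (hL : ∀ γ ∈ L, γ ∈ P ∧ γ ≠ 0) (ρ : ℝ) (hρ : ρ₀ + (L.map (factorSize h ρ₀ Ω)).sum / c ≤ ρ) :
    wnorm (coneWeight P h ρ) (prodK Ω L (basis k)) ≤
      ENNReal.ofReal (L.map (factorSize h ρ₀ Ω)).sum ∧ prodK Ω L (basis k) 0 = 0 := by
  have hρ₀0 : 0 < ρ₀ := pos_of_mul_pos_left (one_pos.trans_le hρ₀) hc.le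
  have hpos : ∀ γ ∈ P, 0 ≤ h γ := fun γ hγ => (by positivity : 0 ≤ c * ‖γ‖).trans (hP γ hγ)
  induction L generalizing ρ with
  | nil => simp [prodK, wnorm]
  | cons γ L ih =>
    obtain ⟨⟨hγP, hγ0⟩, hL'⟩ := List.forall_mem_cons.1 hL
    rw [List.map_cons, List.sum_cons, add_div] at hρ
    rw [List.map_cons, List.sum_cons]
    set η := factorSize h ρ₀ Ω γ with hη
    have hη0 : 0 ≤ η := factorSize_nonneg _ _ _
    set S := (L.map (factorSize h ρ₀ Ω)).sum
    have hS0 : 0 ≤ S := List.sum_nonneg fun x hx => by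
      obtain ⟨γ, _, rfl⟩ := List.mem_map.1 hx
      exact factorSize_nonneg _ _ _
    have hρρ : ρ₀ ≤ ρ := by
      have h1 : 0 ≤ η / c := by positivity
      have h2 : 0 ≤ S / c := by positivity
      linarith
    -- `ρ₀ c ≥ 1` and `‖γ‖ ≥ 1` make the exponent at most `-1`; this puts the weight of `X_γ` below
    -- `1/2`, as the estimate of the logarithm requires.
    have hexp : ∀ ρ', ρ₀ ≤ ρ' → Real.exp (-(ρ' * h γ)) ≤ 1 / 2 := by
      intro ρ' hρ'
      have h1 : 1 ≤ ρ' * h γ := calc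
        1 ≤ ρ₀ * c * 1 := by linarith
        _ ≤ ρ₀ * c * ‖γ‖ := by gcongr; exact one_le_norm_of_ne_zero hγ0
        _ = ρ₀ * (c * ‖γ‖) := by ring
        _ ≤ ρ₀ * h γ := by gcongr; exact hP γ hγP
        _ ≤ ρ' * h γ := by gcongr; exact hpos γ hγP
      calc Real.exp (-(ρ' * h γ)) ≤ Real.exp (-1) := Real.exp_le_exp.2 (by linarith)
        _ ≤ 1 / 2 := by
          rw [Real.exp_neg, one_div]
          gcongr
          linarith [Real.add_one_le_exp 1]
    have hK : ∀ δ, wnorm (coneWeight P h ρ) (K γ (Ω γ) δ) ≤ ENNReal.ofReal (η * ‖δ‖) := by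
      intro δ
      refine (wnorm_K_le hγP (hexp ρ hρρ) (Ω γ) δ).trans (ENNReal.ofReal_le_ofReal ?_)
      rw [hη, factorSize]
      gcongr
      exact hpos γ hγP
    have hsexp : ∀ δ, wnorm (coneWeight P h ρ) (sexp (K γ (Ω γ) δ)) ≤
        ENNReal.ofReal (Real.exp (η * ‖δ‖)) := fun δ =>
      wnorm_sexp_le (coneWeight_add_le P h ρ) (coneWeight_zero P h ρ) (by positivity) (hK δ)
    -- The tail is estimated in the stronger norm with the smaller parameter; the difference of the
    -- two weights pays for `exp (η ‖δ‖)`.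
    obtain ⟨ih1, ih0⟩ := ih hL' (ρ - η / c) (by linarith)
    have happ : wnorm (coneWeight P h ρ) ((K γ (Ω γ)).app (prodK Ω L (basis k))) ≤
        ENNReal.ofReal S := by
      refine (wnorm_app_le (coneWeight_add_le P h ρ) _ _).trans (le_trans ?_ ih1)
      refine ENNReal.tsum_le_tsum fun δ => ?_
      rw [mul_assoc]
      gcongr
      by_cases hδ : δ ∈ P
      · rw [coneWeight_of_mem P h _ hδ, coneWeight_of_mem P h _ hδ]
        refine (mul_le_mul_right (hsexp δ) _).trans ?_
        rw [← ENNReal.ofReal_mul (Real.exp_pos _).le, ← Real.exp_add]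
        refine ENNReal.ofReal_le_ofReal (Real.exp_le_exp.2 ?_)
        have : η * ‖δ‖ ≤ η / c * h δ := by
          rw [div_mul_eq_mul_div, le_div_iff₀ hc]
          calc η * ‖δ‖ * c = η * (c * ‖δ‖) := by ring
            _ ≤ η * h δ := by gcongr; exact hP δ hδ
        linarith
      · rw [coneWeight_of_notMem P h (ρ - η / c) hδ]
        exact le_top
    refine ⟨?_, ?_⟩
    · rw [prodK, Aut.comp]
      refine (wnorm_add_le _ _ _).trans ?_
      rw [ENNReal.ofReal_add hη0 hS0]
      gcongr
      simpa [norm_basis] using hK (basis k)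
    · have h1 : K γ (Ω γ) (basis k) 0 = 0 := by simp [K, logOneSub_zero hγ0]
      -- A contribution to the constant coefficient needs both `δ` and `-δ` in the cone. There `h ≥
      -- c ‖·‖`, so `δ = 0`, and the constant coefficient of the tail vanishes by induction.
      have h2 : (K γ (Ω γ)).app (prodK Ω L (basis k)) 0 = 0 := by
        rw [Aut.app]
        refine finsum_eq_zero_of_forall_eq_zero fun δ => ?_
        by_contra hne
        obtain ⟨hF, hE⟩ := mul_ne_zero_iff.1 hne
        have hδ := mem_of_wnorm_coneWeight_lt_top (ih1.trans_lt ENNReal.ofReal_lt_top) hF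
        have hδ' := mem_of_wnorm_coneWeight_lt_top
          ((hsexp δ).trans_lt ENNReal.ofReal_lt_top) hE
        have h3 := hP δ hδ
        have h4 := hP _ hδ'
        rw [zero_sub, map_neg, norm_neg] at h4
        have : δ = 0 := by
          by_contra hδ0
          have := one_le_norm_of_ne_zero hδ0
          nlinarith
        rw [this] at hF
        exact hF ih0
      rw [prodK, Aut.comp, Pi.add_apply, h1, h2, add_zero]

end ConeWeights

/-! ### Support and growth of the jump coefficients. -/

section JumpBounds

variable {U : Set ℂ}

/-- The charges `γ` with `Z_γ` in a closed cone around the ray opposite to `ray σ`. -/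
noncomputable def chargeCone (z : Charge →+ ℂ) (σ : ℂ) (κ c : ℝ) (hκ : 0 ≤ κ) (hc : 0 ≤ c) :
    AddSubmonoid Charge where
  carrier := {γ | κ * ‖z γ‖ ≤ -(z γ * conj σ).re ∧ c * ‖γ‖ ≤ -(z γ * conj σ).re}
  zero_mem' := by simp
  add_mem' := by
    rintro γ δ ⟨h1, h2⟩ ⟨h3, h4⟩
    have h5 : -(z (γ + δ) * conj σ).re = -(z γ * conj σ).re + -(z δ * conj σ).re := by
      rw [map_add, add_mul, Complex.add_re]; ring
    refine ⟨?_, ?_⟩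
    · rw [h5, map_add]
      exact (mul_le_mul_of_nonneg_left (norm_add_le _ _) hκ).trans (by linarith)
    · rw [h5]
      exact (mul_le_mul_of_nonneg_left (norm_add_le _ _) hc).trans (by linarith)

theorem finite_norm_le (N : ℝ) : {γ : Charge | ‖γ‖ ≤ N}.Finite := by
  have : {γ : Charge | ‖γ‖ ≤ N} = Metric.closedBall 0 N := by ext; simp
  rw [this]
  exact (isCompact_closedBall _ _).finite_of_discrete

/-- `IsJumpExpansion` quantifies over all lists, so it has content only because a list exists.
Within the half-plane of positive real part the counterclockwise order is the order of the slopes.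
-/
theorem MonodromyData.exists_isRayList (D : MonodromyData U) (a σ : ℂ) (N : ℕ) :
    ∃ L, D.IsRayList a σ N L := by
  classical
  set s : Set Charge := {γ | ‖γ‖ ≤ (N : ℝ) ∧ D.Ω a γ ≠ 0 ∧ 0 < (-D.Z γ a * conj σ).re}
  have hs : s.Finite := (finite_norm_le N).subset fun γ hγ => hγ.1
  -- The tangent of the angle between `ℓ_γ(a)` and `σ`. Cross-multiplying `t γ ≤ t δ` gives the
  -- required imaginary part times `|σ|²`.
  set t : Charge → ℝ := fun γ => (-D.Z γ a * conj σ).im / (-D.Z γ a * conj σ).re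
  set le : Charge → Charge → Bool := fun γ δ => decide (t γ ≤ t δ)
  have hperm := List.mergeSort_perm hs.toFinset.toList le
  have hmem : ∀ γ, γ ∈ hs.toFinset.toList.mergeSort le ↔ γ ∈ s := fun γ => by
    rw [hperm.mem_iff]; simp
  refine ⟨hs.toFinset.toList.mergeSort le, hperm.nodup_iff.2 (Finset.nodup_toList _), hmem, ?_⟩
  have hsort := List.pairwise_mergeSort (le := le)
    (by simp only [le, decide_eq_true_eq]; exact fun a b c => le_trans)
    (by simp only [le, Bool.or_eq_true, decide_eq_true_eq]; exact fun a b => le_total _ _)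
    hs.toFinset.toList
  refine hsort.imp_of_mem fun {γ δ} hγ hδ hle => ?_
  have h1 := ((hmem γ).1 hγ).2.2
  have h2 := ((hmem δ).1 hδ).2.2
  have h3 : t γ ≤ t δ := by simpa [le] using hle
  rw [div_le_div_iff₀ h1 h2] at h3
  have hσ : 0 < Complex.normSq σ := by
    rw [Complex.normSq_pos]
    rintro rfl
    simp at h1
  simp only [Complex.mul_re, Complex.mul_im, Complex.neg_re, Complex.neg_im, Complex.conj_re,
    Complex.conj_im, Complex.normSq_apply] at *
  refine nonneg_of_mul_nonneg_right (a := σ.re * σ.re + σ.im * σ.im) ?_ hσ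
  nlinarith

/-- The bounds on a jump along `ray σ` that come from one generic parameter `a`. -/
theorem MonodromyData.jump_bounds_at (D : MonodromyData U) {a σ : ℂ} {κ c A B : ℝ}
    (hκ : 0 < κ) (hc : 0 < c)
    (hadm : ∀ γ, D.Ω a γ ≠ 0 → κ * ‖D.Z γ a‖ ≤ |(D.Z γ a * conj σ).re|)
    (hsupp : ∀ γ, D.Ω a γ ≠ 0 → c * ‖γ‖ < ‖D.Z γ a‖)
    (htame : ∀ γ, |(D.Ω a γ : ℝ)| ≤ A * Real.exp (B * ‖γ‖))
    {f : Fin 2 → Charge → ℚ} (hf : D.IsJumpExpansion a σ f) :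
    (∀ k γ, f k γ ≠ 0 → γ ≠ 0 ∧ κ * ‖D.Z γ a‖ ≤ -(D.Z γ a * conj σ).re ∧
      κ * c * ‖γ‖ ≤ -(D.Z γ a * conj σ).re) ∧
    ∃ C B' : ℝ, 0 ≤ C ∧ 0 ≤ B' ∧ ∀ k γ, |(f k γ : ℝ)| ≤ C * Real.exp (B' * ‖γ‖) := by
  set z : Charge →+ ℂ := (Pi.evalAddMonoidHom (fun _ : ℂ => ℂ) a).comp D.Z with hz
  have hzγ : ∀ γ, z γ = D.Z γ a := fun γ => rfl
  set P := chargeCone z σ κ (κ * c) hκ.le (by positivity) with hPdef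
  set h : Charge →+ ℝ :=
    { toFun := fun γ => -(z γ * conj σ).re
      map_zero' := by simp
      map_add' := fun γ δ => by rw [map_add, add_mul, Complex.add_re]; ring } with hh
  have hhγ : ∀ γ, h γ = -(D.Z γ a * conj σ).re := fun γ => rfl
  have hP : ∀ γ ∈ P, κ * c * ‖γ‖ ≤ h γ := fun γ hγ => hγ.2
  have hA : 0 ≤ |A| := abs_nonneg A
  -- So that `ρ₀ κ c ≥ |B| + 4`: this absorbs the growth `exp (B ‖γ‖)` of `Ω` and the factor `‖γ‖ ≤
  -- exp ‖γ‖`, and leaves the summable `exp (-2 ‖γ‖)`. The final summand also guarantees `ρ₀ κ c ≥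
  -- 1`.
  set ρ₀ : ℝ := max 0 (|B| + 3) / (κ * c) + 1 / (κ * c) with hρ₀def
  have hkc : 0 < κ * c := by positivity
  have hρ₀c : ρ₀ * (κ * c) = max 0 (|B| + 3) + 1 := by rw [hρ₀def]; field_simp
  have hρ₀0 : 0 ≤ ρ₀ := by positivity
  have hρ₀1 : 1 ≤ ρ₀ * (κ * c) := by rw [hρ₀c]; linarith [le_max_left 0 (|B| + 3)]
  set b : Charge → ℝ := fun γ => 4 * |A| * Real.exp (-2 * ‖γ‖) with hb
  have hbsum : Summable b := (summable_exp_neg_norm le_rfl).mul_left _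
  have hηb : ∀ γ ∈ P, factorSize h ρ₀ (D.Ω a) γ ≤ b γ := by
    intro γ hγ
    have hBle : B ≤ |B| := le_abs_self B
    calc factorSize h ρ₀ (D.Ω a) γ
        ≤ 4 * (|A| * Real.exp (B * ‖γ‖)) * Real.exp ‖γ‖ * Real.exp (-(ρ₀ * (κ * c * ‖γ‖))) := by
          unfold factorSize
          gcongr
          · exact (htame γ).trans (by gcongr; exact le_abs_self A)
          · linarith [Real.add_one_le_exp ‖γ‖]
          · exact hP γ hγ
      _ = 4 * |A| * Real.exp ((B + 1 - ρ₀ * (κ * c)) * ‖γ‖) := by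
          rw [mul_assoc, mul_assoc, mul_assoc, mul_assoc, ← Real.exp_add, ← Real.exp_add]
          ring_nf
      _ ≤ b γ := by
          change _ ≤ 4 * |A| * Real.exp (-2 * ‖γ‖)
          rw [hρ₀c]
          gcongr
          linarith [le_max_right 0 (|B| + 3)]
  set M := ∑' γ, b γ with hM
  have hM0 : 0 ≤ M := tsum_nonneg fun γ => by positivity
  -- The bound `M` for the total size is independent of the cutoff `N`, so the limit over `N`
  -- inherits it.
  have hlist : ∀ N L, D.IsRayList a σ N L → (∀ γ ∈ L, γ ∈ P ∧ γ ≠ 0) ∧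
      (L.map (factorSize h ρ₀ (D.Ω a))).sum ≤ M := by
    intro N L hL
    have h1 : ∀ γ ∈ L, γ ∈ P ∧ γ ≠ 0 := by
      intro γ hγ
      obtain ⟨-, hΩ, hpos⟩ := (hL.2.1 γ).1 hγ
      have hre : κ * ‖D.Z γ a‖ ≤ -(D.Z γ a * conj σ).re := by
        have := hadm γ hΩ
        rwa [abs_of_neg] at this
        rw [neg_mul, Complex.neg_re] at hpos; linarith
      refine ⟨⟨hre, ?_⟩, ?_⟩
      · refine le_trans ?_ hre
        rw [mul_assoc]
        gcongr
        exact (hsupp γ hΩ).le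
      · rintro rfl
        have := hsupp 0 hΩ
        simp at this
    refine ⟨h1, ?_⟩
    classical
    rw [← List.sum_toFinset _ hL.1]
    calc ∑ γ ∈ L.toFinset, factorSize h ρ₀ (D.Ω a) γ ≤ ∑ γ ∈ L.toFinset, b γ :=
          Finset.sum_le_sum fun γ hγ => hηb γ (h1 γ (List.mem_toFinset.1 hγ)).1
      _ ≤ M := hbsum.sum_le_tsum _ fun γ _ => by positivity
  set ρ₁ := ρ₀ + M / (κ * c) with hρ₁
  have hρ₁0 : 0 ≤ ρ₁ := by positivity
  -- The cutoff at which a coefficient stabilizes depends on that coefficient, so the bound is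
  -- transferred one coefficient at a time, phrased as the norm of a series with a single term.
  have key : ∀ k γ, wnorm (coneWeight P h ρ₁) (Pi.single γ (f k γ)) ≤ ENNReal.ofReal M ∧
      f k 0 = 0 := by
    intro k γ
    have hget : ∀ γ, ∃ L, ((∀ γ ∈ L, γ ∈ P ∧ γ ≠ 0) ∧
        (L.map (factorSize h ρ₀ (D.Ω a))).sum ≤ M) ∧ prodK (D.Ω a) L (basis k) γ = f k γ := by
      intro γ
      obtain ⟨N, hN⟩ := (hf k γ).exists
      obtain ⟨L, hL⟩ := D.exists_isRayList a σ N
      exact ⟨L, hlist N L hL, hN L hL⟩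
    have hbd : ∀ L : List Charge, ((∀ γ ∈ L, γ ∈ P ∧ γ ≠ 0) ∧
        (L.map (factorSize h ρ₀ (D.Ω a))).sum ≤ M) → _ := fun L hL =>
      wnorm_prodK_le hkc hP hρ₀1 (D.Ω a) k L hL.1 ρ₁ (by
        rw [hρ₁]; gcongr; exact hL.2)
    refine ⟨?_, ?_⟩
    · obtain ⟨L, hL, hLf⟩ := hget γ
      rw [wnorm, tsum_eq_single γ]
      · rw [Pi.single_eq_same, ← hLf]
        exact (le_wnorm _ _ _).trans ((hbd L hL).1.trans (ENNReal.ofReal_le_ofReal hL.2))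
      · intro δ hδ; rw [Pi.single_eq_of_ne hδ]; simp
    · obtain ⟨L, hL, hLf⟩ := hget 0
      rw [← hLf]; exact (hbd L hL).2
  have hmemP : ∀ k γ, f k γ ≠ 0 → γ ∈ P := fun k γ hγ =>
    mem_of_wnorm_coneWeight_lt_top ((key k γ).1.trans_lt ENNReal.ofReal_lt_top) (γ := γ)
      (by rwa [Pi.single_eq_same])
  refine ⟨fun k γ hγ => ⟨?_, hmemP k γ hγ⟩, ?_⟩
  · rintro rfl
    exact hγ (key k 0).2
  -- A linear upper bound of `h` turns the weighted estimate into exponential growth in `‖γ‖`. Its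
  -- constant depends on `a`.
  · have hhle : ∀ γ, h γ ≤ (‖D.Z (1, 0) a‖ + ‖D.Z (0, 1) a‖) * ‖σ‖ * ‖γ‖ := by
      intro γ
      have h1 : z γ = (γ.1 : ℂ) * z (1, 0) + (γ.2 : ℂ) * z (0, 1) := by
        conv_lhs => rw [show γ = γ.1 • ((1, 0) : Charge) + γ.2 • ((0, 1) : Charge) by
          ext <;> simp]
        rw [map_add, map_zsmul, map_zsmul, zsmul_eq_mul, zsmul_eq_mul]
      have h3 : ‖(γ.1 : ℂ)‖ ≤ ‖γ‖ := by
        rw [Prod.norm_def, Complex.norm_intCast, ← Int.norm_eq_abs]; exact le_max_left _ _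
      have h4 : ‖(γ.2 : ℂ)‖ ≤ ‖γ‖ := by
        rw [Prod.norm_def, Complex.norm_intCast, ← Int.norm_eq_abs]; exact le_max_right _ _
      calc h γ ≤ ‖z γ * conj σ‖ := (neg_le_abs _).trans (Complex.abs_re_le_norm _)
        _ = ‖z γ‖ * ‖σ‖ := by rw [norm_mul, Complex.norm_conj]
        _ ≤ (‖γ‖ * ‖z (1, 0)‖ + ‖γ‖ * ‖z (0, 1)‖) * ‖σ‖ := by
          gcongr
          rw [h1]
          refine (norm_add_le _ _).trans ?_
          rw [norm_mul, norm_mul]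
          gcongr
        _ = _ := by rw [hzγ, hzγ]; ring
    refine ⟨M, ρ₁ * ((‖D.Z (1, 0) a‖ + ‖D.Z (0, 1) a‖) * ‖σ‖), hM0, by positivity,
      fun k γ => ?_⟩
    by_cases hγ : f k γ = 0
    · rw [hγ]; simp only [Rat.cast_zero, abs_zero]; positivity
    · have h1 := (le_wnorm _ _ γ).trans (key k γ).1
      rw [Pi.single_eq_same, coneWeight_of_mem P h ρ₁ (hmemP k γ hγ), ← ofReal_norm,
        ← ENNReal.ofReal_mul (norm_nonneg _), ENNReal.ofReal_le_ofReal_iff hM0,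
        ← Rat.norm_cast_real, Real.norm_eq_abs, Real.exp_neg, ← div_eq_mul_inv,
        div_le_iff₀ (Real.exp_pos _)] at h1
      have h2 := mul_le_mul_of_nonneg_left (hhle γ) hρ₁0
      rw [← mul_assoc] at h2
      exact h1.trans (by gcongr)

/-- The properties of the coefficients of a jump along `ray σ` on which the analysis of the
integral equation rests. -/
structure MonodromyData.JumpBounds (D : MonodromyData U) (σ : ℂ) (f : Fin 2 → Charge → ℚ)
    (κ c C B : ℝ) : Prop where
  ne_zero : ∀ k γ, f k γ ≠ 0 → γ ≠ 0
  sector : ∀ k γ, f k γ ≠ 0 → ∀ a ∈ U, κ * ‖D.Z γ a‖ ≤ -(D.Z γ a * conj σ).re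
  growth : ∀ k γ, f k γ ≠ 0 → ∀ a ∈ U, c * ‖γ‖ ≤ -(D.Z γ a * conj σ).re
  coeff : ∀ k γ, |(f k γ : ℝ)| ≤ C * Real.exp (B * ‖γ‖)

/-- The growth bound for the coefficients is needed at one generic parameter only, as the
coefficients do not depend on it. The two linear inequalities hold at every generic parameter and
extend to `U` by density and continuity of `Z_γ`. -/
theorem MonodromyData.exists_jumpBounds (D : MonodromyData U) (hU : U.Nonempty) {e : ℂ}
    (he : D.AdmissibleRay e) {fp fm : Fin 2 → Charge → ℚ} (hf : D.Isomonodromic e fp fm) :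
    ∃ κ c C B : ℝ, 0 < κ ∧ 0 < c ∧ 0 ≤ C ∧ 0 ≤ B ∧ D.JumpBounds e fp κ c C B ∧
      D.JumpBounds (-e) fm κ c C B := by
  obtain ⟨-, κ, hκ, hadm⟩ := he
  obtain ⟨c, hc, hsupp⟩ := D.support
  obtain ⟨A, B, htame⟩ := D.tame
  obtain ⟨hdense, hjump⟩ := hf
  obtain ⟨a₀, ha₀, hgen₀⟩ : ∃ a, a ∈ U ∧ D.Generic a := by
    obtain ⟨a, ha⟩ := hU
    obtain ⟨b, hb⟩ := closure_nonempty_iff.1 ⟨a, hdense ha⟩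
    exact ⟨b, hb⟩
  have main : ∀ (σ : ℂ) (f : Fin 2 → Charge → ℚ),
      (∀ a ∈ U, ∀ γ, D.Ω a γ ≠ 0 → κ * ‖D.Z γ a‖ ≤ |(D.Z γ a * conj σ).re|) →
      (∀ a ∈ U, D.Generic a → D.IsJumpExpansion a σ f) →
      ∃ C B' : ℝ, 0 ≤ C ∧ 0 ≤ B' ∧ D.JumpBounds σ f κ (κ * c) C B' := by
    intro σ f hadm' hj
    have hat := fun a (ha : a ∈ U) (hg : D.Generic a) =>
      D.jump_bounds_at hκ hc (hadm' a ha) (hsupp a ha) (htame a ha) (hj a ha hg)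
    obtain ⟨h0, C, B', hC, hB', hcoeff⟩ := hat a₀ ha₀ hgen₀
    have hcont : ∀ γ, ContinuousOn (fun a => -(D.Z γ a * conj σ).re) U := fun γ =>
      (Complex.continuous_re.comp_continuousOn
        ((D.Z_holo γ).continuousOn.mul continuousOn_const)).neg
    have hextend : ∀ (g₁ g₂ : ℂ → ℝ), ContinuousOn g₁ U → ContinuousOn g₂ U →
        (∀ a ∈ U, D.Generic a → g₁ a ≤ g₂ a) → ∀ a ∈ U, g₁ a ≤ g₂ a := by
      intro g₁ g₂ h1 h2 hle a ha
      exact ContinuousWithinAt.closure_le (s := {a | a ∈ U ∧ D.Generic a}) (hdense ha)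
        ((h1 a ha).mono fun b hb => hb.1) ((h2 a ha).mono fun b hb => hb.1)
        fun b hb => hle b hb.1 hb.2
    refine ⟨C, B', hC, hB', fun k γ hγ => (h0 k γ hγ).1, fun k γ hγ => ?_, fun k γ hγ => ?_,
      hcoeff⟩
    · exact hextend _ _ ((D.Z_holo γ).continuousOn.norm.const_mul κ) (hcont γ)
        fun a ha hg => ((hat a ha hg).1 k γ hγ).2.1
    · exact hextend _ _ continuousOn_const (hcont γ)
        fun a ha hg => ((hat a ha hg).1 k γ hγ).2.2
  obtain ⟨C₁, B₁, hC₁, hB₁, h₁⟩ := main e fp hadm fun a ha hg => (hjump a ha hg).1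
  obtain ⟨C₂, B₂, hC₂, hB₂, h₂⟩ := main (-e) fm
    (fun a ha γ hγ => by
      rw [map_neg, mul_neg, Complex.neg_re, abs_neg]; exact hadm a ha γ hγ) fun a ha hg => (hjump a ha hg).2
  have hmono : ∀ (C B : ℝ) (γ : Charge), 0 ≤ C → C ≤ max C₁ C₂ → B ≤ max B₁ B₂ →
      C * Real.exp (B * ‖γ‖) ≤ max C₁ C₂ * Real.exp (max B₁ B₂ * ‖γ‖) := by
    intro C B γ hC h1 h2
    gcongr
  exact ⟨κ, κ * c, max C₁ C₂, max B₁ B₂, hκ, by positivity, le_max_of_le_left hC₁,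
    le_max_of_le_left hB₁,
    ⟨h₁.ne_zero, h₁.sector, h₁.growth, fun k γ => (h₁.coeff k γ).trans
      (hmono _ _ γ hC₁ (le_max_left _ _) (le_max_left _ _))⟩,
    ⟨h₂.ne_zero, h₂.sector, h₂.growth, fun k γ => (h₂.coeff k γ).trans
      (hmono _ _ γ hC₂ (le_max_right _ _) (le_max_right _ _))⟩⟩

end JumpBounds

/-! ### The Cauchy kernel on the Riemann sphere. -/

section Kernel

@[simp] theorem kernel_infty (w : ℂ) : kernel w OnePoint.infty = -1 := rfl

@[simp] theorem kernel_coe (w z : ℂ) : kernel w (z : OnePoint ℂ) = (w + z) / (w - z) := rfl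

theorem kernel_zero {w : ℂ} (hw : w ≠ 0) : kernel w ((0 : ℂ) : OnePoint ℂ) = 1 := by
  simp [hw]

/-- The points of the Riemann sphere whose direction stays away from the unit vector `τ`. -/
def apart (τ : ℂ) (ρ : ℝ) : Set (OnePoint ℂ) :=
  {OnePoint.infty} ∪ ((↑) : ℂ → OnePoint ℂ) '' {z | (z * conj τ).re ≤ ρ * ‖z‖}

theorem infty_mem_apart (τ : ℂ) (ρ : ℝ) : OnePoint.infty ∈ apart τ ρ := Or.inl rfl

theorem coe_mem_apart {τ : ℂ} {ρ : ℝ} {z : ℂ} :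
    (z : OnePoint ℂ) ∈ apart τ ρ ↔ (z * conj τ).re ≤ ρ * ‖z‖ := by
  simp [apart]

/-- The bound for the kernel on `apart τ ρ`. -/
noncomputable def kernelBound (ρ : ℝ) : ℝ := Real.sqrt (2 / (1 - ρ))

theorem one_le_kernelBound {ρ : ℝ} (h0 : 0 ≤ ρ) (h1 : ρ < 1) : 1 ≤ kernelBound ρ := by
  rw [kernelBound, Real.one_le_sqrt, le_div_iff₀ (by linarith)]
  linarith

/-- `‖w‖² + ‖z‖² - 2ρ‖w‖‖z‖ - (1 - ρ)/2 (‖w‖ + ‖z‖)² = (1 + ρ)/2 (‖w‖ - ‖z‖)² ≥ 0`. -/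
theorem norm_add_le_kernelBound_mul {w z : ℂ} {ρ : ℝ} (h0 : 0 ≤ ρ) (h1 : ρ < 1)
    (h : (z * conj w).re ≤ ρ * (‖z‖ * ‖w‖)) : ‖w‖ + ‖z‖ ≤ kernelBound ρ * ‖w - z‖ := by
  have h2 : ‖w - z‖ ^ 2 = ‖w‖ ^ 2 + ‖z‖ ^ 2 - 2 * (z * conj w).re := by
    rw [← Complex.normSq_eq_norm_sq, ← Complex.normSq_eq_norm_sq, ← Complex.normSq_eq_norm_sq,
      Complex.normSq_sub]
    congr 2
    simp only [Complex.mul_re, Complex.conj_re, Complex.conj_im]; ring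
  have h3 : (1 - ρ) / 2 * (‖w‖ + ‖z‖) ^ 2 ≤ ‖w - z‖ ^ 2 := by
    nlinarith [mul_nonneg (show 0 ≤ 1 + ρ by linarith) (sq_nonneg (‖w‖ - ‖z‖))]
  have h4 : (‖w‖ + ‖z‖) ^ 2 ≤ (kernelBound ρ * ‖w - z‖) ^ 2 := by
    rw [mul_pow, kernelBound, Real.sq_sqrt (div_nonneg zero_le_two (by linarith)),
      div_mul_eq_mul_div, le_div_iff₀ (by linarith)]
    linarith
  exact (pow_le_pow_iff_left₀ (by positivity) (by rw [kernelBound]; positivity) two_ne_zero).1 h4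

theorem norm_kernel_le {w : ℂ} {ρ : ℝ} (h0 : 0 ≤ ρ) (h1 : ρ < 1)
    {z : ℂ} (h : (z * conj w).re ≤ ρ * (‖z‖ * ‖w‖)) :
    ‖kernel w (z : OnePoint ℂ)‖ ≤ kernelBound ρ := by
  rw [kernel_coe, norm_div]
  refine div_le_of_le_mul₀ (norm_nonneg _) (by rw [kernelBound]; positivity) ?_
  exact (norm_add_le _ _).trans (norm_add_le_kernelBound_mul h0 h1 h)

/-- The parametrization of `ray τ` by the multiplicative Haar measure. -/
noncomputable def expRay (τ : ℂ) (x : ℝ) : ℂ := (Real.exp x : ℂ) * τ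

theorem continuous_expRay (τ : ℂ) : Continuous (expRay τ) := by
  unfold expRay; fun_prop

theorem norm_expRay {τ : ℂ} (hτ : ‖τ‖ = 1) (x : ℝ) : ‖expRay τ x‖ = Real.exp x := by
  rw [expRay, norm_mul, hτ, mul_one, Complex.norm_real, Real.norm_of_nonneg (Real.exp_pos x).le]

theorem expRay_ne_zero {τ : ℂ} (hτ : ‖τ‖ = 1) (x : ℝ) : expRay τ x ≠ 0 := by
  rw [← norm_pos_iff, norm_expRay hτ]; exact Real.exp_pos x

theorem expRay_mem_ray (τ : ℂ) (x : ℝ) : expRay τ x ∈ ray τ := ⟨Real.exp x, Real.exp_pos x, rfl⟩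

theorem norm_kernel_expRay_le {τ : ℂ} {ρ : ℝ} (h0 : 0 ≤ ρ) (h1 : ρ < 1)
    {ζ : OnePoint ℂ} (h : ζ ∈ apart τ ρ) (hτ : ‖τ‖ = 1) (x : ℝ) :
    ‖kernel (expRay τ x) ζ‖ ≤ kernelBound ρ := by
  induction ζ using OnePoint.rec with
  | infty => simpa using one_le_kernelBound h0 h1
  | coe z =>
    rw [coe_mem_apart] at h
    refine norm_kernel_le h0 h1 ?_
    rw [norm_expRay hτ, expRay, map_mul, Complex.conj_ofReal,
      show z * ((Real.exp x : ℂ) * conj τ) = (Real.exp x : ℂ) * (z * conj τ) by ring,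
      Complex.re_ofReal_mul]
    calc Real.exp x * (z * conj τ).re ≤ Real.exp x * (ρ * ‖z‖) := by gcongr
      _ = _ := by ring

theorem tendsto_inv_cocompact_zero : Tendsto (fun z : ℂ => z⁻¹) (cocompact ℂ) (𝓝 0) :=
  (Metric.cobounded_eq_cocompact (α := ℂ)) ▸ tendsto_inv₀_cobounded

theorem continuousAt_kernel {w : ℂ} {ζ : OnePoint ℂ} (h : ζ ≠ (w : OnePoint ℂ)) :
    ContinuousAt (kernel w) ζ := by
  induction ζ using OnePoint.rec with
  | infty =>
    rw [OnePoint.continuousAt_infty', kernel_infty, coclosedCompact_eq_cocompact]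
    have h1 : Tendsto (fun z : ℂ => -1 - 2 * w * (z - w)⁻¹) (cocompact ℂ) (𝓝 (-1)) := by
      have h2 : Tendsto (fun z : ℂ => z - w) (cocompact ℂ) (cocompact ℂ) :=
        (Homeomorph.subRight w).isClosedEmbedding.tendsto_cocompact
      have h3 : Tendsto (fun z : ℂ => (z - w)⁻¹) (cocompact ℂ) (𝓝 0) :=
        tendsto_inv_cocompact_zero.comp h2
      simpa using (h3.const_mul (2 * w)).const_sub (-1)
    refine h1.congr' ?_
    have : ∀ᶠ z in cocompact ℂ, z ≠ w := by
      have := (isCompact_singleton (x := w)).compl_mem_cocompact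
      filter_upwards [this] with z hz using hz
    filter_upwards [this] with z hz
    have h4 : z - w ≠ 0 := sub_ne_zero.2 hz
    have h5 : w - z ≠ 0 := sub_ne_zero.2 hz.symm
    simp only [Function.comp_apply, kernel_coe]
    field_simp
    ring
  | coe z =>
    rw [OnePoint.continuousAt_coe]
    have h' : w - z ≠ 0 := by
      rw [sub_ne_zero]; rintro rfl; exact h rfl
    have : ContinuousAt (fun z : ℂ => (w + z) / (w - z)) z :=
      ContinuousAt.div (by fun_prop) (by fun_prop) h'
    exact this

/-- Continuity in `ζ` up to `∞` comes from dominated convergence, which works along sequences. -/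
instance : FirstCountableTopology (OnePoint ℂ) := by
  exact (onePointEquivSphereOfFinrankEq (ι := Fin 3) (V := ℂ)
    (by simp)).isInducing.firstCountableTopology

end Kernel

/-! ### Cauchy integrals along a ray, away from the ray. -/

section RayIntegral

/-- A weight that is integrable for the multiplicative Haar measure. -/
noncomputable def logWeight (x : ℝ) : ℝ := (1 + x ^ 2)⁻¹

theorem logWeight_pos (x : ℝ) : 0 < logWeight x := by unfold logWeight; positivity

theorem integrable_logWeight : Integrable logWeight := integrable_inv_one_add_sq

theorem integral_logWeight : ∫ x, logWeight x = Real.pi := integral_univ_inv_one_add_sq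

/-- The integral of `kernel ζ' ζ * h ζ'` along `ray τ`, for the measure `dζ' / ζ'`. -/
noncomputable def rayInt (τ : ℂ) (h : ℂ → ℂ) (ζ : OnePoint ℂ) : ℂ :=
  ∫ x : ℝ, kernel (expRay τ x) ζ * h (expRay τ x)

/-- The functions on a ray for which the ray integral is considered. -/
structure RayBound (τ : ℂ) (η : ℝ) (h : ℂ → ℂ) : Prop where
  cont : Continuous fun x => h (expRay τ x)
  le : ∀ x, ‖h (expRay τ x)‖ ≤ η * logWeight x

variable {τ : ℂ} {ρ η : ℝ} {h : ℂ → ℂ}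

theorem measurable_kernel_expRay (τ : ℂ) (ζ : OnePoint ℂ) :
    Measurable fun x => kernel (expRay τ x) ζ := by
  have h1 := (continuous_expRay τ).measurable
  induction ζ using OnePoint.rec with
  | infty => exact measurable_const
  | coe z => exact (h1.add_const z).div (h1.sub_const z)

theorem RayBound.aestronglyMeasurable (hh : RayBound τ η h) (ζ : OnePoint ℂ) :
    AEStronglyMeasurable (fun x => kernel (expRay τ x) ζ * h (expRay τ x)) :=
  ((measurable_kernel_expRay τ ζ).mul hh.cont.measurable).aestronglyMeasurable

theorem RayBound.norm_integrand_le (hh : RayBound τ η h) (hτ : ‖τ‖ = 1) (h0 : 0 ≤ ρ) (h1 : ρ < 1)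
    {ζ : OnePoint ℂ} (hζ : ζ ∈ apart τ ρ) (x : ℝ) :
    ‖kernel (expRay τ x) ζ * h (expRay τ x)‖ ≤ kernelBound ρ * η * logWeight x := by
  rw [norm_mul, mul_assoc]
  gcongr
  · rw [kernelBound]; positivity
  · exact norm_kernel_expRay_le h0 h1 hζ hτ x
  · exact hh.le x

theorem RayBound.integrable (hh : RayBound τ η h) (hτ : ‖τ‖ = 1) (h0 : 0 ≤ ρ) (h1 : ρ < 1)
    {ζ : OnePoint ℂ} (hζ : ζ ∈ apart τ ρ) :
    Integrable fun x => kernel (expRay τ x) ζ * h (expRay τ x) :=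
  (integrable_logWeight.const_mul (kernelBound ρ * η)).mono' (hh.aestronglyMeasurable ζ)
    (Eventually.of_forall (hh.norm_integrand_le hτ h0 h1 hζ))

theorem RayBound.norm_rayInt_le (hh : RayBound τ η h) (hτ : ‖τ‖ = 1) (h0 : 0 ≤ ρ) (h1 : ρ < 1)
    {ζ : OnePoint ℂ} (hζ : ζ ∈ apart τ ρ) : ‖rayInt τ h ζ‖ ≤ kernelBound ρ * η * Real.pi := by
  refine (norm_integral_le_of_norm_le (integrable_logWeight.const_mul (kernelBound ρ * η))
    (Eventually.of_forall (hh.norm_integrand_le hτ h0 h1 hζ))).trans (le_of_eq ?_)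
  rw [integral_const_mul, integral_logWeight]

theorem expRay_notMem_apart (hτ : ‖τ‖ = 1) (h1 : ρ < 1) (x : ℝ) :
    (expRay τ x : OnePoint ℂ) ∉ apart τ ρ := by
  rw [coe_mem_apart, norm_expRay hτ, expRay, mul_assoc, Complex.mul_conj,
    Complex.normSq_eq_norm_sq, hτ, not_le]
  have := Real.exp_pos x
  rw [← Complex.ofReal_mul, Complex.ofReal_re]
  nlinarith

/-- On `apart τ ρ` the kernel is bounded uniformly in `ζ` and in the integration variable, so one
integrable majorant serves all `ζ`, including `0` and `∞`. -/
theorem RayBound.continuousOn_rayInt (hh : RayBound τ η h) (hτ : ‖τ‖ = 1) (h0 : 0 ≤ ρ)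
    (h1 : ρ < 1) : ContinuousOn (rayInt τ h) (apart τ ρ) := by
  intro ζ hζ
  refine continuousWithinAt_of_dominated (bound := fun x => kernelBound ρ * η * logWeight x)
    (Eventually.of_forall fun ζ => hh.aestronglyMeasurable ζ) ?_
    (integrable_logWeight.const_mul _) (Eventually.of_forall fun x => ?_)
  · filter_upwards [self_mem_nhdsWithin] with ξ hξ
    exact Eventually.of_forall (hh.norm_integrand_le hτ h0 h1 hξ)
  · refine ContinuousWithinAt.mul (continuousAt_kernel ?_).continuousWithinAt
      continuousWithinAt_const
    rintro rfl
    exact expRay_notMem_apart hτ h1 x hζ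

theorem differentiableOn_kernel (w : ℂ) {s : Set ℂ} (hs : w ∉ s) :
    DifferentiableOn ℂ (fun z : ℂ => kernel w (z : OnePoint ℂ)) s := by
  have : DifferentiableOn ℂ (fun z : ℂ => (w + z) / (w - z)) s := by
    refine DifferentiableOn.div (by fun_prop) (by fun_prop) fun z hz => ?_
    rw [sub_ne_zero]; rintro rfl; exact hs hz
  exact this

theorem RayBound.differentiableOn_rayInt (hh : RayBound τ η h) (hτ : ‖τ‖ = 1) (h0 : 0 ≤ ρ)
    (h1 : ρ < 1) :
    DifferentiableOn ℂ (fun z : ℂ => rayInt τ h z) {z | (z * conj τ).re < ρ * ‖z‖} := by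
  have hO : IsOpen {z : ℂ | (z * conj τ).re < ρ * ‖z‖} :=
    isOpen_lt (by fun_prop) (by fun_prop)
  refine differentiableOn_integral_of_norm_le hO (fun z _ => hh.aestronglyMeasurable z)
    (integrable_logWeight.const_mul (kernelBound ρ * η))
    (fun z hz => hh.norm_integrand_le hτ h0 h1 (coe_mem_apart.2 (le_of_lt hz))) fun x => ?_
  refine (differentiableOn_kernel _ fun hx => ?_).mul_const _
  exact expRay_notMem_apart hτ h1 x (coe_mem_apart.2 (le_of_lt hx))

end RayIntegral

/-! ### Shifting a contour in a strip. -/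

section Strip

/-- Shift of the contour of integration in a strip, for a function that is holomorphic off one
point, continuous, and small at both ends of the strip. -/
theorem integral_eq_integral_sub_mul_I {F : ℂ → ℂ} {δ : ℝ} (hδ : 0 ≤ δ) {z : ℂ}
    (hc : ContinuousOn F {t | -δ ≤ t.im ∧ t.im ≤ 0})
    (hd : ∀ t : ℂ, -δ < t.im → t.im < 0 → t ≠ z → DifferentiableAt ℂ F t)
    (hi₀ : Integrable fun x : ℝ => F x) (hi₁ : Integrable fun x : ℝ => F (x - δ * Complex.I))
    {b : ℝ → ℝ} (hb : ∀ᶠ x : ℝ in cocompact ℝ, ∀ y ∈ Icc (-δ) 0, ‖F (x + (y : ℝ) * Complex.I)‖ ≤ b x)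
    (hb0 : Tendsto b (cocompact ℝ) (𝓝 0)) :
    ∫ x : ℝ, F x = ∫ x : ℝ, F (x - δ * Complex.I) := by
  have hrect : ∀ T : ℝ, (∫ x in (-T)..T, F (x - δ * Complex.I)) - (∫ x in (-T)..T, F x) +
      Complex.I • (∫ y in (-δ)..0, F (T + y * Complex.I)) -
      Complex.I • (∫ y in (-δ)..0, F (((-T : ℝ) : ℂ) + y * Complex.I)) = 0 := by
    intro T
    -- The exceptional point `z` is allowed because continuity there suffices; it will be the place
    -- of a removable singularity.
    have := Complex.integral_boundary_rect_eq_zero_of_differentiable_on_off_countable F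
      (⟨-T, -δ⟩ : ℂ) (⟨T, 0⟩ : ℂ) {z} (countable_singleton z)
      (hc.mono fun t ht => by
        have h2 := ht.2
        simp only [mem_preimage, uIcc_of_le (neg_nonpos.2 hδ)] at h2
        exact h2)
      (fun t ht => by
        obtain ⟨⟨-, h2⟩, h3⟩ := ht
        simp only [mem_preimage, min_eq_left (neg_nonpos.2 hδ), max_eq_right (neg_nonpos.2 hδ)] at h2
        exact hd t h2.1 h2.2 h3)
    simpa [sub_eq_add_neg] using this
  have hside : ∀ s : ℝ → ℝ, Tendsto s atTop (cocompact ℝ) →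
      Tendsto (fun T : ℝ => Complex.I • ∫ y in (-δ)..0, F ((s T : ℂ) + y * Complex.I)) atTop
        (𝓝 0) := by
    intro s hs
    rw [tendsto_zero_iff_norm_tendsto_zero]
    have hlim : Tendsto (fun T => b (s T) * |0 - -δ|) atTop (𝓝 0) := by
      simpa using (hb0.comp hs).mul_const |0 - -δ|
    refine squeeze_zero' (Eventually.of_forall fun _ => norm_nonneg _) ?_ hlim
    filter_upwards [hs.eventually hb] with T hT
    rw [norm_smul, Complex.norm_I, one_mul]
    refine intervalIntegral.norm_integral_le_of_norm_le_const fun y hy => hT y ?_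
    rw [uIoc_of_le (neg_nonpos.2 hδ)] at hy
    exact Ioc_subset_Icc_self hy
  have htop : Tendsto (fun T : ℝ => T) atTop (cocompact ℝ) := atTop_le_cocompact
  have hbot : Tendsto (fun T : ℝ => -T) atTop (cocompact ℝ) :=
    tendsto_neg_atTop_atBot.mono_right atBot_le_cocompact
  have h1 := intervalIntegral_tendsto_integral hi₁ tendsto_neg_atTop_atBot tendsto_id
  have h0 := intervalIntegral_tendsto_integral hi₀ tendsto_neg_atTop_atBot tendsto_id
  have := ((h1.sub h0).add (hside _ htop)).sub (hside _ hbot)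
  have h3 := tendsto_nhds_unique this
    ((tendsto_const_nhds (x := (0 : ℂ))).congr fun T => (hrect T).symm)
  rw [add_zero, sub_zero, sub_eq_zero] at h3
  exact h3.symm

end Strip

/-! ### Sectors, and rotation of the contour without meeting the pole. -/

section Sector

/-- The closed sector of opening `δ` on the clockwise side of `ray σ`, without its vertex. -/
def sector (σ : ℂ) (δ : ℝ) : Set ℂ :=
  {ζ | ζ ≠ 0 ∧ -δ ≤ (ζ * conj σ).arg ∧ (ζ * conj σ).arg ≤ 0}

/-- The interior of `sector σ δ`. -/
def openSector (σ : ℂ) (δ : ℝ) : Set ℂ :=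
  {ζ | ζ ≠ 0 ∧ -δ < (ζ * conj σ).arg ∧ (ζ * conj σ).arg < 0}

/-- The direction of the second boundary ray of `sector σ δ`. -/
noncomputable def rot (σ : ℂ) (δ : ℝ) : ℂ := Complex.exp (-(δ * Complex.I)) * σ

variable {σ : ℂ} {δ : ℝ}

theorem norm_rot (hσ : ‖σ‖ = 1) (δ : ℝ) : ‖rot σ δ‖ = 1 := by
  rw [rot, norm_mul, hσ, mul_one, ← neg_mul, ← Complex.ofReal_neg, Complex.norm_exp_ofReal_mul_I]

theorem openSector_subset_sector : openSector σ δ ⊆ sector σ δ := fun _ h =>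
  ⟨h.1, h.2.1.le, h.2.2.le⟩

theorem mul_conj_ne_zero (hσ : ‖σ‖ = 1) {ζ : ℂ} (h : ζ ≠ 0) : ζ * conj σ ≠ 0 := by
  refine mul_ne_zero h ?_
  rw [← norm_pos_iff, Complex.norm_conj, hσ]; exact one_pos

theorem mul_conj_mul_self (hσ : ‖σ‖ = 1) (ζ : ℂ) : ζ * conj σ * σ = ζ := by
  rw [mul_assoc, Complex.conj_mul', hσ]; simp

theorem isOpen_openSector (hσ : ‖σ‖ = 1) : IsOpen (openSector σ δ) := by
  have h1 : IsOpen (Complex.slitPlane ∩ Complex.arg ⁻¹' Ioo (-δ) 0) :=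
    ContinuousOn.isOpen_inter_preimage
      (fun x hx => (Complex.continuousAt_arg hx).continuousWithinAt) Complex.isOpen_slitPlane
      isOpen_Ioo
  have h2 : openSector σ δ = (fun ζ => ζ * conj σ) ⁻¹'
      (Complex.slitPlane ∩ Complex.arg ⁻¹' Ioo (-δ) 0) := by
    ext ζ
    constructor
    · rintro ⟨h0, h1, h2⟩
      refine ⟨Complex.mem_slitPlane_iff_arg.2 ⟨?_, mul_conj_ne_zero hσ h0⟩, h1, h2⟩
      exact (h2.trans Real.pi_pos).ne
    · rintro ⟨h0, h1, h2⟩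
      exact ⟨left_ne_zero_of_mul (Complex.slitPlane_ne_zero h0), h1, h2⟩
  rw [h2]
  exact h1.preimage (by fun_prop)

theorem re_pos_of_mem_sector (hσ : ‖σ‖ = 1) (hδ : δ ≤ 1 / 2) {ζ : ℂ} (h : ζ ∈ sector σ δ) :
    0 < (ζ * conj σ).re := by
  have h1 : |(ζ * conj σ).arg| < Real.pi / 2 := by
    rw [abs_lt]
    constructor <;> linarith [h.2.1, h.2.2, Real.pi_gt_three]
  rcases Complex.abs_arg_lt_pi_div_two_iff.1 h1 with h2 | h2
  · exact h2
  · exact absurd h2 (mul_conj_ne_zero hσ h.1)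

theorem exp_mul_mul_conj (hσ : ‖σ‖ = 1) (t : ℂ) :
    Complex.exp t * σ * conj σ = Complex.exp t := by
  rw [mul_assoc, Complex.mul_conj', hσ]; simp

theorem arg_exp {t : ℂ} (h1 : -Real.pi < t.im) (h2 : t.im ≤ Real.pi) :
    (Complex.exp t).arg = t.im := by
  rw [← Complex.log_im, Complex.log_exp h1 h2]

theorem arg_exp_mul (hσ : ‖σ‖ = 1) (hδ : δ ≤ 1 / 2) {t : ℂ} (h1 : -δ ≤ t.im) (h2 : t.im ≤ 0) :
    (Complex.exp t * σ * conj σ).arg = t.im := by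
  rw [exp_mul_mul_conj hσ]
  exact arg_exp (by linarith [Real.pi_gt_three]) (by linarith [Real.pi_gt_three])

theorem exp_mul_ne_zero (hσ : ‖σ‖ = 1) (t : ℂ) : Complex.exp t * σ ≠ 0 := by
  refine mul_ne_zero (Complex.exp_ne_zero t) ?_
  rw [← norm_pos_iff, hσ]; exact one_pos

/-- The substitution `ζ' = exp t * σ` turns the sector into the strip `-δ ≤ Im t ≤ 0` and `dζ' / ζ'`
into `dt`, so rotating a ray becomes shifting a line. -/
theorem exp_mul_mem_sector (hσ : ‖σ‖ = 1) (hδ : δ ≤ 1 / 2) {t : ℂ} (h1 : -δ ≤ t.im)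
    (h2 : t.im ≤ 0) : Complex.exp t * σ ∈ sector σ δ :=
  ⟨exp_mul_ne_zero hσ t, by rwa [arg_exp_mul hσ hδ h1 h2], by rwa [arg_exp_mul hσ hδ h1 h2]⟩

theorem exp_mul_mem_openSector (hσ : ‖σ‖ = 1) (hδ : δ ≤ 1 / 2) {t : ℂ} (h1 : -δ < t.im)
    (h2 : t.im < 0) : Complex.exp t * σ ∈ openSector σ δ :=
  ⟨exp_mul_ne_zero hσ t, by rwa [arg_exp_mul hσ hδ h1.le h2.le],
    by rwa [arg_exp_mul hσ hδ h1.le h2.le]⟩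

theorem norm_exp_mul (hσ : ‖σ‖ = 1) (t : ℂ) : ‖Complex.exp t * σ‖ = Real.exp t.re := by
  rw [norm_mul, hσ, mul_one, Complex.norm_exp]

theorem exp_ofReal_mul (σ : ℂ) (x : ℝ) : Complex.exp x * σ = expRay σ x := by
  rw [expRay, Complex.ofReal_exp]

theorem exp_sub_mul (σ : ℂ) (δ x : ℝ) :
    Complex.exp (x - δ * Complex.I) * σ = expRay (rot σ δ) x := by
  rw [expRay, rot, Complex.ofReal_exp, ← mul_assoc, ← Complex.exp_add, sub_eq_add_neg]

/-- The functions on a sector for which the ray integral is considered. -/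
structure SectorBound (σ : ℂ) (δ η : ℝ) (h : ℂ → ℂ) : Prop where
  cont : ContinuousOn h (sector σ δ)
  holo : DifferentiableOn ℂ h (openSector σ δ)
  le : ∀ ζ ∈ sector σ δ, ‖h ζ‖ ≤ η * logWeight (Real.log ‖ζ‖)

variable {η : ℝ} {h : ℂ → ℂ}

theorem SectorBound.norm_exp_le (hh : SectorBound σ δ η h) (hσ : ‖σ‖ = 1) (hδ : δ ≤ 1 / 2) {t : ℂ}
    (h1 : -δ ≤ t.im) (h2 : t.im ≤ 0) : ‖h (Complex.exp t * σ)‖ ≤ η * logWeight t.re := by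
  have := hh.le _ (exp_mul_mem_sector hσ hδ h1 h2)
  rwa [norm_exp_mul hσ, Real.log_exp] at this

theorem SectorBound.continuousOn_exp (hh : SectorBound σ δ η h) (hσ : ‖σ‖ = 1) (hδ : δ ≤ 1 / 2) :
    ContinuousOn (fun t => h (Complex.exp t * σ)) {t | -δ ≤ t.im ∧ t.im ≤ 0} :=
  hh.cont.comp (by fun_prop) fun _ ht => exp_mul_mem_sector hσ hδ ht.1 ht.2

theorem SectorBound.rayBound (hh : SectorBound σ δ η h) (hσ : ‖σ‖ = 1) (hδ0 : 0 ≤ δ)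
    (hδ : δ ≤ 1 / 2) : RayBound σ η h where
  cont := by
    have : Continuous fun x : ℝ => h (Complex.exp x * σ) :=
      (hh.continuousOn_exp hσ hδ).comp_continuous Complex.continuous_ofReal
        fun x => by simp [hδ0]
    simpa only [exp_ofReal_mul] using this
  le x := by
    have := hh.norm_exp_le hσ hδ (t := x) (by simpa using hδ0) (by simp)
    rwa [exp_ofReal_mul, Complex.ofReal_re] at this

theorem SectorBound.rayBound_rot (hh : SectorBound σ δ η h) (hσ : ‖σ‖ = 1) (hδ0 : 0 ≤ δ)
    (hδ : δ ≤ 1 / 2) : RayBound (rot σ δ) η h where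
  cont := by
    have : Continuous fun x : ℝ => h (Complex.exp (x - δ * Complex.I) * σ) :=
      (hh.continuousOn_exp hσ hδ).comp_continuous
        (by fun_prop : Continuous fun x : ℝ => (x : ℂ) - δ * Complex.I)
        fun x => by simp [hδ0]
    simpa only [exp_sub_mul] using this
  le x := by
    have := hh.norm_exp_le hσ hδ (t := x - δ * Complex.I) (by simp) (by simpa using hδ0)
    rw [exp_sub_mul] at this
    simpa using this

theorem tendsto_logWeight : Tendsto logWeight (cocompact ℝ) (𝓝 0) := by
  have h1 : Tendsto (fun x : ℝ => ‖x‖ ^ 2) (cocompact ℝ) atTop :=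
    (tendsto_pow_atTop two_ne_zero).comp (tendsto_norm_cocompact_atTop (E := ℝ))
  have h2 : Tendsto (fun x : ℝ => 1 + x ^ 2) (cocompact ℝ) atTop := by
    refine tendsto_atTop_add_const_left _ _ ?_
    simpa using h1
  exact tendsto_inv_atTop_zero.comp h2

/-- The kernel is bounded along a sector if its second argument is not in the sector. -/
theorem exists_norm_kernel_exp_le (hσ : ‖σ‖ = 1) (hδ0 : 0 ≤ δ) (hδ : δ ≤ 1 / 2) {ζ : OnePoint ℂ}
    (hζ : ζ ∉ ((↑) : ℂ → OnePoint ℂ) '' sector σ δ) :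
    ∃ K : ℝ, ∀ t : ℂ, -δ ≤ t.im → t.im ≤ 0 → ‖kernel (Complex.exp t * σ) ζ‖ ≤ K := by
  induction ζ using OnePoint.rec with
  | infty => exact ⟨1, fun t _ _ => by simp⟩
  | coe z =>
    rcases eq_or_ne z 0 with rfl | hz
    · exact ⟨1, fun t _ _ => by rw [kernel_zero (exp_mul_ne_zero hσ t)]; simp⟩
    set α := (z * conj σ).arg with hα
    -- The cosine of the angle between `z` and the directions of the sector attains its maximum. The
    -- value 1 would put the direction of `z` into the sector, so the maximum is below 1 and the
    -- kernel is uniformly bounded.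
    obtain ⟨y₀, hy₀, hmax⟩ := (isCompact_Icc (a := -δ) (b := 0)).exists_isMaxOn
      ⟨0, by simpa using hδ0⟩
      (by fun_prop : Continuous fun y => Real.cos (α - y)).continuousOn
    have hlt : Real.cos (α - y₀) < 1 := by
      refine lt_of_le_of_ne (Real.cos_le_one _) fun h1 => hζ ⟨z, ⟨hz, ?_⟩, rfl⟩
      have h2 := Complex.neg_pi_lt_arg (z * conj σ)
      have h3 := Complex.arg_le_pi (z * conj σ)
      have := (Real.cos_eq_one_iff_of_lt_of_lt
        (by linarith [hy₀.1, hy₀.2, Real.pi_gt_three])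
        (by linarith [hy₀.1, hy₀.2, Real.pi_gt_three])).1 h1
      rw [← hα, show α = y₀ by linarith]
      exact hy₀
    refine ⟨kernelBound (max 0 (Real.cos (α - y₀))), fun t h1 h2 => ?_⟩
    refine norm_kernel_le (le_max_left _ _) (max_lt one_pos hlt) ?_
    have h3 : (z * conj (Complex.exp t * σ)).re =
        ‖z‖ * ‖Complex.exp t * σ‖ * Real.cos (α - t.im) := by
      have h4 : z * conj σ = ‖z‖ * Complex.exp (α * Complex.I) := by
        conv_lhs => rw [← Complex.norm_mul_exp_arg_mul_I (z * conj σ)]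
        rw [norm_mul, Complex.norm_conj, hσ, mul_one]
      rw [norm_exp_mul hσ, map_mul, mul_comm (conj _), ← mul_assoc, h4, ← Complex.exp_conj,
        mul_assoc, ← Complex.exp_add, Complex.re_ofReal_mul, Complex.exp_re]
      simp [sub_eq_add_neg, mul_assoc]
    rw [h3, mul_comm _ (‖z‖ * _)]
    gcongr
    exact le_max_of_le_right (hmax ⟨h1, h2⟩)

theorem differentiableAt_kernel_left {w : ℂ} {ζ : OnePoint ℂ} (h : ζ ≠ (w : OnePoint ℂ)) :
    DifferentiableAt ℂ (fun w => kernel w ζ) w := by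
  induction ζ using OnePoint.rec with
  | infty => exact differentiableAt_const _
  | coe z =>
    have : DifferentiableAt ℂ (fun w => (w + z) / (w - z)) w := by
      refine DifferentiableAt.div (by fun_prop) (by fun_prop) ?_
      rw [sub_ne_zero]; rintro rfl; exact h rfl
    exact this

/-- The contour of the ray integral may be rotated if the pole of the kernel is not met. -/
theorem SectorBound.rayInt_eq_of_notMem (hh : SectorBound σ δ η h) (hσ : ‖σ‖ = 1) (hδ0 : 0 ≤ δ)
    (hδ : δ ≤ 1 / 2) {ζ : OnePoint ℂ} (hζ : ζ ∉ ((↑) : ℂ → OnePoint ℂ) '' sector σ δ) :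
    rayInt σ h ζ = rayInt (rot σ δ) h ζ := by
  obtain ⟨K, hK⟩ := exists_norm_kernel_exp_le hσ hδ0 hδ hζ
  have hne : ∀ t : ℂ, -δ ≤ t.im → t.im ≤ 0 → ζ ≠ ((Complex.exp t * σ : ℂ) : OnePoint ℂ) := by
    rintro t h1 h2 rfl
    exact hζ ⟨_, exp_mul_mem_sector hσ hδ h1 h2, rfl⟩
  have hle : ∀ t : ℂ, -δ ≤ t.im → t.im ≤ 0 →
      ‖kernel (Complex.exp t * σ) ζ * h (Complex.exp t * σ)‖ ≤ K * η * logWeight t.re := by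
    intro t h1 h2
    have h3 := hK t h1 h2
    rw [norm_mul, mul_assoc]
    gcongr
    · exact (norm_nonneg _).trans h3
    · exact hh.norm_exp_le hσ hδ h1 h2
  -- Here the integrand is differentiable throughout the open strip; the exceptional point `0` is a
  -- dummy.
  have key := integral_eq_integral_sub_mul_I (F := fun t =>
      kernel (Complex.exp t * σ) ζ * h (Complex.exp t * σ)) (z := 0)
    (b := fun x => K * η * logWeight x) hδ0 ?_ ?_ ?_ ?_ ?_ ?_
  · simpa only [exp_ofReal_mul, exp_sub_mul, rayInt] using key
  · refine ContinuousOn.mul (fun t ht => ?_) (hh.continuousOn_exp hσ hδ)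
    exact (ContinuousAt.comp (g := fun w => kernel w ζ) (f := fun t => Complex.exp t * σ)
      (differentiableAt_kernel_left (hne t ht.1 ht.2)).continuousAt
      (by fun_prop)).continuousWithinAt
  · intro t h1 h2 _
    refine DifferentiableAt.mul ?_ ?_
    · exact DifferentiableAt.comp (g := fun w => kernel w ζ) t
        (differentiableAt_kernel_left (hne t h1.le h2.le)) (by fun_prop)
    · exact DifferentiableAt.comp t ((hh.holo _ (exp_mul_mem_openSector hσ hδ h1 h2)).differentiableAt
        ((isOpen_openSector hσ).mem_nhds (exp_mul_mem_openSector hσ hδ h1 h2))) (by fun_prop)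
  · simp only [exp_ofReal_mul]
    refine (integrable_logWeight.const_mul (K * η)).mono'
      ((hh.rayBound hσ hδ0 hδ).aestronglyMeasurable ζ) (Eventually.of_forall fun x => ?_)
    have := hle x (by simpa using hδ0) (by simp)
    simpa only [exp_ofReal_mul, Complex.ofReal_re] using this
  · simp only [exp_sub_mul]
    refine (integrable_logWeight.const_mul (K * η)).mono'
      ((hh.rayBound_rot hσ hδ0 hδ).aestronglyMeasurable ζ) (Eventually.of_forall fun x => ?_)
    have := hle (x - δ * Complex.I) (by simp) (by simpa using hδ0)
    rw [exp_sub_mul] at this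
    simpa using this
  · refine Eventually.of_forall fun (x : ℝ) y hy => ?_
    have := hle (x + y * Complex.I) (by simpa using hy.1) (by simpa using hy.2)
    simpa using this
  · simpa using tendsto_logWeight.const_mul (K * η)

end Sector

/-! ### Rotation of the contour across the pole. -/

section Residue

/-- The rational function `ζ' (1 / (ζ' - ζ) - 1 / (ζ' + ζ))` of `ζ'`. -/
noncomputable def dipole (z w : ℂ) : ℂ := 2 * z * w / ((w - z) * (w + z))

theorem one_add_sq_div_two_le (u : ℝ) : 1 + u ^ 2 ≤ 2 * (Real.exp u + 2 + Real.exp (-u)) := by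
  rcases le_total 0 u with hu | hu
  · have h1 := Real.quadratic_le_exp_of_nonneg hu
    have h2 := Real.add_one_le_exp (-u)
    nlinarith
  · have h1 := Real.quadratic_le_exp_of_nonneg (neg_nonneg.2 hu)
    have h2 := Real.add_one_le_exp u
    nlinarith

/-- With `u = x - x₀` the left-hand side is `1 / (exp u + 2 + exp (-u))`. -/
theorem mul_div_add_sq_le (x x₀ : ℝ) :
    Real.exp x₀ * Real.exp x / (Real.exp x + Real.exp x₀) ^ 2 ≤ 2 * logWeight (x - x₀) := by
  have h := one_add_sq_div_two_le (x - x₀)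
  rw [logWeight, ← div_eq_mul_inv, div_le_div_iff₀ (by positivity) (by positivity)]
  have h1 : Real.exp x₀ * Real.exp x * (Real.exp (x - x₀) + 2 + Real.exp (-(x - x₀))) =
      (Real.exp x + Real.exp x₀) ^ 2 := by
    rw [neg_sub, Real.exp_sub, Real.exp_sub]
    field_simp
    ring
  rw [← h1]
  have : 0 < Real.exp x₀ * Real.exp x := by positivity
  nlinarith

theorem abs_re_lt_norm_of_im_ne_zero {u : ℂ} (h : u.im ≠ 0) : |u.re| < ‖u‖ :=
  Complex.abs_re_lt_norm.2 h

variable {τ z : ℂ}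

theorem expRay_mul_conj (τ z : ℂ) (x : ℝ) :
    z * conj (expRay τ x) = (Real.exp x : ℂ) * (z * conj τ) := by
  rw [expRay, map_mul, Complex.conj_ofReal]; ring

/-- Off the line through the ray, both `‖w - z‖` and `‖w + z‖` are comparable to `‖w‖ + ‖z‖`. The
second pole at `-z` produces decay at both ends of the ray, which a single Cauchy kernel does not
have for the measure `dw / w`. -/
theorem exists_norm_dipole_le (hτ : ‖τ‖ = 1) (h : (z * conj τ).im ≠ 0) :
    ∃ C : ℝ, ∀ x, ‖dipole z (expRay τ x)‖ ≤ C * logWeight (x - Real.log ‖z‖) := by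
  have hz : z ≠ 0 := by rintro rfl; simp at h
  have hz' : 0 < ‖z‖ := norm_pos_iff.2 hz
  set ρ := |(z * conj τ).re| / ‖z‖ with hρ
  have h0 : 0 ≤ ρ := by positivity
  have h1 : ρ < 1 := by
    rw [hρ, div_lt_one hz']
    simpa [hτ] using abs_re_lt_norm_of_im_ne_zero h
  have hρz : ρ * ‖z‖ = |(z * conj τ).re| := by rw [hρ]; field_simp
  have hb : ∀ z' : ℂ, ‖z'‖ = ‖z‖ → (z' * conj τ).re ≤ |(z * conj τ).re| → ∀ x,
      Real.exp x + ‖z‖ ≤ kernelBound ρ * ‖expRay τ x - z'‖ := by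
    intro z' hz' hre x
    have := norm_add_le_kernelBound_mul (w := expRay τ x) (z := z') h0 h1 (by
      rw [norm_expRay hτ, expRay_mul_conj, Complex.re_ofReal_mul, hz', ← mul_assoc, hρz, mul_comm]
      gcongr)
    rwa [norm_expRay hτ, hz'] at this
  have hK : 0 < kernelBound ρ := one_pos.trans_le (one_le_kernelBound h0 h1)
  refine ⟨kernelBound ρ ^ 2 * 4, fun x => ?_⟩
  have h2 := hb z rfl (le_abs_self _) x
  have h3 := hb (-z) (norm_neg z) (by rw [neg_mul, Complex.neg_re]; exact neg_le_abs _) x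
  rw [sub_neg_eq_add] at h3
  have h4 : (Real.exp x + ‖z‖) ^ 2 ≤
      kernelBound ρ ^ 2 * (‖expRay τ x - z‖ * ‖expRay τ x + z‖) := by
    calc (Real.exp x + ‖z‖) ^ 2 = (Real.exp x + ‖z‖) * (Real.exp x + ‖z‖) := sq _
      _ ≤ (kernelBound ρ * ‖expRay τ x - z‖) * (kernelBound ρ * ‖expRay τ x + z‖) := by gcongr
      _ = _ := by ring
  have h5 := mul_div_add_sq_le x (Real.log ‖z‖)
  rw [Real.exp_log hz'] at h5
  have h6 : 0 < Real.exp x + ‖z‖ := by positivity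
  have h7 : 0 < ‖expRay τ x - z‖ * ‖expRay τ x + z‖ :=
    pos_of_mul_pos_right ((by positivity : 0 < (Real.exp x + ‖z‖) ^ 2).trans_le h4) (by positivity)
  calc ‖dipole z (expRay τ x)‖
      = 2 * (‖z‖ * Real.exp x) / (‖expRay τ x - z‖ * ‖expRay τ x + z‖) := by
        rw [dipole, norm_div, norm_mul, norm_mul, norm_mul, norm_expRay hτ]; simp; ring
    _ ≤ 2 * (‖z‖ * Real.exp x) * kernelBound ρ ^ 2 / (Real.exp x + ‖z‖) ^ 2 := by
        rw [div_le_div_iff₀ h7 (by positivity)]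
        calc 2 * (‖z‖ * Real.exp x) * (Real.exp x + ‖z‖) ^ 2
            ≤ 2 * (‖z‖ * Real.exp x) *
              (kernelBound ρ ^ 2 * (‖expRay τ x - z‖ * ‖expRay τ x + z‖)) := by gcongr
          _ = _ := by ring
    _ = 2 * kernelBound ρ ^ 2 * (‖z‖ * Real.exp x / (Real.exp x + ‖z‖) ^ 2) := by ring
    _ ≤ 2 * kernelBound ρ ^ 2 * (2 * logWeight (x - Real.log ‖z‖)) := by gcongr
    _ = _ := by ring

theorem expRay_sub_ne_zero (h : (z * conj τ).im ≠ 0) (x : ℝ) : expRay τ x - z ≠ 0 := by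
  intro h0
  rw [sub_eq_zero] at h0
  apply h
  rw [← h0, expRay, mul_assoc, Complex.mul_conj, ← Complex.ofReal_mul, Complex.ofReal_im]

theorem expRay_add_ne_zero (h : (z * conj τ).im ≠ 0) (x : ℝ) : expRay τ x + z ≠ 0 := by
  have := expRay_sub_ne_zero (τ := τ) (z := -z) (by rw [neg_mul, Complex.neg_im]; exact neg_ne_zero.2 h) x
  rwa [sub_neg_eq_add] at this

theorem integrable_dipole (hτ : ‖τ‖ = 1) (h : (z * conj τ).im ≠ 0) :
    Integrable fun x => dipole z (expRay τ x) := by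
  obtain ⟨C, hC⟩ := exists_norm_dipole_le hτ h
  have hc := continuous_expRay τ
  refine ((integrable_logWeight.comp_sub_right (Real.log ‖z‖)).const_mul C).mono' ?_
    (Eventually.of_forall hC)
  refine (Continuous.div ?_ ?_ fun x =>
    mul_ne_zero (expRay_sub_ne_zero h x) (expRay_add_ne_zero h x)).aestronglyMeasurable
  · fun_prop
  · fun_prop

/-- The sign is constant along the ray. Hence the quotient stays in the slit plane, where the
principal logarithm is a primitive of the dipole, and the sign tells from which side the quotient
approaches `-1`. -/
theorem im_expRay_quotient (z τ : ℂ) (x : ℝ) :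
    ((expRay τ x - z) / (expRay τ x + z)).im =
      -2 * Real.exp x * (z * conj τ).im / Complex.normSq (expRay τ x + z) := by
  rw [Complex.div_im, expRay]
  simp only [Complex.sub_re, Complex.sub_im, Complex.add_re, Complex.add_im, Complex.mul_re,
    Complex.mul_im, Complex.ofReal_re, Complex.ofReal_im, Complex.conj_re, Complex.conj_im]
  ring

theorem hasDerivAt_expRay (τ : ℂ) (x : ℝ) : HasDerivAt (expRay τ) (expRay τ x) x := by
  unfold expRay
  exact ((Real.hasDerivAt_exp x).ofReal_comp).mul_const τ

theorem hasDerivAt_log_expRay_quotient (h : (z * conj τ).im ≠ 0) (x : ℝ) :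
    HasDerivAt (fun x => Complex.log ((expRay τ x - z) / (expRay τ x + z)))
      (dipole z (expRay τ x)) x := by
  have h1 := expRay_sub_ne_zero h x
  have h2 := expRay_add_ne_zero h x
  have hd := ((hasDerivAt_expRay τ x).sub_const z).div ((hasDerivAt_expRay τ x).add_const z) h2
  have hs : (expRay τ x - z) / (expRay τ x + z) ∈ Complex.slitPlane := by
    rw [Complex.mem_slitPlane_iff]
    right
    rw [im_expRay_quotient]
    refine div_ne_zero (mul_ne_zero (mul_ne_zero (by norm_num) (Real.exp_pos x).ne') h) ?_
    exact Complex.normSq_eq_zero.not.2 h2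
  refine (hd.clog_real hs).congr_deriv ?_
  simp only [Pi.div_apply, dipole]
  field_simp
  ring

theorem tendsto_expRay_atBot (τ : ℂ) : Tendsto (expRay τ) atBot (𝓝 0) := by
  have : Tendsto (fun x => ((Real.exp x : ℝ) : ℂ) * τ) atBot (𝓝 (((0 : ℝ) : ℂ) * τ)) :=
    (Complex.continuous_ofReal.continuousAt.tendsto.comp Real.tendsto_exp_atBot).mul_const τ
  rw [Complex.ofReal_zero, zero_mul] at this
  exact this

theorem tendsto_expRay_quotient_atBot (hz : z ≠ 0) :
    Tendsto (fun x => (expRay τ x - z) / (expRay τ x + z)) atBot (𝓝 (-1)) := by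
  have h := tendsto_expRay_atBot τ
  have : Tendsto (fun x => (expRay τ x - z) / (expRay τ x + z)) atBot
      (𝓝 ((0 - z) / (0 + z))) := (h.sub_const z).div (h.add_const z) (by simpa using hz)
  simpa [hz, neg_div] using this

theorem tendsto_expRay_quotient_atTop (hτ : ‖τ‖ = 1) (z : ℂ) :
    Tendsto (fun x => (expRay τ x - z) / (expRay τ x + z)) atTop (𝓝 1) := by
  have h : Tendsto (fun x => z * (expRay τ x)⁻¹) atTop (𝓝 0) := by
    have h1 : Tendsto (fun x => (expRay τ x)⁻¹) atTop (𝓝 0) := by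
      rw [tendsto_zero_iff_norm_tendsto_zero]
      simp only [norm_inv, norm_expRay hτ]
      exact tendsto_inv_atTop_zero.comp Real.tendsto_exp_atTop
    simpa using h1.const_mul z
  have h2 : Tendsto (fun x => (1 - z * (expRay τ x)⁻¹) / (1 + z * (expRay τ x)⁻¹)) atTop
      (𝓝 ((1 - 0) / (1 + 0))) := (h.const_sub 1).div (h.const_add 1) (by simp)
  simp only [sub_zero, add_zero, div_one] at h2
  refine h2.congr fun x => ?_
  have := expRay_ne_zero hτ x
  rw [← mul_div_mul_left _ _ this]
  congr 1 <;> field_simp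

theorem tendsto_log_expRay_quotient_atTop (hτ : ‖τ‖ = 1) (z : ℂ) :
    Tendsto (fun x => Complex.log ((expRay τ x - z) / (expRay τ x + z))) atTop (𝓝 0) := by
  have h := (continuousAt_clog (x := 1) (by simp)).tendsto.comp
    (tendsto_expRay_quotient_atTop hτ z)
  rw [Complex.log_one] at h
  exact h

/-- The quotient runs through the upper half-plane from `-1` to `1`, so its logarithm goes from `πi`
to `0`. -/
theorem integral_dipole_of_im_neg (hτ : ‖τ‖ = 1) (h : (z * conj τ).im < 0) :
    ∫ x, dipole z (expRay τ x) = -(Real.pi * Complex.I) := by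
  have hz : z ≠ 0 := by rintro rfl; simp at h
  have hbot : Tendsto (fun x => Complex.log ((expRay τ x - z) / (expRay τ x + z))) atBot
      (𝓝 (Real.pi * Complex.I)) := by
    have h1 := Complex.tendsto_log_nhdsWithin_im_nonneg_of_re_neg_of_im_zero (z := -1)
      (by simp) (by simp)
    simp only [norm_neg, norm_one, Real.log_one, Complex.ofReal_zero, zero_add] at h1
    refine h1.comp (tendsto_nhdsWithin_iff.2 ⟨tendsto_expRay_quotient_atBot hz,
      Eventually.of_forall fun x => ?_⟩)
    change (0 : ℝ) ≤ Complex.im _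
    rw [im_expRay_quotient]
    refine div_nonneg ?_ (Complex.normSq_nonneg _)
    nlinarith [Real.exp_pos x]
  rw [integral_of_hasDerivAt_of_tendsto (fun x => hasDerivAt_log_expRay_quotient h.ne x)
    (integrable_dipole hτ h.ne) hbot (tendsto_log_expRay_quotient_atTop hτ z), zero_sub]

/-- Now the path is in the lower half-plane and the logarithm starts at `-πi`. The difference `2πi`
of the two cases is the residue. -/
theorem integral_dipole_of_im_pos (hτ : ‖τ‖ = 1) (h : 0 < (z * conj τ).im) :
    ∫ x, dipole z (expRay τ x) = Real.pi * Complex.I := by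
  have hz : z ≠ 0 := by rintro rfl; simp at h
  have hbot : Tendsto (fun x => Complex.log ((expRay τ x - z) / (expRay τ x + z))) atBot
      (𝓝 (-(Real.pi * Complex.I))) := by
    have h1 := Complex.tendsto_log_nhdsWithin_im_neg_of_re_neg_of_im_zero (z := -1)
      (by simp) (by simp)
    simp only [norm_neg, norm_one, Real.log_one, Complex.ofReal_zero, zero_sub] at h1
    refine h1.comp (tendsto_nhdsWithin_iff.2 ⟨tendsto_expRay_quotient_atBot hz,
      Eventually.of_forall fun x => ?_⟩)
    change Complex.im _ < (0 : ℝ)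
    rw [im_expRay_quotient]
    refine div_neg_of_neg_of_pos ?_ (Complex.normSq_pos.2 (expRay_add_ne_zero h.ne' x))
    nlinarith [Real.exp_pos x, mul_pos (Real.exp_pos x) h]
  rw [integral_of_hasDerivAt_of_tendsto (fun x => hasDerivAt_log_expRay_quotient h.ne' x)
    (integrable_dipole hτ h.ne') hbot (tendsto_log_expRay_quotient_atTop hτ z), zero_sub, neg_neg]

variable {σ : ℂ} {δ η : ℝ} {h : ℂ → ℂ}

theorem im_mul_conj_neg_of_mem_openSector (hz : z ∈ openSector σ δ) : (z * conj σ).im < 0 :=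
  Complex.arg_neg_iff.1 hz.2.2

theorem mul_conj_rot (z σ : ℂ) (δ : ℝ) :
    z * conj (rot σ δ) = Complex.exp (δ * Complex.I) * (z * conj σ) := by
  rw [rot, map_mul, ← Complex.exp_conj]
  simp only [map_neg, map_mul, Complex.conj_ofReal, Complex.conj_I, mul_neg, neg_neg]
  ring

theorem mul_conj_eq_polar (hσ : ‖σ‖ = 1) (z : ℂ) :
    z * conj σ = ‖z‖ * Complex.exp ((z * conj σ).arg * Complex.I) := by
  conv_lhs => rw [← Complex.norm_mul_exp_arg_mul_I (z * conj σ)]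
  rw [norm_mul, Complex.norm_conj, hσ, mul_one]

theorem mul_conj_rot_eq_polar (hσ : ‖σ‖ = 1) (z : ℂ) (δ : ℝ) :
    z * conj (rot σ δ) = ‖z‖ * Complex.exp (((δ + (z * conj σ).arg : ℝ) : ℂ) * Complex.I) := by
  rw [mul_conj_rot, mul_conj_eq_polar hσ z, mul_left_comm, ← Complex.exp_add]
  push_cast
  rw [add_mul, ← mul_conj_eq_polar hσ z]

theorem im_mul_conj_rot_pos_of_mem_openSector (hσ : ‖σ‖ = 1) (hδ : δ ≤ 1 / 2)
    (hz : z ∈ openSector σ δ) : 0 < (z * conj (rot σ δ)).im := by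
  rw [mul_conj_rot_eq_polar hσ, Complex.im_ofReal_mul, Complex.exp_ofReal_mul_I_im]
  refine mul_pos (norm_pos_iff.2 hz.1) (Real.sin_pos_of_pos_of_lt_pi ?_ ?_)
  · linarith [hz.2.1]
  · linarith [hz.2.2, Real.pi_gt_three]

/-- The two summands majorize the kernel term and the dipole term on the vertical side `Re t = x`,
where only `‖w‖ = exp x` is known. At `+∞` the fractions are reduced by `exp x`. -/
theorem tendsto_sides {r : ℝ} (hr : 0 < r) (A B : ℝ) :
    Tendsto (fun x => (Real.exp x + r) / |Real.exp x - r| * (A * logWeight x) +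
      B * (2 * r * Real.exp x / (|Real.exp x - r|) ^ 2)) (cocompact ℝ) (𝓝 0) := by
  have hdiv : ∀ x : ℝ, Real.exp x = (Real.exp (-x))⁻¹ := fun x => by rw [Real.exp_neg, inv_inv]
  have hinv : Tendsto (fun x => Real.exp (-x)) atTop (𝓝 0) := Real.tendsto_exp_neg_atTop_nhds_zero
  rw [cocompact_eq_atBot_atTop, tendsto_sup]
  constructor
  · have h0 := Real.tendsto_exp_atBot
    have h1 : Tendsto (fun x => (Real.exp x + r) / |Real.exp x - r|) atBot
        (𝓝 ((0 + r) / |0 - r|)) :=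
      (h0.add_const r).div (h0.sub_const r).abs (by simpa using hr.ne')
    have h2 : Tendsto (fun x => 2 * r * Real.exp x / (|Real.exp x - r|) ^ 2) atBot
        (𝓝 (2 * r * 0 / |0 - r| ^ 2)) :=
      (h0.const_mul _).div ((h0.sub_const r).abs.pow 2) (by simpa using hr.ne')
    have h3 := (tendsto_logWeight.mono_left atBot_le_cocompact).const_mul A
    simpa using (h1.mul h3).add (h2.const_mul B)
  · have h1 : Tendsto (fun x => (1 + r * Real.exp (-x)) / |1 - r * Real.exp (-x)|) atTop
        (𝓝 ((1 + r * 0) / |1 - r * 0|)) :=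
      ((hinv.const_mul r).const_add 1).div ((hinv.const_mul r).const_sub 1).abs (by simp)
    have h2 : Tendsto (fun x => 2 * r * Real.exp (-x) / |1 - r * Real.exp (-x)| ^ 2) atTop
        (𝓝 (2 * r * 0 / |1 - r * 0| ^ 2)) :=
      (hinv.const_mul _).div (((hinv.const_mul r).const_sub 1).abs.pow 2) (by simp)
    have h3 := (tendsto_logWeight.mono_left atTop_le_cocompact).const_mul A
    have h4 := (h1.mul h3).add (h2.const_mul B)
    simp only [mul_zero, add_zero, zero_div] at h4
    refine h4.congr fun x => ?_
    have hx := Real.exp_pos x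
    have habs : |1 - r * Real.exp (-x)| = Real.exp (-x) * |Real.exp x - r| := by
      rw [← abs_of_pos (Real.exp_pos (-x)), ← abs_mul, abs_of_pos (Real.exp_pos (-x)), mul_sub,
        ← Real.exp_add]
      simp [mul_comm]
    rw [habs, Real.exp_neg]
    congr 1
    · congr 1
      rw [← mul_div_mul_left _ (|Real.exp x - r|) (inv_ne_zero hx.ne')]
      congr 1
      field_simp
    · congr 1
      rw [mul_pow, ← mul_div_mul_left _ (|Real.exp x - r| ^ 2)
        (pow_ne_zero 2 (inv_ne_zero hx.ne'))]
      congr 1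
      field_simp

/-- The contribution of the pole when the contour of the ray integral is rotated across it. -/
theorem SectorBound.rayInt_eq_of_mem (hh : SectorBound σ δ η h) (hσ : ‖σ‖ = 1) (hδ0 : 0 ≤ δ)
    (hδ : δ ≤ 1 / 2) (hz : z ∈ openSector σ δ) :
    rayInt σ h z = rayInt (rot σ δ) h z - 4 * Real.pi * Complex.I * h z := by
  have hz0 : z ≠ 0 := hz.1
  have hr : 0 < ‖z‖ := norm_pos_iff.2 hz0
  have him := im_mul_conj_neg_of_mem_openSector hz
  have him' := im_mul_conj_rot_pos_of_mem_openSector hσ hδ hz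
  have hmem := (isOpen_openSector hσ).mem_nhds hz
  have hadd : ∀ w ∈ sector σ δ, w + z ≠ 0 := by
    intro w hw h0
    have h1 := re_pos_of_mem_sector hσ hδ hw
    have h2 := re_pos_of_mem_sector hσ hδ (openSector_subset_sector hz)
    rw [eq_neg_of_add_eq_zero_left h0, neg_mul, Complex.neg_re] at h1
    linarith
  -- The correction equals `h z` at `w = z`, and its pole `-z` is outside the sector; so `Y` is
  -- regular there and vanishes at `z`.
  set Y : ℂ → ℂ := fun w => h w - h z * (2 * z / (w + z)) with hY
  have hYz : Y z = 0 := by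
    have : z + z ≠ 0 := by simpa [← two_mul] using hz0
    rw [hY]
    field_simp
    ring
  have hYc : ContinuousOn Y (sector σ δ) :=
    hh.cont.sub (continuousOn_const.mul (ContinuousOn.div (by fun_prop) (by fun_prop) hadd))
  have hYd : ∀ w ∈ openSector σ δ, DifferentiableAt ℂ Y w := fun w hw => by
    have hdiv : DifferentiableAt ℂ (fun w => 2 * z / (w + z)) w :=
      DifferentiableAt.div (by fun_prop) (by fun_prop) (hadd w (openSector_subset_sector hw))
    exact ((hh.holo w hw).differentiableAt ((isOpen_openSector hσ).mem_nhds hw)).sub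
      (hdiv.const_mul _)
  -- Since `kernel w z = 2w / (w - z) - 1`, this is `kernel w z * h w - 2 h(z) dipole z w` off `z`,
  -- and `dslope` fills in the removable singularity. The shift of contours applies to `F`; the
  -- dipole is integrated explicitly.
  set F : ℂ → ℂ := fun t => 2 * (Complex.exp t * σ) * dslope Y z (Complex.exp t * σ) -
    h (Complex.exp t * σ) with hF
  have hformula : ∀ w ∈ sector σ δ, w ≠ z →
      2 * w * dslope Y z w - h w = kernel w z * h w - 2 * h z * dipole z w := by
    intro w hw hwz
    have h1 := hadd w hw
    have h2 : w - z ≠ 0 := sub_ne_zero.2 hwz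
    rw [dslope_of_ne _ hwz, slope_def_field, hYz, sub_zero, hY, kernel_coe, dipole]
    field_simp
    ring
  have hF0 : ∀ x : ℝ, F x = kernel (expRay σ x) z * h (expRay σ x) -
      2 * h z * dipole z (expRay σ x) := by
    intro x
    have hs := exp_mul_mem_sector hσ hδ (t := x) (by simpa using hδ0) (by simp)
    rw [exp_ofReal_mul] at hs
    rw [hF]
    simp only [exp_ofReal_mul]
    exact hformula _ hs (sub_ne_zero.1 (expRay_sub_ne_zero him.ne x))
  have hF1 : ∀ x : ℝ, F (x - δ * Complex.I) =
      kernel (expRay (rot σ δ) x) z * h (expRay (rot σ δ) x) -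
      2 * h z * dipole z (expRay (rot σ δ) x) := by
    intro x
    have hs := exp_mul_mem_sector hσ hδ (t := x - δ * Complex.I) (by simp) (by simpa using hδ0)
    rw [exp_sub_mul] at hs
    rw [hF]
    simp only [exp_sub_mul]
    exact hformula _ hs (sub_ne_zero.1 (expRay_sub_ne_zero him'.ne' x))
  have happ : ∀ τ : ℂ, ‖τ‖ = 1 → (z * conj τ).im ≠ 0 → RayBound τ η h →
      Integrable fun x => kernel (expRay τ x) z * h (expRay τ x) := by
    intro τ hτ him hR
    refine hR.integrable (ρ := |(z * conj τ).re| / ‖z‖) hτ (by positivity) ?_ ?_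
    · rw [div_lt_one hr]
      simpa [hτ] using abs_re_lt_norm_of_im_ne_zero him
    · rw [coe_mem_apart, div_mul_cancel₀ _ hr.ne']
      exact le_abs_self _
  have hrot := norm_rot hσ δ
  have hi0 := happ σ hσ him.ne (hh.rayBound hσ hδ0 hδ)
  have hi1 := happ _ hrot him'.ne' (hh.rayBound_rot hσ hδ0 hδ)
  have hd0 := (integrable_dipole hσ him.ne).const_mul (2 * h z)
  have hd1 := (integrable_dipole hrot him'.ne').const_mul (2 * h z)
  have key := integral_eq_integral_sub_mul_I (F := F) (z := Complex.log (z * conj σ))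
    (b := fun x => (Real.exp x + ‖z‖) / |Real.exp x - ‖z‖| * (η * logWeight x) +
      2 * ‖h z‖ * (2 * ‖z‖ * Real.exp x / (|Real.exp x - ‖z‖|) ^ 2)) hδ0 ?_ ?_ ?_ ?_ ?_
    (tendsto_sides hr _ _)
  · simp only [hF0, hF1] at key
    -- The dipole integral is `-πi` on the original ray and `πi` on the rotated one; the factor `2
    -- h(z)` gives the jump `4πi h(z)`.
    rw [integral_sub hi0 hd0, integral_sub hi1 hd1, integral_const_mul, integral_const_mul,
      integral_dipole_of_im_neg hσ him, integral_dipole_of_im_pos hrot him'] at key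
    rw [rayInt, rayInt]
    linear_combination key
  · refine ContinuousOn.sub (ContinuousOn.mul (by fun_prop) ?_) (hh.continuousOn_exp hσ hδ)
    have : ContinuousOn (dslope Y z) (sector σ δ) :=
      (continuousOn_dslope (mem_of_superset hmem openSector_subset_sector)).2 ⟨hYc, hYd z hz⟩
    exact this.comp (by fun_prop) fun t ht => exp_mul_mem_sector hσ hδ ht.1 ht.2
  · intro t h1 h2 hne
    have hs := exp_mul_mem_openSector hσ hδ h1 h2
    have hwz : Complex.exp t * σ ≠ z := by
      rintro rfl
      apply hne
      rw [exp_mul_mul_conj hσ, Complex.log_exp (by linarith [Real.pi_gt_three])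
        (by linarith [Real.pi_gt_three])]
    refine DifferentiableAt.sub (DifferentiableAt.mul (by fun_prop) ?_) ?_
    · exact DifferentiableAt.comp t ((differentiableAt_dslope_of_ne hwz).2 (hYd _ hs)) (by fun_prop)
    · exact DifferentiableAt.comp t ((hh.holo _ hs).differentiableAt
        ((isOpen_openSector hσ).mem_nhds hs)) (by fun_prop)
  · simp only [hF0]; exact hi0.sub hd0
  · simp only [hF1]; exact hi1.sub hd1
  · have hne : ∀ᶠ x : ℝ in cocompact ℝ, x ≠ Real.log ‖z‖ :=
      (isCompact_singleton (x := Real.log ‖z‖)).compl_mem_cocompact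
    filter_upwards [hne] with x hx y hy
    have hx' : 0 < |Real.exp x - ‖z‖| := by
      rw [abs_pos, sub_ne_zero]
      intro h0
      exact hx (by rw [← h0, Real.log_exp])
    set t : ℂ := x + (y : ℝ) * Complex.I with ht
    have hre : t.re = x := by simp [ht]
    have him : t.im = y := by simp [ht]
    set w := Complex.exp t * σ with hw
    have hs : w ∈ sector σ δ := exp_mul_mem_sector hσ hδ (by rw [him]; exact hy.1)
      (by rw [him]; exact hy.2)
    have hnw : ‖w‖ = Real.exp x := by rw [hw, norm_exp_mul hσ, hre]
    have h1 : |Real.exp x - ‖z‖| ≤ ‖w - z‖ := by rw [← hnw]; exact abs_norm_sub_norm_le w z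
    have h2 : |Real.exp x - ‖z‖| ≤ ‖w + z‖ := by
      rw [← hnw]; simpa using abs_norm_sub_norm_le w (-z)
    have hwz : w ≠ z := by
      rintro h0
      rw [h0, sub_self, norm_zero] at h1
      linarith
    have hFt : F t = kernel w z * h w - 2 * h z * dipole z w := hformula w hs hwz
    have hhw := hh.norm_exp_le hσ hδ (t := t) (by rw [him]; exact hy.1) (by rw [him]; exact hy.2)
    rw [hre, ← hw] at hhw
    rw [hFt]
    clear_value w
    refine (norm_sub_le _ _).trans (add_le_add ?_ ?_)
    · rw [norm_mul, kernel_coe, norm_div]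
      gcongr
      exact (norm_add_le _ _).trans (by rw [hnw])
    · simp only [dipole, norm_mul, norm_div, Complex.norm_ofNat, hnw, sq]
      gcongr

end Residue

/-! ### Boundary values of the ray integral from the two sides. -/

section BoundaryValues

variable {σ : ℂ} {δ η : ℝ} {h : ℂ → ℂ}

/-- The affine coordinate on the Riemann sphere, with junk value `0` at `∞`. -/
def toC (ζ : OnePoint ℂ) : ℂ := ζ.elim 0 id

@[simp] theorem toC_coe (z : ℂ) : toC (z : OnePoint ℂ) = z := rfl

theorem coe_mem_image {z : ℂ} {s : Set ℂ} :
    (z : OnePoint ℂ) ∈ ((↑) : ℂ → OnePoint ℂ) '' s ↔ z ∈ s := by simp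

theorem infty_notMem_image {s : Set ℂ} :
    (OnePoint.infty : OnePoint ℂ) ∉ ((↑) : ℂ → OnePoint ℂ) '' s := by simp

theorem continuousWithinAt_coe_iff {X : Type*} [TopologicalSpace X] {f : OnePoint ℂ → X}
    {s : Set (OnePoint ℂ)} {z : ℂ} : ContinuousWithinAt f s (z : OnePoint ℂ) ↔
      ContinuousWithinAt (fun z : ℂ => f z) (((↑) : ℂ → OnePoint ℂ) ⁻¹' s) z := by
  rw [ContinuousWithinAt, ContinuousWithinAt, nhdsWithin, nhdsWithin, OnePoint.nhds_coe_eq,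
    ← Filter.map_inf_principal_preimage, tendsto_map'_iff]
  rfl

theorem continuousWithinAt_infty_of_tendsto {X : Type*} [TopologicalSpace X] {f : OnePoint ℂ → X}
    {s : Set (OnePoint ℂ)} (h : Tendsto (fun z : ℂ => f z)
      (cocompact ℂ ⊓ 𝓟 (((↑) : ℂ → OnePoint ℂ) ⁻¹' s)) (𝓝 (f OnePoint.infty))) :
    ContinuousWithinAt f s OnePoint.infty := by
  rw [ContinuousWithinAt, nhdsWithin, OnePoint.nhds_infty_eq, inf_sup_right, tendsto_sup,
    ← Filter.map_inf_principal_preimage, tendsto_map'_iff, coclosedCompact_eq_cocompact]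
  exact ⟨h, (tendsto_pure_nhds f _).mono_left inf_le_left⟩

theorem isClosed_infty_union_image {s : Set ℂ} (hs : IsClosed s) :
    IsClosed ({OnePoint.infty} ∪ ((↑) : ℂ → OnePoint ℂ) '' s) := by
  rw [← isOpen_compl_iff]
  have : ({OnePoint.infty} ∪ ((↑) : ℂ → OnePoint ℂ) '' s)ᶜ = ((↑) : ℂ → OnePoint ℂ) '' sᶜ := by
    ext ζ
    induction ζ using OnePoint.rec <;> simp
  rw [this, OnePoint.isOpen_image_coe]
  exact hs.isOpen_compl

theorem mem_ray_iff (hσ : ‖σ‖ = 1) {z : ℂ} :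
    z ∈ ray σ ↔ z ≠ 0 ∧ (z * conj σ).arg = 0 := by
  constructor
  · rintro ⟨s, hs, rfl⟩
    refine ⟨?_, ?_⟩
    · refine mul_ne_zero (by exact_mod_cast hs.ne') ?_
      rw [← norm_pos_iff, hσ]; exact one_pos
    · rw [mul_assoc, Complex.mul_conj', hσ]
      simpa using Complex.arg_ofReal_of_nonneg hs.le
  · rintro ⟨h0, h1⟩
    refine ⟨‖z‖, norm_pos_iff.2 h0, ?_⟩
    have := mul_conj_eq_polar hσ z
    rw [h1] at this
    simp only [Complex.ofReal_zero, zero_mul, Complex.exp_zero, mul_one] at this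
    rw [← this, mul_conj_mul_self hσ]

theorem re_mul_conj_eq (hσ : ‖σ‖ = 1) (z : ℂ) :
    (z * conj σ).re = ‖z‖ * Real.cos (z * conj σ).arg := by
  conv_lhs => rw [mul_conj_eq_polar hσ z]
  rw [Complex.re_ofReal_mul, Complex.exp_ofReal_mul_I_re]

theorem ray_subset_sector (hσ : ‖σ‖ = 1) (hδ0 : 0 ≤ δ) : ray σ ⊆ sector σ δ := fun z hz => by
  obtain ⟨h0, h1⟩ := (mem_ray_iff hσ).1 hz
  exact ⟨h0, by rw [h1]; linarith, h1.le⟩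

/-- A point off a ray is apart from its direction. -/
theorem exists_mem_apart (hσ : ‖σ‖ = 1) {ζ : OnePoint ℂ}
    (hζ : ζ ∉ ((↑) : ℂ → OnePoint ℂ) '' ray σ) : ∃ ρ : ℝ, 0 ≤ ρ ∧ ρ < 1 ∧ ζ ∈ apart σ ρ := by
  induction ζ using OnePoint.rec with
  | infty => exact ⟨0, le_rfl, one_pos, infty_mem_apart _ _⟩
  | coe z =>
    rw [coe_mem_image, mem_ray_iff hσ, not_and] at hζ
    rcases eq_or_ne z 0 with rfl | hz
    · exact ⟨0, le_rfl, one_pos, by simp [coe_mem_apart]⟩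
    refine ⟨max 0 (Real.cos (z * conj σ).arg), le_max_left _ _, max_lt one_pos ?_, ?_⟩
    · refine lt_of_le_of_ne (Real.cos_le_one _) fun h1 => hζ hz ?_
      have h2 := Complex.neg_pi_lt_arg (z * conj σ)
      have h3 := Complex.arg_le_pi (z * conj σ)
      exact (Real.cos_eq_one_iff_of_lt_of_lt (by linarith) (by linarith [Real.pi_pos])).1 h1
    · rw [coe_mem_apart, re_mul_conj_eq hσ, mul_comm]
      gcongr
      exact le_max_right _ _

open Classical in
/-- The ray integral, with its boundary values from the counterclockwise side on the ray. -/
noncomputable def leftInt (σ : ℂ) (δ : ℝ) (h : ℂ → ℂ) (ζ : OnePoint ℂ) : ℂ :=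
  if ζ ∈ ((↑) : ℂ → OnePoint ℂ) '' ray σ then rayInt (rot σ δ) h ζ else rayInt σ h ζ

open Classical in
/-- The ray integral, with its boundary values from the clockwise side on the ray. -/
noncomputable def rightInt (σ : ℂ) (δ : ℝ) (h : ℂ → ℂ) (ζ : OnePoint ℂ) : ℂ :=
  if ζ ∈ ((↑) : ℂ → OnePoint ℂ) '' ray σ then
    rayInt (rot σ δ) h ζ - 4 * Real.pi * Complex.I * h (toC ζ)
  else rayInt σ h ζ

theorem leftInt_of_mem {ζ : OnePoint ℂ} (hζ : ζ ∈ ((↑) : ℂ → OnePoint ℂ) '' ray σ) :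
    leftInt σ δ h ζ = rayInt (rot σ δ) h ζ := if_pos hζ

theorem leftInt_of_notMem {ζ : OnePoint ℂ} (hζ : ζ ∉ ((↑) : ℂ → OnePoint ℂ) '' ray σ) :
    leftInt σ δ h ζ = rayInt σ h ζ := if_neg hζ

theorem rightInt_of_mem {ζ : OnePoint ℂ} (hζ : ζ ∈ ((↑) : ℂ → OnePoint ℂ) '' ray σ) :
    rightInt σ δ h ζ = rayInt (rot σ δ) h ζ - 4 * Real.pi * Complex.I * h (toC ζ) := if_pos hζ

theorem rightInt_of_notMem {ζ : OnePoint ℂ} (hζ : ζ ∉ ((↑) : ℂ → OnePoint ℂ) '' ray σ) :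
    rightInt σ δ h ζ = rayInt σ h ζ := if_neg hζ

theorem coe_mem_closedHalfPlane {z : ℂ} :
    (z : OnePoint ℂ) ∈ closedHalfPlane σ ↔ 0 ≤ (z * conj σ).im := by
  simp [closedHalfPlane]

theorem infty_mem_closedHalfPlane : OnePoint.infty ∈ closedHalfPlane σ := Or.inl rfl

theorem cos_half_nonneg (hδ0 : 0 ≤ δ) (hδ : δ ≤ 1 / 2) : 0 ≤ Real.cos (δ / 2) :=
  Real.cos_nonneg_of_neg_pi_div_two_le_of_le (by linarith [Real.pi_pos])
    (by linarith [Real.pi_gt_three])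

theorem cos_half_lt_one (hδ0 : 0 < δ) (hδ : δ ≤ 1 / 2) : Real.cos (δ / 2) < 1 := by
  have := Real.cos_lt_cos_of_nonneg_of_le_pi (x := 0) (y := δ / 2) le_rfl
    (by linarith [Real.pi_gt_three]) (by linarith)
  simpa using this

/-- The rotated ray lies at angle `δ` on the other side, so the points of this half-plane stay at
angle at least `δ` from it. The weaker `δ / 2` is the value that also serves near the ray on the
clockwise side. -/
theorem closedHalfPlane_subset_apart_rot (hσ : ‖σ‖ = 1) (hδ0 : 0 ≤ δ) (hδ : δ ≤ 1 / 2) :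
    closedHalfPlane σ ⊆ apart (rot σ δ) (Real.cos (δ / 2)) := by
  intro ζ hζ
  induction ζ using OnePoint.rec with
  | infty => exact infty_mem_apart _ _
  | coe z =>
    rw [coe_mem_closedHalfPlane] at hζ
    rw [coe_mem_apart, mul_conj_rot, Complex.mul_re, Complex.exp_ofReal_mul_I_re,
      Complex.exp_ofReal_mul_I_im]
    have h1 : (z * conj σ).re ≤ ‖z‖ := (Complex.re_le_norm _).trans (by simp [hσ])
    have h2 : 0 ≤ Real.sin δ := Real.sin_nonneg_of_nonneg_of_le_pi hδ0
      (by linarith [Real.pi_gt_three])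
    have h3 : Real.cos δ ≤ Real.cos (δ / 2) := Real.cos_le_cos_of_nonneg_of_le_pi (by linarith)
      (by linarith [Real.pi_gt_three]) (by linarith)
    have h4 : 0 ≤ Real.cos δ := Real.cos_nonneg_of_neg_pi_div_two_le_of_le
      (by linarith [Real.pi_pos]) (by linarith [Real.pi_gt_three])
    have h5 := norm_nonneg z
    nlinarith [mul_nonneg h2 hζ, mul_le_mul_of_nonneg_left h1 h4]

theorem notMem_sector_of_im_nonneg (hσ : ‖σ‖ = 1) {z : ℂ} (h : 0 ≤ (z * conj σ).im)
    (hz : z ∉ ray σ) : z ∉ sector σ δ := fun hs =>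
  hz ((mem_ray_iff hσ).2 ⟨hs.1, le_antisymm hs.2.2 (Complex.arg_nonneg_iff.2 h)⟩)

/-- The closed counterclockwise half-plane meets the sector only in the ray itself. Off the ray the
contour may thus be rotated freely, and on the ray the rotated integral is the value by definition.
-/
theorem SectorBound.leftInt_eq (hh : SectorBound σ δ η h) (hσ : ‖σ‖ = 1) (hδ0 : 0 ≤ δ)
    (hδ : δ ≤ 1 / 2) {ζ : OnePoint ℂ} (hζ : ζ ∈ closedHalfPlane σ) :
    leftInt σ δ h ζ = rayInt (rot σ δ) h ζ := by
  by_cases hr : ζ ∈ ((↑) : ℂ → OnePoint ℂ) '' ray σ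
  · exact leftInt_of_mem hr
  · rw [leftInt_of_notMem hr]
    refine hh.rayInt_eq_of_notMem hσ hδ0 hδ ?_
    induction ζ using OnePoint.rec with
    | infty => exact infty_notMem_image
    | coe z =>
      rw [coe_mem_image] at hr ⊢
      exact notMem_sector_of_im_nonneg hσ (coe_mem_closedHalfPlane.1 hζ) hr

theorem SectorBound.continuousOn_leftInt (hh : SectorBound σ δ η h) (hσ : ‖σ‖ = 1) (hδ0 : 0 < δ)
    (hδ : δ ≤ 1 / 2) : ContinuousOn (leftInt σ δ h) (closedHalfPlane σ) :=
  (((hh.rayBound_rot hσ hδ0.le hδ).continuousOn_rayInt (norm_rot hσ δ)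
    (cos_half_nonneg hδ0.le hδ) (cos_half_lt_one hδ0 hδ)).mono
    (closedHalfPlane_subset_apart_rot hσ hδ0.le hδ)).congr
    fun _ hζ => hh.leftInt_eq hσ hδ0.le hδ hζ

/-- The part of the closed clockwise half-plane that is close to `ray σ`. -/
def nearPart (σ : ℂ) (δ : ℝ) : Set (OnePoint ℂ) :=
  {OnePoint.infty} ∪ ((↑) : ℂ → OnePoint ℂ) ''
    {z | (z * conj σ).im ≤ 0 ∧ Real.cos (δ / 2) * ‖z‖ ≤ (z * conj σ).re}

/-- The part of the closed clockwise half-plane that is far from `ray σ`. -/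
def farPart (σ : ℂ) (δ : ℝ) : Set (OnePoint ℂ) :=
  {OnePoint.infty} ∪ ((↑) : ℂ → OnePoint ℂ) ''
    {z | (z * conj σ).im ≤ 0 ∧ (z * conj σ).re ≤ Real.cos (δ / 2) * ‖z‖}

theorem isClosed_nearPart : IsClosed (nearPart σ δ) := by
  refine isClosed_infty_union_image (IsClosed.and ?_ ?_)
  · exact isClosed_le (by fun_prop) (by fun_prop)
  · exact isClosed_le (by fun_prop) (by fun_prop)

theorem isClosed_farPart : IsClosed (farPart σ δ) := by
  refine isClosed_infty_union_image (IsClosed.and ?_ ?_)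
  · exact isClosed_le (by fun_prop) (by fun_prop)
  · exact isClosed_le (by fun_prop) (by fun_prop)

theorem coe_mem_nearPart {z : ℂ} : (z : OnePoint ℂ) ∈ nearPart σ δ ↔
    (z * conj σ).im ≤ 0 ∧ Real.cos (δ / 2) * ‖z‖ ≤ (z * conj σ).re := by simp [nearPart]

theorem coe_mem_farPart {z : ℂ} : (z : OnePoint ℂ) ∈ farPart σ δ ↔
    (z * conj σ).im ≤ 0 ∧ (z * conj σ).re ≤ Real.cos (δ / 2) * ‖z‖ := by simp [farPart]

theorem closedHalfPlane_neg_eq : closedHalfPlane (-σ) = nearPart σ δ ∪ farPart σ δ := by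
  ext ζ
  induction ζ using OnePoint.rec with
  | infty => exact ⟨fun _ => Or.inl (Or.inl rfl), fun _ => infty_mem_closedHalfPlane⟩
  | coe z =>
    rw [coe_mem_closedHalfPlane, mem_union, coe_mem_nearPart, coe_mem_farPart, map_neg, mul_neg,
      Complex.neg_im, neg_nonneg, ← and_or_left]
    exact ⟨fun h => ⟨h, le_total _ _⟩, fun h => h.1⟩

theorem farPart_subset_apart : farPart σ δ ⊆ apart σ (Real.cos (δ / 2)) := by
  intro ζ hζ
  induction ζ using OnePoint.rec with
  | infty => exact infty_mem_apart _ _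
  | coe z => exact coe_mem_apart.2 (coe_mem_farPart.1 hζ).2

theorem arg_mem_of_mem_nearPart (hσ : ‖σ‖ = 1) (hδ0 : 0 ≤ δ) (hδ : δ ≤ 1 / 2) {z : ℂ} (hz : z ≠ 0)
    (h : (z : OnePoint ℂ) ∈ nearPart σ δ) :
    -(δ / 2) ≤ (z * conj σ).arg ∧ (z * conj σ).arg ≤ 0 := by
  rw [coe_mem_nearPart] at h
  obtain ⟨h1, h2⟩ := h
  have hz' : 0 < ‖z‖ := norm_pos_iff.2 hz
  have hcos : 0 < Real.cos (δ / 2) := Real.cos_pos_of_mem_Ioo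
    ⟨by linarith [Real.pi_gt_three], by linarith [Real.pi_gt_three]⟩
  have hre : 0 < (z * conj σ).re := (by positivity : 0 < Real.cos (δ / 2) * ‖z‖).trans_le h2
  have harg : (z * conj σ).arg ≤ 0 := by
    rcases h1.lt_or_eq with h3 | h3
    · exact (Complex.arg_neg_iff.2 h3).le
    · exact (Complex.arg_eq_zero_iff.2 ⟨hre.le, h3⟩).le
  refine ⟨?_, harg⟩
  rw [re_mul_conj_eq hσ, mul_comm] at h2
  have h3 := le_of_mul_le_mul_left h2 hz'
  by_contra! h4
  have h5 := Complex.neg_pi_lt_arg (z * conj σ)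
  have := Real.cos_lt_cos_of_nonneg_of_le_pi (x := δ / 2) (y := -(z * conj σ).arg) (by linarith)
    (by linarith) (by linarith)
  rw [Real.cos_neg] at this
  linarith

theorem mem_sector_of_mem_nearPart (hσ : ‖σ‖ = 1) (hδ0 : 0 ≤ δ) (hδ : δ ≤ 1 / 2) {z : ℂ}
    (hz : z ≠ 0) (h : (z : OnePoint ℂ) ∈ nearPart σ δ) : z ∈ sector σ δ := by
  have := arg_mem_of_mem_nearPart hσ hδ0 hδ hz h
  exact ⟨hz, by linarith, this.2⟩

theorem nearPart_subset_apart_rot (hσ : ‖σ‖ = 1) (hδ0 : 0 ≤ δ) (hδ : δ ≤ 1 / 2) :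
    nearPart σ δ ⊆ apart (rot σ δ) (Real.cos (δ / 2)) := by
  intro ζ hζ
  induction ζ using OnePoint.rec with
  | infty => exact infty_mem_apart _ _
  | coe z =>
    rw [coe_mem_apart]
    rcases eq_or_ne z 0 with rfl | hz
    · simp
    obtain ⟨h1, h2⟩ := arg_mem_of_mem_nearPart hσ hδ0 hδ hz hζ
    rw [mul_conj_rot_eq_polar hσ, Complex.re_ofReal_mul, Complex.exp_ofReal_mul_I_re, mul_comm]
    gcongr
    exact Real.cos_le_cos_of_nonneg_of_le_pi (by linarith) (by linarith [Real.pi_gt_three])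
      (by linarith)

/-- The extension of `h` by zero to the vertices `0`, `∞` of the sector. -/
noncomputable def extendZero (h : ℂ → ℂ) (ζ : OnePoint ℂ) : ℂ :=
  ζ.elim 0 fun z => if z = 0 then 0 else h z

theorem extendZero_coe {z : ℂ} (hz : z ≠ 0) : extendZero h z = h z := if_neg hz

theorem extendZero_zero : extendZero h ((0 : ℂ) : OnePoint ℂ) = 0 := if_pos rfl

theorem extendZero_infty : extendZero h OnePoint.infty = 0 := rfl

theorem SectorBound.nonneg (hh : SectorBound σ δ η h) (hσ : ‖σ‖ = 1) (hδ0 : 0 ≤ δ) : 0 ≤ η := by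
  have := (norm_nonneg _).trans (hh.le _ (ray_subset_sector hσ hδ0 (expRay_mem_ray σ 0)))
  exact nonneg_of_mul_nonneg_left this (logWeight_pos _)

theorem SectorBound.norm_le (hh : SectorBound σ δ η h) (hσ : ‖σ‖ = 1) (hδ0 : 0 ≤ δ) {z : ℂ}
    (hz : z ∈ sector σ δ) : ‖h z‖ ≤ η := by
  refine (hh.le z hz).trans (mul_le_of_le_one_right (hh.nonneg hσ hδ0) ?_)
  exact inv_le_one_of_one_le₀ (by nlinarith [sq_nonneg (Real.log ‖z‖)])

theorem tendsto_logWeight_log_zero :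
    Tendsto (fun z : ℂ => logWeight (Real.log ‖z‖)) (𝓝[≠] 0) (𝓝 0) := by
  refine (tendsto_logWeight.mono_left atBot_le_cocompact).comp ?_
  exact Real.tendsto_log_nhdsGT_zero.comp tendsto_norm_nhdsNE_zero

theorem tendsto_logWeight_log_cocompact :
    Tendsto (fun z : ℂ => logWeight (Real.log ‖z‖)) (cocompact ℂ) (𝓝 0) := by
  refine (tendsto_logWeight.mono_left atTop_le_cocompact).comp ?_
  exact Real.tendsto_log_atTop.comp (tendsto_norm_cocompact_atTop (E := ℂ))

/-- The bound by `logWeight` forces `h` to tend to `0` at both vertices of the sector. -/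
theorem SectorBound.continuousOn_extendZero (hh : SectorBound σ δ η h) (hσ : ‖σ‖ = 1)
    (hδ0 : 0 ≤ δ) (hδ : δ ≤ 1 / 2) : ContinuousOn (extendZero h) (nearPart σ δ) := by
  have hle : ∀ z : ℂ, (z : OnePoint ℂ) ∈ nearPart σ δ → z ≠ 0 →
      ‖extendZero h z‖ ≤ η * logWeight (Real.log ‖z‖) := fun z hz hz0 => by
    rw [extendZero_coe hz0]
    exact hh.le z (mem_sector_of_mem_nearPart hσ hδ0 hδ hz0 hz)
  intro ζ hζ
  induction ζ using OnePoint.rec with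
  | infty =>
    refine continuousWithinAt_infty_of_tendsto ?_
    rw [extendZero_infty]
    have h1 : Tendsto (fun z : ℂ => η * logWeight (Real.log ‖z‖))
        (cocompact ℂ ⊓ 𝓟 (((↑) : ℂ → OnePoint ℂ) ⁻¹' nearPart σ δ)) (𝓝 0) := by
      simpa using (tendsto_logWeight_log_cocompact.const_mul η).mono_left inf_le_left
    refine squeeze_zero_norm' ?_ h1
    have hne : ∀ᶠ z : ℂ in cocompact ℂ, z ≠ 0 :=
      (isCompact_singleton (x := (0 : ℂ))).compl_mem_cocompact
    filter_upwards [hne.filter_mono inf_le_left, mem_inf_of_right (mem_principal_self _)]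
      with z hz hz'
    exact hle z hz' hz
  | coe z =>
    rw [continuousWithinAt_coe_iff]
    rcases eq_or_ne z 0 with rfl | hz
    · have h0 : Tendsto (fun z : ℂ => η * logWeight (Real.log ‖z‖)) (𝓝[≠] 0) (𝓝 0) := by
        simpa using tendsto_logWeight_log_zero.const_mul η
      rw [Metric.continuousWithinAt_iff']
      intro ε hε
      have h1 := h0.eventually (gt_mem_nhds hε)
      rw [eventually_nhdsWithin_iff] at h1
      filter_upwards [h1.filter_mono nhdsWithin_le_nhds, self_mem_nhdsWithin] with w hw hw'
      simp only [extendZero_zero, dist_zero_right]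
      rcases eq_or_ne w 0 with rfl | hw0
      · rw [extendZero_zero, norm_zero]; exact hε
      · exact (hle w hw' hw0).trans_lt (hw hw0)
    · have hs := mem_sector_of_mem_nearPart hσ hδ0 hδ hz hζ
      have hne : {w : ℂ | w ≠ 0} ∈ 𝓝 z := isOpen_ne.mem_nhds hz
      have h1 : ContinuousWithinAt h (((↑) : ℂ → OnePoint ℂ) ⁻¹' nearPart σ δ) z := by
        refine ((hh.cont z hs).mono (s := ((↑) : ℂ → OnePoint ℂ) ⁻¹' nearPart σ δ ∩ {w | w ≠ 0})
          fun w hw => mem_sector_of_mem_nearPart hσ hδ0 hδ hw.2 hw.1).mono_of_mem_nhdsWithin ?_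
        exact inter_mem self_mem_nhdsWithin (mem_nhdsWithin_of_mem_nhds hne)
      refine h1.congr_of_eventuallyEq ?_ (extendZero_coe hz)
      filter_upwards [mem_nhdsWithin_of_mem_nhds hne] with w hw
      exact extendZero_coe hw

/-- Rotating the contour crosses `ζ` and picks up the residue. At `0` and `∞` no pole is crossed, in
agreement with the extension of `h` by zero. -/
theorem SectorBound.rightInt_eq_of_mem_nearPart (hh : SectorBound σ δ η h) (hσ : ‖σ‖ = 1)
    (hδ0 : 0 < δ) (hδ : δ ≤ 1 / 2) {ζ : OnePoint ℂ} (hζ : ζ ∈ nearPart σ δ) :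
    rightInt σ δ h ζ =
      rayInt (rot σ δ) h ζ - 4 * Real.pi * Complex.I * extendZero h ζ := by
  induction ζ using OnePoint.rec with
  | infty =>
    rw [rightInt_of_notMem infty_notMem_image, extendZero_infty, mul_zero, sub_zero]
    exact hh.rayInt_eq_of_notMem hσ hδ0.le hδ infty_notMem_image
  | coe z =>
    rcases eq_or_ne z 0 with rfl | hz
    · rw [extendZero_zero, mul_zero, sub_zero, rightInt_of_notMem]
      · exact hh.rayInt_eq_of_notMem hσ hδ0.le hδ fun h => (coe_mem_image.1 h).1 rfl
      · exact fun h => ((mem_ray_iff hσ).1 (coe_mem_image.1 h)).1 rfl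
    · rw [extendZero_coe hz]
      obtain ⟨h1, h2⟩ := arg_mem_of_mem_nearPart hσ hδ0.le hδ hz hζ
      rcases h2.lt_or_eq with h3 | h3
      · rw [rightInt_of_notMem]
        · exact hh.rayInt_eq_of_mem hσ hδ0.le hδ ⟨hz, by linarith, h3⟩
        · exact fun h => h3.ne ((mem_ray_iff hσ).1 (coe_mem_image.1 h)).2
      · rw [rightInt_of_mem (coe_mem_image.2 ((mem_ray_iff hσ).2 ⟨hz, h3⟩)), toC_coe]

theorem rightInt_eq_of_mem_farPart (hσ : ‖σ‖ = 1) (hδ0 : 0 < δ) (hδ : δ ≤ 1 / 2)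
    {ζ : OnePoint ℂ} (hζ : ζ ∈ farPart σ δ) : rightInt σ δ h ζ = rayInt σ h ζ := by
  refine rightInt_of_notMem fun hr => ?_
  obtain ⟨z, hz, rfl⟩ := hr
  obtain ⟨h0, h1⟩ := (mem_ray_iff hσ).1 hz
  have h2 := (coe_mem_farPart.1 hζ).2
  rw [re_mul_conj_eq hσ, h1, Real.cos_zero, mul_one] at h2
  have h3 := cos_half_lt_one hδ0 hδ
  have h4 : 0 < ‖z‖ := norm_pos_iff.2 h0
  nlinarith

/-- Each of the two closed pieces has its own continuous formula: the rotated integral minus the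
residue within angle `δ / 2` of the ray, the original integral beyond. -/
theorem SectorBound.continuousOn_rightInt (hh : SectorBound σ δ η h) (hσ : ‖σ‖ = 1) (hδ0 : 0 < δ)
    (hδ : δ ≤ 1 / 2) : ContinuousOn (rightInt σ δ h) (closedHalfPlane (-σ)) := by
  rw [closedHalfPlane_neg_eq (δ := δ)]
  have h0 := cos_half_nonneg hδ0.le hδ
  have h1 := cos_half_lt_one hδ0 hδ
  refine ContinuousOn.union_of_isClosed ?_ ?_ isClosed_nearPart isClosed_farPart
  · refine ContinuousOn.congr ?_ fun ζ hζ => hh.rightInt_eq_of_mem_nearPart hσ hδ0 hδ hζ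
    exact (((hh.rayBound_rot hσ hδ0.le hδ).continuousOn_rayInt (norm_rot hσ δ) h0 h1).mono
      (nearPart_subset_apart_rot hσ hδ0.le hδ)).sub
      (continuousOn_const.mul (hh.continuousOn_extendZero hσ hδ0.le hδ))
  · refine ContinuousOn.congr ?_ fun ζ hζ => rightInt_eq_of_mem_farPart hσ hδ0 hδ hζ
    exact ((hh.rayBound hσ hδ0.le hδ).continuousOn_rayInt hσ h0 h1).mono farPart_subset_apart

/-- The norm of the operator `rightInt`. -/
noncomputable def rightBound (δ : ℝ) : ℝ := kernelBound (Real.cos (δ / 2)) * Real.pi + 4 * Real.pi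

theorem rightBound_pos (δ : ℝ) : 0 < rightBound δ := by
  have : 0 ≤ kernelBound (Real.cos (δ / 2)) := by rw [kernelBound]; positivity
  rw [rightBound]; positivity

/-- Near the ray on its clockwise side and on the counterclockwise half-plane the integral is taken
over the rotated ray, elsewhere over the original one, so the pole is always at an angle of at least
`δ / 2` from the contour. The residue adds at most `4πη`. -/
theorem SectorBound.norm_rightInt_le (hh : SectorBound σ δ η h) (hσ : ‖σ‖ = 1) (hδ0 : 0 < δ)
    (hδ : δ ≤ 1 / 2) (ζ : OnePoint ℂ) : ‖rightInt σ δ h ζ‖ ≤ rightBound δ * η := by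
  have h0 := cos_half_nonneg hδ0.le hδ
  have h1 := cos_half_lt_one hδ0 hδ
  have hη := hh.nonneg hσ hδ0.le
  have hR := hh.rayBound hσ hδ0.le hδ
  have hR' := hh.rayBound_rot hσ hδ0.le hδ
  have hcase : ∀ w : ℂ, ‖w‖ ≤ kernelBound (Real.cos (δ / 2)) * η * Real.pi →
      ‖w‖ ≤ rightBound δ * η := fun w hw => hw.trans (by
    rw [rightBound]; nlinarith [Real.pi_pos, mul_nonneg hη Real.pi_pos.le])
  by_cases hζ : ζ ∈ closedHalfPlane (-σ)
  · rw [closedHalfPlane_neg_eq (δ := δ)] at hζ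
    rcases hζ with hζ | hζ
    · rw [hh.rightInt_eq_of_mem_nearPart hσ hδ0 hδ hζ]
      refine (norm_sub_le _ _).trans ?_
      have h2 := hR'.norm_rayInt_le (norm_rot hσ δ) h0 h1 (nearPart_subset_apart_rot hσ hδ0.le hδ hζ)
      have h3 : ‖extendZero h ζ‖ ≤ η := by
        induction ζ using OnePoint.rec with
        | infty => simpa [extendZero_infty] using hη
        | coe z =>
          rcases eq_or_ne z 0 with rfl | hz
          · simpa [extendZero_zero] using hη
          · rw [extendZero_coe hz]
            exact hh.norm_le hσ hδ0.le (mem_sector_of_mem_nearPart hσ hδ0.le hδ hz hζ)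
      have h4 : ‖4 * (Real.pi : ℂ) * Complex.I * extendZero h ζ‖ ≤ 4 * Real.pi * η := by
        rw [norm_mul, norm_mul, norm_mul, Complex.norm_I, Complex.norm_real,
          Real.norm_of_nonneg Real.pi_pos.le]
        simp only [Complex.norm_ofNat, mul_one]
        gcongr
      rw [rightBound]
      linarith
    · rw [rightInt_eq_of_mem_farPart hσ hδ0 hδ hζ]
      exact hcase _ (hR.norm_rayInt_le hσ h0 h1 (farPart_subset_apart hζ))
  · have hζ' : ζ ∈ closedHalfPlane σ := by
      induction ζ using OnePoint.rec with
      | infty => exact infty_mem_closedHalfPlane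
      | coe z =>
        rw [coe_mem_closedHalfPlane, map_neg, mul_neg, Complex.neg_im] at hζ
        rw [coe_mem_closedHalfPlane]
        linarith
    have hr : ζ ∉ ((↑) : ℂ → OnePoint ℂ) '' ray σ := by
      rintro ⟨z, hz, rfl⟩
      apply hζ
      rw [coe_mem_closedHalfPlane, map_neg, mul_neg, Complex.neg_im]
      have := ((mem_ray_iff hσ).1 hz).2
      rw [Complex.arg_eq_zero_iff] at this
      rw [this.2, neg_zero]
    rw [rightInt_of_notMem hr, ← leftInt_of_notMem (δ := δ) hr, hh.leftInt_eq hσ hδ0.le hδ hζ']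
    exact hcase _ (hR'.norm_rayInt_le (norm_rot hσ δ) h0 h1
      (closedHalfPlane_subset_apart_rot hσ hδ0.le hδ hζ'))

theorem notMem_ray_of_im_ne_zero (hσ : ‖σ‖ = 1) {z : ℂ} (hz : (z * conj σ).im ≠ 0) :
    z ∉ ray σ := fun h =>
  hz (Complex.arg_eq_zero_iff.1 ((mem_ray_iff hσ).1 h).2).2

theorem SectorBound.differentiableOn_rightInt (hh : SectorBound σ δ η h) (hσ : ‖σ‖ = 1)
    (hδ0 : 0 ≤ δ) (hδ : δ ≤ 1 / 2) {s : Set ℂ}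
    (him : ∀ z ∈ s, (z * conj σ).im ≠ 0) :
    DifferentiableOn ℂ (fun z : ℂ => rightInt σ δ h z) s := by
  have heq : ∀ z ∈ s, rightInt σ δ h z = rayInt σ h z := fun z hz =>
    rightInt_of_notMem fun h => notMem_ray_of_im_ne_zero hσ (him z hz) (coe_mem_image.1 h)
  refine DifferentiableOn.congr (fun z hz => ?_) heq
  have h1 := abs_re_lt_norm_of_im_ne_zero (him z hz)
  have h2 : ‖z * conj σ‖ = ‖z‖ := by simp [hσ]
  rw [h2] at h1
  have h3 : 0 < ‖z‖ := (abs_nonneg _).trans_lt h1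
  obtain ⟨ρ, hρ1, hρ2⟩ := exists_between ((div_lt_one h3).2 h1)
  have hρ0 : 0 ≤ ρ := (by positivity : 0 ≤ |(z * conj σ).re| / ‖z‖).trans hρ1.le
  have hO : IsOpen {z : ℂ | (z * conj σ).re < ρ * ‖z‖} :=
    isOpen_lt (by fun_prop) (by fun_prop)
  refine (((hh.rayBound hσ hδ0 hδ).differentiableOn_rayInt hσ hρ0 hρ2).differentiableAt
    (hO.mem_nhds ?_)).differentiableWithinAt
  rw [div_lt_iff₀ h3] at hρ1
  exact (le_abs_self _).trans_lt hρ1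

theorem RayBound.rayInt_sub {τ : ℂ} {η₁ η₂ ρ : ℝ} {h₁ h₂ : ℂ → ℂ} (hh₁ : RayBound τ η₁ h₁)
    (hh₂ : RayBound τ η₂ h₂) (hτ : ‖τ‖ = 1) (h0 : 0 ≤ ρ) (h1 : ρ < 1) {ζ : OnePoint ℂ}
    (hζ : ζ ∈ apart τ ρ) :
    rayInt τ (fun z => h₁ z - h₂ z) ζ = rayInt τ h₁ ζ - rayInt τ h₂ ζ := by
  rw [rayInt, rayInt, rayInt, ← integral_sub (hh₁.integrable hτ h0 h1 hζ)
    (hh₂.integrable hτ h0 h1 hζ)]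
  simp only [mul_sub]

theorem ray_subset_apart_rot (hσ : ‖σ‖ = 1) (hδ0 : 0 ≤ δ) (hδ : δ ≤ 1 / 2) {ζ : OnePoint ℂ}
    (hζ : ζ ∈ ((↑) : ℂ → OnePoint ℂ) '' ray σ) : ζ ∈ apart (rot σ δ) (Real.cos (δ / 2)) := by
  obtain ⟨z, hz, rfl⟩ := hζ
  refine closedHalfPlane_subset_apart_rot hσ hδ0 hδ (coe_mem_closedHalfPlane.2 ?_)
  exact (Complex.arg_eq_zero_iff.1 ((mem_ray_iff hσ).1 hz).2).2.ge

theorem SectorBound.rightInt_sub {η₁ η₂ : ℝ} {h₁ h₂ : ℂ → ℂ} (hh₁ : SectorBound σ δ η₁ h₁)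
    (hh₂ : SectorBound σ δ η₂ h₂) (hσ : ‖σ‖ = 1) (hδ0 : 0 < δ) (hδ : δ ≤ 1 / 2)
    (ζ : OnePoint ℂ) :
    rightInt σ δ (fun z => h₁ z - h₂ z) ζ = rightInt σ δ h₁ ζ - rightInt σ δ h₂ ζ := by
  by_cases hr : ζ ∈ ((↑) : ℂ → OnePoint ℂ) '' ray σ
  · rw [rightInt_of_mem hr, rightInt_of_mem hr, rightInt_of_mem hr,
      (hh₁.rayBound_rot hσ hδ0.le hδ).rayInt_sub (hh₂.rayBound_rot hσ hδ0.le hδ) (norm_rot hσ δ)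
      (cos_half_nonneg hδ0.le hδ) (cos_half_lt_one hδ0 hδ) (ray_subset_apart_rot hσ hδ0.le hδ hr)]
    ring
  · obtain ⟨ρ, h0, h1, hρ⟩ := exists_mem_apart hσ hr
    rw [rightInt_of_notMem hr, rightInt_of_notMem hr, rightInt_of_notMem hr,
      (hh₁.rayBound hσ hδ0.le hδ).rayInt_sub (hh₂.rayBound hσ hδ0.le hδ) hσ h0 h1 hρ]

variable {E : Type*} [NormedAddCommGroup E] [NormedSpace ℂ E] [FiniteDimensional ℂ E]

theorem differentiableOn_rayInt_param {τ : ℂ} {η ρ : ℝ} {W : Set E} (hW : IsOpen W)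
    {h : E → ℂ → ℂ} (hh : ∀ p ∈ W, RayBound τ η (h p)) (hτ : ‖τ‖ = 1) (h0 : 0 ≤ ρ) (h1 : ρ < 1)
    (hd : ∀ x, DifferentiableOn ℂ (fun p => h p (expRay τ x)) W) {ζ : OnePoint ℂ}
    (hζ : ζ ∈ apart τ ρ) : DifferentiableOn ℂ (fun p => rayInt τ (h p) ζ) W :=
  differentiableOn_integral_of_norm_le hW (fun p hp => (hh p hp).aestronglyMeasurable ζ)
    (integrable_logWeight.const_mul (kernelBound ρ * η))
    (fun p hp => (hh p hp).norm_integrand_le hτ h0 h1 hζ) fun x => (hd x).const_mul _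

theorem expRay_mem_sector (hσ : ‖σ‖ = 1) (hδ0 : 0 ≤ δ) (x : ℝ) : expRay σ x ∈ sector σ δ :=
  ray_subset_sector hσ hδ0 (expRay_mem_ray σ x)

theorem expRay_rot_mem_sector (hσ : ‖σ‖ = 1) (hδ0 : 0 ≤ δ) (hδ : δ ≤ 1 / 2) (x : ℝ) :
    expRay (rot σ δ) x ∈ sector σ δ := by
  rw [← exp_sub_mul]
  exact exp_mul_mem_sector hσ hδ (by simp) (by simpa using hδ0)

theorem differentiableOn_leftInt_param {W : Set E} (hW : IsOpen W) {h : E → ℂ → ℂ}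
    (hh : ∀ p ∈ W, SectorBound σ δ η (h p)) (hσ : ‖σ‖ = 1) (hδ0 : 0 < δ) (hδ : δ ≤ 1 / 2)
    (hd : ∀ z ∈ sector σ δ, DifferentiableOn ℂ (fun p => h p z) W) (ζ : OnePoint ℂ) :
    DifferentiableOn ℂ (fun p => leftInt σ δ (h p) ζ) W := by
  by_cases hr : ζ ∈ ((↑) : ℂ → OnePoint ℂ) '' ray σ
  · simp only [leftInt_of_mem hr]
    exact differentiableOn_rayInt_param hW (fun p hp => (hh p hp).rayBound_rot hσ hδ0.le hδ)
      (norm_rot hσ δ) (cos_half_nonneg hδ0.le hδ) (cos_half_lt_one hδ0 hδ)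
      (fun x => hd _ (expRay_rot_mem_sector hσ hδ0.le hδ x)) (ray_subset_apart_rot hσ hδ0.le hδ hr)
  · obtain ⟨ρ, h0, h1, hρ⟩ := exists_mem_apart hσ hr
    simp only [leftInt_of_notMem hr]
    exact differentiableOn_rayInt_param hW (fun p hp => (hh p hp).rayBound hσ hδ0.le hδ)
      hσ h0 h1 (fun x => hd _ (expRay_mem_sector hσ hδ0.le x)) hρ

open Classical in
theorem rightInt_eq_leftInt_sub (σ : ℂ) (δ : ℝ) (h : ℂ → ℂ) (ζ : OnePoint ℂ) :
    rightInt σ δ h ζ = leftInt σ δ h ζ -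
      if ζ ∈ ((↑) : ℂ → OnePoint ℂ) '' ray σ then 4 * Real.pi * Complex.I * h (toC ζ) else 0 := by
  rw [rightInt, leftInt]
  split_ifs <;> simp

/-- For fixed `ζ` the contour is fixed too. Either side's value is a dominated integral of
holomorphic functions, and the difference on the ray is the evaluation of `h p` at `ζ`. -/
theorem differentiableOn_rightInt_param {W : Set E} (hW : IsOpen W) {h : E → ℂ → ℂ}
    (hh : ∀ p ∈ W, SectorBound σ δ η (h p)) (hσ : ‖σ‖ = 1) (hδ0 : 0 < δ) (hδ : δ ≤ 1 / 2)
    (hd : ∀ z ∈ sector σ δ, DifferentiableOn ℂ (fun p => h p z) W) (ζ : OnePoint ℂ) :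
    DifferentiableOn ℂ (fun p => rightInt σ δ (h p) ζ) W := by
  simp only [rightInt_eq_leftInt_sub]
  refine (differentiableOn_leftInt_param hW hh hσ hδ0 hδ hd ζ).sub ?_
  by_cases hr : ζ ∈ ((↑) : ℂ → OnePoint ℂ) '' ray σ
  · simp only [if_pos hr]
    obtain ⟨z, hz, rfl⟩ := hr
    exact (hd z (ray_subset_sector hσ hδ0.le hz)).const_mul _
  · simp only [if_neg hr]
    exact differentiableOn_const _

end BoundaryValues

/-! ### Decay of the semiflat functions and size of the jump functions. -/

section JumpFunction

variable {σ : ℂ} {f : Fin 2 → Charge → ℚ} {κ c C B : ℝ} {A A' : Charge → ℂ}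

/-- The bounds on the coefficients `f` of a jump along `ray σ` and on the values `A γ`, `A' γ` that
replace `Z_γ`, `conj Z_γ`. -/
structure JumpData (σ : ℂ) (f : Fin 2 → Charge → ℚ) (κ c C B : ℝ) (A A' : Charge → ℂ) : Prop where
  ne_zero : ∀ k γ, f k γ ≠ 0 → γ ≠ 0
  cone : ∀ k γ, f k γ ≠ 0 → κ * ‖A γ‖ ≤ -(A γ * conj σ).re
  growth : ∀ k γ, f k γ ≠ 0 → c * ‖γ‖ ≤ -(A γ * conj σ).re
  cone' : ∀ k γ, f k γ ≠ 0 → κ * ‖A' γ‖ ≤ -(A' γ * σ).re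
  growth' : ∀ k γ, f k γ ≠ 0 → c * ‖γ‖ ≤ -(A' γ * σ).re
  coeff : ∀ k γ, |(f k γ : ℝ)| ≤ C * Real.exp (B * ‖γ‖)

/-- The opening of the sectors in which the semiflat functions decay. -/
noncomputable def opening (κ : ℝ) : ℝ := min (κ / 4) (1 / 2)

theorem opening_pos (hκ : 0 < κ) : 0 < opening κ := lt_min (by positivity) (by norm_num)

theorem opening_le (κ : ℝ) : opening κ ≤ 1 / 2 := min_le_right _ _

/-- `cos α ≥ 3/4`, and the sine term is at most `(κ/4) ‖u‖ ≤ -Re u / 4`; half of the negative real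
part survives. This fixes the opening of the sectors. -/
theorem re_mul_exp_le {u : ℂ} {α : ℝ} (hu : κ * ‖u‖ ≤ -u.re) (hα : |α| ≤ κ / 4)
    (hα' : |α| ≤ 1 / 2) : (u * Complex.exp (α * Complex.I)).re ≤ u.re / 2 := by
  rw [Complex.mul_re, Complex.exp_ofReal_mul_I_re, Complex.exp_ofReal_mul_I_im]
  have hα0 := abs_nonneg α
  have h1 : 3 / 4 ≤ Real.cos α := by
    have := Real.one_sub_sq_div_two_le_cos (x := α)
    rw [← sq_abs] at this
    nlinarith
  have h2 : -(u.im * Real.sin α) ≤ ‖u‖ * (κ / 4) := by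
    calc -(u.im * Real.sin α) ≤ |u.im * Real.sin α| := neg_le_abs _
      _ = |u.im| * |Real.sin α| := abs_mul _ _
      _ ≤ ‖u‖ * (κ / 4) := by
        gcongr
        · exact Complex.abs_im_le_norm u
        · exact (Real.abs_sin_le_abs).trans hα
  have h3 : u.re ≤ 0 := by
    have : 0 ≤ κ * ‖u‖ := mul_nonneg (by linarith) (norm_nonneg u)
    linarith
  nlinarith

theorem abs_arg_le_of_mem_sector {δ : ℝ} {z : ℂ} (hz : z ∈ sector σ δ) :
    |(z * conj σ).arg| ≤ δ := by
  rw [abs_le]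
  exact ⟨hz.2.1, hz.2.2.trans (by linarith [hz.2.1, hz.2.2])⟩

theorem eq_polar (hσ : ‖σ‖ = 1) (z : ℂ) :
    z = ‖z‖ * Complex.exp ((z * conj σ).arg * Complex.I) * σ := by
  rw [← mul_conj_eq_polar hσ z, mul_conj_mul_self hσ]

theorem re_div_le (hσ : ‖σ‖ = 1) {w z : ℂ} (hw : κ * ‖w‖ ≤ -(w * conj σ).re)
    (hz : z ∈ sector σ (opening κ)) : (w / z).re ≤ (w * conj σ).re / 2 * ‖z‖⁻¹ := by
  have hz0 : ‖z‖ ≠ 0 := norm_ne_zero_iff.2 hz.1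
  have hα := abs_arg_le_of_mem_sector hz
  set α := (z * conj σ).arg with hαdef
  have hσσ : conj σ * σ = 1 := by rw [Complex.conj_mul', hσ]; simp
  have h1 : w / z = (w * conj σ * Complex.exp ((-α : ℝ) * Complex.I)) * ((‖z‖⁻¹ : ℝ) : ℂ) := by
    rw [div_eq_iff hz.1]
    conv_rhs => rw [eq_polar hσ z, ← hαdef]
    have h2 : Complex.exp ((-α : ℝ) * Complex.I) * Complex.exp (α * Complex.I) = 1 := by
      rw [← Complex.exp_add]; simp
    have h3 : ((‖z‖⁻¹ : ℝ) : ℂ) * (‖z‖ : ℂ) = 1 := by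
      rw [← Complex.ofReal_mul, inv_mul_cancel₀ hz0, Complex.ofReal_one]
    have h4 : ‖(‖z‖ : ℂ) * Complex.exp (α * Complex.I) * σ‖ = ‖z‖ := by
      rw [norm_mul, norm_mul, Complex.norm_exp_ofReal_mul_I, hσ]; simp
    rw [h4]
    calc w = w * (conj σ * σ) * (Complex.exp ((-α : ℝ) * Complex.I) * Complex.exp (α * Complex.I)) *
          (((‖z‖⁻¹ : ℝ) : ℂ) * (‖z‖ : ℂ)) := by rw [hσσ, h2, h3]; ring
      _ = _ := by ring
  rw [h1, Complex.re_mul_ofReal]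
  gcongr
  refine re_mul_exp_le (by rwa [norm_mul, Complex.norm_conj, hσ, mul_one]) ?_ ?_
  · rw [abs_neg]; exact hα.trans (min_le_left _ _)
  · rw [abs_neg]; exact hα.trans (min_le_right _ _)

theorem re_mul_le (hσ : ‖σ‖ = 1) {w z : ℂ} (hw : κ * ‖w‖ ≤ -(w * σ).re)
    (hz : z ∈ sector σ (opening κ)) : (z * w).re ≤ (w * σ).re / 2 * ‖z‖ := by
  have hα := abs_arg_le_of_mem_sector hz
  have h1 : z * w = (w * σ * Complex.exp ((z * conj σ).arg * Complex.I)) * (‖z‖ : ℂ) := by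
    conv_lhs => rw [eq_polar hσ z]
    ring
  rw [h1, Complex.re_mul_ofReal]
  gcongr
  exact re_mul_exp_le (by rwa [norm_mul, hσ, mul_one]) (hα.trans (min_le_left _ _))
    (hα.trans (min_le_right _ _))

/-- The semiflat function, with `A γ`, `A' γ` in place of `Z_γ`, `conj Z_γ`. -/
noncomputable def semiflat (R : ℝ) (A A' : Charge → ℂ) (γ : Charge) (v : Fin 2 → ℂ) (z : ℂ) : ℂ :=
  Complex.exp (Real.pi * R * A γ / z + Complex.I * lin γ v + Real.pi * R * z * A' γ)

theorem norm_fst_le (γ : Charge) : ‖(γ.1 : ℂ)‖ ≤ ‖γ‖ := by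
  rw [Prod.norm_def, Complex.norm_intCast, ← Int.norm_eq_abs]; exact le_max_left _ _

theorem norm_snd_le (γ : Charge) : ‖(γ.2 : ℂ)‖ ≤ ‖γ‖ := by
  rw [Prod.norm_def, Complex.norm_intCast, ← Int.norm_eq_abs]; exact le_max_right _ _

theorem norm_lin_le (γ : Charge) (v : Fin 2 → ℂ) : ‖lin γ v‖ ≤ 2 * ‖γ‖ * ‖v‖ := by
  rw [lin]
  calc ‖(γ.1 : ℂ) * v 0 + (γ.2 : ℂ) * v 1‖ ≤ ‖(γ.1 : ℂ)‖ * ‖v 0‖ + ‖(γ.2 : ℂ)‖ * ‖v 1‖ := by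
        rw [← norm_mul, ← norm_mul]; exact norm_add_le _ _
    _ ≤ ‖γ‖ * ‖v‖ + ‖γ‖ * ‖v‖ := by
        gcongr
        exacts [norm_fst_le γ, norm_le_pi_norm v 0, norm_snd_le γ, norm_le_pi_norm v 1]
    _ = _ := by ring

theorem lin_sub (γ : Charge) (v w : Fin 2 → ℂ) : lin γ (v - w) = lin γ v - lin γ w := by
  simp only [lin, Pi.sub_apply]; ring

/-- Controls `|exp (i v_γ)|`. The bound 2 is 1 for the imaginary part of the complexified torus
coordinates plus `ε ≤ 1` for the deviation from the center. -/
theorem neg_im_lin_le (γ : Charge) {v : Fin 2 → ℂ} (hv : ∀ k, |(v k).im| ≤ 2) :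
    -(lin γ v).im ≤ 4 * ‖γ‖ := by
  have h : ∀ (n : ℤ) (k : Fin 2), ‖(n : ℂ)‖ ≤ ‖γ‖ → -((n : ℂ) * v k).im ≤ ‖γ‖ * 2 := by
    intro n k hn
    rw [← Complex.ofReal_intCast, Complex.im_ofReal_mul]
    refine (neg_le_abs _).trans ?_
    rw [abs_mul]
    rw [Complex.norm_intCast] at hn
    gcongr
    exact hv k
  rw [lin, Complex.add_im]
  linarith [h γ.1 0 (norm_fst_le γ), h γ.2 1 (norm_snd_le γ)]

theorem exp_neg_add_inv_le {s : ℝ} (hs : 0 < s) :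
    Real.exp (-(s⁻¹ + s)) ≤ logWeight (Real.log s) := by
  set x := Real.log s with hx
  have hsx : s = Real.exp x := (Real.exp_log hs).symm
  have hy : 1 + x ^ 2 / 2 ≤ s⁻¹ + s := by
    rw [hsx, ← Real.exp_neg]
    rcases le_total 0 x with h | h
    · have := Real.quadratic_le_exp_of_nonneg h
      have := Real.exp_pos (-x)
      nlinarith
    · have := Real.quadratic_le_exp_of_nonneg (neg_nonneg.2 h)
      have := Real.exp_pos x
      nlinarith
  have hy0 : 0 ≤ s⁻¹ + s := by positivity
  have h1 := Real.quadratic_le_exp_of_nonneg hy0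
  rw [logWeight, Real.exp_neg]
  gcongr
  have h2 : (1 + x ^ 2 / 2) ^ 2 ≤ (s⁻¹ + s) ^ 2 := by gcongr
  nlinarith [sq_nonneg (x ^ 2)]

/-- The exponent of the semiflat function has very negative real part in the sector. -/
theorem JumpData.norm_semiflat_le (D : JumpData σ f κ c C B A A') (hσ : ‖σ‖ = 1) {R : ℝ}
    (hR : 0 ≤ R) {k : Fin 2} {γ : Charge} (hγ : f k γ ≠ 0) {v : Fin 2 → ℂ}
    (hv : ∀ k, |(v k).im| ≤ 2) {z : ℂ} (hz : z ∈ sector σ (opening κ)) :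
    (Real.pi * R * A γ / z + Complex.I * lin γ v + Real.pi * R * z * A' γ).re ≤
      4 * ‖γ‖ - Real.pi * R * c / 2 * ‖γ‖ * (‖z‖⁻¹ + ‖z‖) := by
  have h1 := re_div_le hσ (D.cone k γ hγ) hz
  have h2 := re_mul_le hσ (D.cone' k γ hγ) hz
  have h3 := D.growth k γ hγ
  have h4 := D.growth' k γ hγ
  have h5 := neg_im_lin_le γ hv
  have hpr : 0 ≤ Real.pi * R := by positivity
  have e1 : (Real.pi * R * A γ / z : ℂ) = ((Real.pi * R : ℝ) : ℂ) * (A γ / z) := by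
    push_cast; ring
  have e2 : (Real.pi * R * z * A' γ : ℂ) = ((Real.pi * R : ℝ) : ℂ) * (z * A' γ) := by
    push_cast; ring
  rw [e1, e2, Complex.add_re, Complex.add_re, Complex.re_ofReal_mul, Complex.re_ofReal_mul]
  have e3 : (Complex.I * lin γ v).re = -(lin γ v).im := by simp
  rw [e3]
  have hz1 : 0 ≤ ‖z‖⁻¹ := by positivity
  have h6 : (A γ / z).re ≤ -(c * ‖γ‖) / 2 * ‖z‖⁻¹ := h1.trans (by gcongr; linarith)
  have h7 : (z * A' γ).re ≤ -(c * ‖γ‖) / 2 * ‖z‖ := h2.trans (by gcongr; linarith)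
  have h8 := mul_le_mul_of_nonneg_left h6 hpr
  have h9 := mul_le_mul_of_nonneg_left h7 hpr
  nlinarith

/-- The summable majorant of the terms of the jump function. -/
noncomputable def majorant (C K : ℝ) (γ : Charge) : ℝ :=
  C * Real.exp (-K) * Real.exp (-4 * ‖γ‖)

theorem summable_majorant (C K : ℝ) : Summable (majorant C K) :=
  (summable_exp_neg_norm (by norm_num)).mul_left _

/-- The size of the jump function. -/
noncomputable def jumpSize (C K : ℝ) : ℝ := ∑' γ, majorant C K γ

/-- `K` is a free parameter, available once `R` is large; its exponential is what makes the operator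
small. -/
theorem jumpSize_eq (C K : ℝ) : jumpSize C K = jumpSize C 0 * Real.exp (-K) := by
  rw [jumpSize, jumpSize, ← tsum_mul_right]
  congr 1; funext γ
  simp only [majorant, neg_zero, Real.exp_zero]
  ring

theorem two_le_inv_add {s : ℝ} (hs : 0 < s) : 2 ≤ s⁻¹ + s := by
  have h : s⁻¹ + s - 2 = (s - 1) ^ 2 / s := by field_simp; ring
  have : 0 ≤ (s - 1) ^ 2 / s := by positivity
  linarith

/-- Of the decay rate `m`, one unit provides `exp (-(s⁻¹ + s))`, since `‖γ‖ ≥ 1`. The other `m - 1`,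
with `s⁻¹ + s ≥ 2`, absorb `exp (B ‖γ‖)` and `exp (6 ‖γ‖)` and leave `exp (-4 ‖γ‖)` and `exp (-K)`.
The 6 is 4 from `neg_im_lin_le` and 2 from the Lipschitz estimate. -/
theorem JumpData.coeff_mul_exp_le (D : JumpData σ f κ c C B A A') (hC : 0 ≤ C) (hB : 0 ≤ B) {K : ℝ}
    (hK : 0 ≤ K) {m : ℝ} (hm : B + 10 + K ≤ 2 * (m - 1)) {k : Fin 2} {γ : Charge}
    (hγ : f k γ ≠ 0) {s : ℝ} (hs : 0 < s) :
    |(f k γ : ℝ)| * Real.exp (6 * ‖γ‖ - m * ‖γ‖ * (s⁻¹ + s)) ≤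
      majorant C K γ * logWeight (Real.log s) := by
  have h1 := one_le_norm_of_ne_zero (D.ne_zero k γ hγ)
  have h2 := two_le_inv_add hs
  calc |(f k γ : ℝ)| * Real.exp (6 * ‖γ‖ - m * ‖γ‖ * (s⁻¹ + s))
      ≤ C * Real.exp (B * ‖γ‖) * Real.exp (6 * ‖γ‖ - m * ‖γ‖ * (s⁻¹ + s)) := by
        gcongr; exact D.coeff k γ
    _ = C * Real.exp (B * ‖γ‖ + (6 * ‖γ‖ - m * ‖γ‖ * (s⁻¹ + s))) := by
        rw [mul_assoc, ← Real.exp_add]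
    _ ≤ C * Real.exp (-K + -4 * ‖γ‖ + -(s⁻¹ + s)) := by
        refine mul_le_mul_of_nonneg_left (Real.exp_le_exp.2 ?_) hC
        have hm1 : 0 ≤ m - 1 := by linarith
        have h3 : 2 * (m - 1) * ‖γ‖ ≤ (m - 1) * ‖γ‖ * (s⁻¹ + s) := by
          have : 0 ≤ (m - 1) * ‖γ‖ := by positivity
          nlinarith
        have h4 : s⁻¹ + s ≤ ‖γ‖ * (s⁻¹ + s) := by nlinarith
        have h5 : (B + 10 + K) * ‖γ‖ ≤ 2 * (m - 1) * ‖γ‖ := by gcongr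
        have h6 : K ≤ K * ‖γ‖ := le_mul_of_one_le_right hK h1
        have h7 : m * ‖γ‖ * (s⁻¹ + s) = (m - 1) * ‖γ‖ * (s⁻¹ + s) + ‖γ‖ * (s⁻¹ + s) := by ring
        rw [h7]
        linarith
    _ = majorant C K γ * Real.exp (-(s⁻¹ + s)) := by
        rw [majorant, Real.exp_add, Real.exp_add]; ring
    _ ≤ majorant C K γ * logWeight (Real.log s) := by
        have := exp_neg_add_inv_le hs
        have h0 : 0 ≤ majorant C K γ := by unfold majorant; positivity
        gcongr

theorem norm_exp_sub_exp_le {a b : ℂ} {M : ℝ} (ha : a.re ≤ M) (hb : b.re ≤ M) :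
    ‖Complex.exp a - Complex.exp b‖ ≤ Real.exp M * ‖a - b‖ := by
  have hconv : Convex ℝ {z : ℂ | z.re ≤ M} := convex_halfSpace_re_le M
  refine hconv.norm_image_sub_le_of_norm_deriv_le (𝕜 := ℂ) (fun z _ => Complex.differentiableAt_exp)
    (fun z hz => ?_) hb ha
  rw [Complex.deriv_exp, Complex.norm_exp]
  exact Real.exp_le_exp.2 hz

/-- The hypotheses under which the ray integrals converge and are small. -/
structure LargeRadius (κ c C B K R : ℝ) : Prop where
  κ_pos : 0 < κ
  C_nonneg : 0 ≤ C
  B_nonneg : 0 ≤ B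
  K_nonneg : 0 ≤ K
  R_nonneg : 0 ≤ R
  le : B + 10 + K ≤ 2 * (Real.pi * R * c / 2 - 1)

variable {K R : ℝ}

theorem JumpData.norm_term_le (D : JumpData σ f κ c C B A A') (hσ : ‖σ‖ = 1)
    (hL : LargeRadius κ c C B K R) (k : Fin 2) (γ : Charge) {v : Fin 2 → ℂ}
    (hv : ∀ k, |(v k).im| ≤ 2) {z : ℂ} (hz : z ∈ sector σ (opening κ)) :
    ‖(f k γ : ℂ) * semiflat R A A' γ v z‖ ≤ majorant C K γ * logWeight (Real.log ‖z‖) := by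
  by_cases hγ : f k γ = 0
  · have h0 : 0 ≤ majorant C K γ := by
      have := hL.C_nonneg; unfold majorant; positivity
    simpa [hγ] using mul_nonneg h0 (logWeight_pos _).le
  · refine le_trans ?_ (D.coeff_mul_exp_le hL.C_nonneg hL.B_nonneg hL.K_nonneg hL.le hγ
      (norm_pos_iff.2 hz.1))
    rw [norm_mul, semiflat, Complex.norm_exp, Complex.norm_ratCast]
    gcongr
    refine (D.norm_semiflat_le hσ hL.R_nonneg hγ hv hz).trans ?_
    gcongr
    norm_num

/-- Mean value inequality for `exp` in a half-plane `Re ≤ M`. The exponents differ by `i lin γ (v -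
w)`, and `2 ‖γ‖ ≤ exp (2 ‖γ‖)` brings the factor into the exponent. -/
theorem JumpData.norm_term_sub_le (D : JumpData σ f κ c C B A A') (hσ : ‖σ‖ = 1)
    (hL : LargeRadius κ c C B K R) (k : Fin 2) (γ : Charge) {v w : Fin 2 → ℂ}
    (hv : ∀ k, |(v k).im| ≤ 2) (hw : ∀ k, |(w k).im| ≤ 2) {z : ℂ}
    (hz : z ∈ sector σ (opening κ)) :
    ‖(f k γ : ℂ) * semiflat R A A' γ v z - (f k γ : ℂ) * semiflat R A A' γ w z‖ ≤
      majorant C K γ * logWeight (Real.log ‖z‖) * ‖v - w‖ := by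
  by_cases hγ : f k γ = 0
  · have h0 : 0 ≤ majorant C K γ := by
      have := hL.C_nonneg; unfold majorant; positivity
    simpa [hγ] using mul_nonneg (mul_nonneg h0 (logWeight_pos _).le) (norm_nonneg (v - w))
  · have h1 := norm_exp_sub_exp_le (D.norm_semiflat_le hσ hL.R_nonneg hγ hv hz)
      (D.norm_semiflat_le hσ hL.R_nonneg hγ hw hz)
    have h2 : ‖(Real.pi * R * A γ / z + Complex.I * lin γ v + Real.pi * R * z * A' γ) -
        (Real.pi * R * A γ / z + Complex.I * lin γ w + Real.pi * R * z * A' γ)‖ ≤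
        Real.exp (2 * ‖γ‖) * ‖v - w‖ := by
      rw [show ∀ a b c d : ℂ, (a + b + c) - (a + d + c) = b - d by intros; ring, ← mul_sub,
        ← lin_sub, norm_mul, Complex.norm_I, one_mul]
      refine (norm_lin_le γ _).trans ?_
      gcongr
      linarith [Real.add_one_le_exp (2 * ‖γ‖)]
    have h3 := D.coeff_mul_exp_le hL.C_nonneg hL.B_nonneg hL.K_nonneg hL.le hγ
      (norm_pos_iff.2 hz.1)
    rw [← mul_sub, norm_mul, Complex.norm_ratCast, semiflat, semiflat]
    calc _ ≤ |(f k γ : ℝ)| * (Real.exp (4 * ‖γ‖ - Real.pi * R * c / 2 * ‖γ‖ * (‖z‖⁻¹ + ‖z‖)) *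
          (Real.exp (2 * ‖γ‖) * ‖v - w‖)) := by
          gcongr
          exact h1.trans (by gcongr)
      _ = |(f k γ : ℝ)| * Real.exp (6 * ‖γ‖ - Real.pi * R * c / 2 * ‖γ‖ * (‖z‖⁻¹ + ‖z‖)) *
          ‖v - w‖ := by
          rw [show 6 * ‖γ‖ - Real.pi * R * c / 2 * ‖γ‖ * (‖z‖⁻¹ + ‖z‖) =
            (4 * ‖γ‖ - Real.pi * R * c / 2 * ‖γ‖ * (‖z‖⁻¹ + ‖z‖)) + 2 * ‖γ‖ by ring,
            Real.exp_add]
          ring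
      _ ≤ _ := by gcongr

/-- The function `log (S X_k / X_k)` of `ζ`, evaluated on the semiflat functions at `Φ`. -/
noncomputable def jump (f : Fin 2 → Charge → ℚ) (A A' : Charge → ℂ) (R : ℝ)
    (Φ : OnePoint ℂ → Fin 2 → ℂ) (k : Fin 2) (z : ℂ) : ℂ :=
  ∑' γ, (f k γ : ℂ) * semiflat R A A' γ (Φ z) z

/-- The regularity in `ζ` that is needed for the integral along `ray σ`. -/
structure RegularAt (σ : ℂ) (Φ : OnePoint ℂ → Fin 2 → ℂ) : Prop where
  cont : ContinuousOn (fun z : ℂ => Φ z) (halfPlane (-σ) ∪ ray σ)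
  holo : DifferentiableOn ℂ (fun z : ℂ => Φ z) (halfPlane (-σ))
  im_le : ∀ ζ k, |(Φ ζ k).im| ≤ 2

theorem mem_halfPlane_neg {z : ℂ} : z ∈ halfPlane (-σ) ↔ (z * conj σ).im < 0 := by
  rw [halfPlane, mem_ofPred_eq, map_neg, mul_neg, Complex.neg_im, neg_pos]

theorem openSector_subset_halfPlane {δ : ℝ} : openSector σ δ ⊆ halfPlane (-σ) := fun _ hz =>
  mem_halfPlane_neg.2 (im_mul_conj_neg_of_mem_openSector hz)

theorem sector_subset {δ : ℝ} (hσ : ‖σ‖ = 1) : sector σ δ ⊆ halfPlane (-σ) ∪ ray σ := by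
  intro z hz
  rcases hz.2.2.lt_or_eq with h | h
  · exact Or.inl (mem_halfPlane_neg.2 (Complex.arg_neg_iff.1 h))
  · exact Or.inr ((mem_ray_iff hσ).2 ⟨hz.1, h⟩)

theorem logWeight_le_one (x : ℝ) : logWeight x ≤ 1 :=
  inv_le_one_of_one_le₀ (by nlinarith [sq_nonneg x])

variable {Φ Ψ : OnePoint ℂ → Fin 2 → ℂ}

theorem majorant_nonneg (hC : 0 ≤ C) (K : ℝ) (γ : Charge) : 0 ≤ majorant C K γ := by
  unfold majorant; positivity

theorem JumpData.norm_term_le_majorant (D : JumpData σ f κ c C B A A') (hσ : ‖σ‖ = 1)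
    (hL : LargeRadius κ c C B K R) (k : Fin 2) (γ : Charge) {v : Fin 2 → ℂ}
    (hv : ∀ k, |(v k).im| ≤ 2) {z : ℂ} (hz : z ∈ sector σ (opening κ)) :
    ‖(f k γ : ℂ) * semiflat R A A' γ v z‖ ≤ majorant C K γ :=
  (D.norm_term_le hσ hL k γ hv hz).trans
    (mul_le_of_le_one_right (majorant_nonneg hL.C_nonneg K γ) (logWeight_le_one _))

theorem continuousOn_semiflat {s : Set ℂ} (hs : (0 : ℂ) ∉ s)
    (hΦ : ContinuousOn (fun z : ℂ => Φ z) s) (R : ℝ) (A A' : Charge → ℂ) (γ : Charge) :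
    ContinuousOn (fun z : ℂ => semiflat R A A' γ (Φ z) z) s := by
  have h0 : ∀ k, ContinuousOn (fun z : ℂ => Φ z k) s := fun k =>
    (continuous_apply k).comp_continuousOn hΦ
  unfold semiflat lin
  refine ContinuousOn.cexp (ContinuousOn.add (ContinuousOn.add ?_ ?_) (by fun_prop))
  · exact ContinuousOn.div (by fun_prop) (by fun_prop) fun z hz h => hs (h ▸ hz)
  · exact continuousOn_const.mul ((continuousOn_const.mul (h0 0)).add
      (continuousOn_const.mul (h0 1)))

theorem differentiableOn_semiflat {s : Set ℂ} (hs : (0 : ℂ) ∉ s)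
    (hΦ : DifferentiableOn ℂ (fun z : ℂ => Φ z) s) (R : ℝ) (A A' : Charge → ℂ) (γ : Charge) :
    DifferentiableOn ℂ (fun z : ℂ => semiflat R A A' γ (Φ z) z) s := by
  have h0 : ∀ k, DifferentiableOn ℂ (fun z : ℂ => Φ z k) s := fun k =>
    differentiableOn_pi.1 hΦ k
  unfold semiflat lin
  refine DifferentiableOn.cexp (DifferentiableOn.add (DifferentiableOn.add ?_ ?_) (by fun_prop))
  · exact DifferentiableOn.div (by fun_prop) (by fun_prop) fun z hz h => hs (h ▸ hz)
  · exact (((h0 0).const_mul _).add ((h0 1).const_mul _)).const_mul _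

theorem JumpData.sectorBound_jump (D : JumpData σ f κ c C B A A') (hσ : ‖σ‖ = 1)
    (hL : LargeRadius κ c C B K R) (hΦ : RegularAt σ Φ) (k : Fin 2) :
    SectorBound σ (opening κ) (jumpSize C K) (jump f A A' R Φ k) where
  cont := by
    refine continuousOn_tsum (fun γ => continuousOn_const.mul (continuousOn_semiflat
      (fun h => h.1 rfl) (hΦ.cont.mono (sector_subset hσ)) R A A' γ)) (summable_majorant C K)
      fun γ z hz => D.norm_term_le_majorant hσ hL k γ (hΦ.im_le _) hz
  holo := by
    refine differentiableOn_tsum_of_norm_le (summable_majorant C K) (isOpen_openSector hσ)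
      (fun γ => (differentiableOn_semiflat (fun h => h.1 rfl)
        (hΦ.holo.mono openSector_subset_halfPlane) R A A' γ).const_mul _)
      fun γ z hz => D.norm_term_le_majorant hσ hL k γ (hΦ.im_le _) (openSector_subset_sector hz)
  le z hz := by
    rw [jumpSize, ← tsum_mul_right]
    exact tsum_of_norm_bounded ((summable_majorant C K).mul_right _).hasSum
      fun γ => D.norm_term_le hσ hL k γ (hΦ.im_le _) hz

/-- The ray integrals are linear in the jump functions, so the contraction estimate reduces to the
size of this difference. -/
theorem JumpData.sectorBound_jump_sub (D : JumpData σ f κ c C B A A') (hσ : ‖σ‖ = 1)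
    (hL : LargeRadius κ c C B K R) (hΦ : RegularAt σ Φ) (hΨ : RegularAt σ Ψ) {M : ℝ}
    (hM : ∀ ζ, ‖Φ ζ - Ψ ζ‖ ≤ M) (k : Fin 2) :
    SectorBound σ (opening κ) (jumpSize C K * M)
      (fun z => jump f A A' R Φ k z - jump f A A' R Ψ k z) where
  cont := (D.sectorBound_jump hσ hL hΦ k).cont.sub (D.sectorBound_jump hσ hL hΨ k).cont
  holo := (D.sectorBound_jump hσ hL hΦ k).holo.sub (D.sectorBound_jump hσ hL hΨ k).holo
  le z hz := by
    have hs : ∀ Φ, RegularAt σ Φ →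
        Summable fun γ => (f k γ : ℂ) * semiflat R A A' γ (Φ z) z := fun Φ hΦ =>
      Summable.of_norm_bounded (summable_majorant C K)
        fun γ => D.norm_term_le_majorant hσ hL k γ (hΦ.im_le _) hz
    rw [jump, jump, ← (hs Φ hΦ).tsum_sub (hs Ψ hΨ), mul_right_comm, jumpSize, ← tsum_mul_right,
      ← tsum_mul_right]
    refine tsum_of_norm_bounded (((summable_majorant C K).mul_right _).mul_right _).hasSum
      fun γ => (D.norm_term_sub_le hσ hL k γ (hΦ.im_le _) (hΨ.im_le _) hz).trans ?_
    have := majorant_nonneg hL.C_nonneg K γ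
    have := (logWeight_pos (Real.log ‖z‖)).le
    gcongr
    exact hM z

end JumpFunction

/-! ### The contraction at a fixed parameter. -/

section StepAt

variable {e : ℂ} {fp fm : Fin 2 → Charge → ℚ} {κ c C B K R ε : ℝ} {A A' : Charge → ℂ}
  {ϑ : Fin 2 → ℂ} {Φ Ψ : OnePoint ℂ → Fin 2 → ℂ}

/-- The integral operator at a fixed parameter, with clockwise boundary values on the rays. -/
noncomputable def stepAt (e : ℂ) (δ : ℝ) (fp fm : Fin 2 → Charge → ℚ) (A A' : Charge → ℂ) (R : ℝ)
    (ϑ : Fin 2 → ℂ) (Φ : OnePoint ℂ → Fin 2 → ℂ) (ζ : OnePoint ℂ) : Fin 2 → ℂ := fun k =>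
  ϑ k - 1 / (4 * Real.pi) * (rightInt e δ (jump fp A A' R Φ k) ζ +
    rightInt (-e) δ (jump fm A A' R Φ k) ζ)

/-- The integral operator at a fixed parameter, with the boundary values from `halfPlane e`. -/
noncomputable def extAt (e : ℂ) (δ : ℝ) (fp fm : Fin 2 → Charge → ℚ) (A A' : Charge → ℂ) (R : ℝ)
    (ϑ : Fin 2 → ℂ) (Φ : OnePoint ℂ → Fin 2 → ℂ) (ζ : OnePoint ℂ) : Fin 2 → ℂ := fun k =>
  ϑ k - 1 / (4 * Real.pi) * (leftInt e δ (jump fp A A' R Φ k) ζ +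
    rightInt (-e) δ (jump fm A A' R Φ k) ζ)

/-- The symmetry that exchanges the two rays. It allows every statement about rays and half-planes
to be proved for one choice of sign. -/
theorem stepAt_neg (e : ℂ) (δ : ℝ) (fp fm : Fin 2 → Charge → ℚ) (A A' : Charge → ℂ) (R : ℝ)
    (ϑ : Fin 2 → ℂ) (Φ : OnePoint ℂ → Fin 2 → ℂ) :
    stepAt (-e) δ fm fp A A' R ϑ Φ = stepAt e δ fp fm A A' R ϑ Φ := by
  funext ζ k
  simp only [stepAt, neg_neg]
  rw [add_comm]

theorem extAt_eq_stepAt {δ : ℝ} {ζ : OnePoint ℂ}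
    (hζ : ζ ∉ ((↑) : ℂ → OnePoint ℂ) '' ray e) :
    extAt e δ fp fm A A' R ϑ Φ ζ = stepAt e δ fp fm A A' R ϑ Φ ζ := by
  funext k
  rw [extAt, stepAt, leftInt_of_notMem hζ, rightInt_of_notMem hζ]

/-- The ball of radius `ε` around the constant `ϑ` in the space of the sectionally holomorphic
functions that are continuous up to the rays from the clockwise side. -/
structure InBallAt (e : ℂ) (ε : ℝ) (ϑ : Fin 2 → ℂ) (Φ : OnePoint ℂ → Fin 2 → ℂ) : Prop where
  le : ∀ ζ, ‖Φ ζ - ϑ‖ ≤ ε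
  regular : ∀ σ : ℂ, σ = e ∨ σ = -e →
    DifferentiableOn ℂ (fun ζ : ℂ => Φ ζ) (halfPlane σ) ∧
    ContinuousOn (fun ζ : ℂ => Φ ζ) (halfPlane (-σ) ∪ ray σ)

theorem InBallAt.neg (h : InBallAt e ε ϑ Φ) : InBallAt (-e) ε ϑ Φ :=
  ⟨h.le, fun σ hσ => h.regular σ (by rw [neg_neg] at hσ; exact hσ.symm)⟩

theorem InBallAt.regularAt (h : InBallAt e ε ϑ Φ) (hε : ε ≤ 1) (hϑ : ∀ k, |(ϑ k).im| ≤ 1) :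
    RegularAt e Φ where
  cont := (h.regular e (Or.inl rfl)).2
  holo := (h.regular (-e) (Or.inr rfl)).1
  im_le ζ k := by
    have h1 : |(Φ ζ k - ϑ k).im| ≤ ε :=
      (Complex.abs_im_le_norm _).trans ((norm_le_pi_norm (Φ ζ - ϑ) k).trans (h.le ζ))
    have h2 : (Φ ζ k).im = (Φ ζ k - ϑ k).im + (ϑ k).im := by simp
    rw [h2]
    exact (abs_add_le _ _).trans (by linarith [hϑ k])

theorem inBallAt_const (e : ℂ) (hε : 0 ≤ ε) (ϑ : Fin 2 → ℂ) : InBallAt e ε ϑ fun _ => ϑ :=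
  ⟨fun ζ => by simpa using hε, fun _ _ => ⟨differentiableOn_const _, continuousOn_const⟩⟩

/-- The hypotheses under which the integral operator is a contraction of the ball. -/
structure ContractionData (e : ℂ) (fp fm : Fin 2 → Charge → ℚ) (κ c C B K R ε : ℝ)
    (A A' : Charge → ℂ) : Prop where
  norm_eq : ‖e‖ = 1
  large : LargeRadius κ c C B K R
  plus : JumpData e fp κ c C B A A'
  minus : JumpData (-e) fm κ c C B A A'
  le_eps : 1 / (4 * Real.pi) * (2 * (rightBound (opening κ) * jumpSize C K)) ≤ ε
  le_half : 1 / (4 * Real.pi) * (2 * (rightBound (opening κ) * jumpSize C K)) ≤ 1 / 2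
  eps_le : ε ≤ 1

namespace ContractionData

theorem neg (D : ContractionData e fp fm κ c C B K R ε A A') :
    ContractionData (-e) fm fp κ c C B K R ε A A' :=
  ⟨by rw [norm_neg, D.norm_eq], D.large, D.minus, by rw [neg_neg]; exact D.plus, D.le_eps,
    D.le_half, D.eps_le⟩

theorem sectorBound (D : ContractionData e fp fm κ c C B K R ε A A') (hϑ : ∀ k, |(ϑ k).im| ≤ 1)
    (hΦ : InBallAt e ε ϑ Φ) (k : Fin 2) :
    SectorBound e (opening κ) (jumpSize C K) (jump fp A A' R Φ k) :=
  D.plus.sectorBound_jump D.norm_eq D.large (hΦ.regularAt D.eps_le hϑ) k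

theorem opening_pos (D : ContractionData e fp fm κ c C B K R ε A A') : 0 < opening κ :=
  StokesRH.opening_pos D.large.κ_pos

theorem norm_prefactor_mul_le {a b : ℂ} {r : ℝ} (ha : ‖a‖ ≤ r) (hb : ‖b‖ ≤ r) :
    ‖(1 / (4 * Real.pi) * (a + b) : ℂ)‖ ≤ 1 / (4 * Real.pi) * (2 * r) := by
  have h1 : ‖(1 / (4 * Real.pi) : ℂ)‖ = 1 / (4 * Real.pi) := by
    rw [norm_div, norm_mul, norm_one, Complex.norm_real, Real.norm_of_nonneg Real.pi_pos.le]
    simp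
  rw [norm_mul, h1]
  gcongr
  exact (norm_add_le _ _).trans (by linarith)

theorem norm_stepAt_sub_le (D : ContractionData e fp fm κ c C B K R ε A A')
    (hϑ : ∀ k, |(ϑ k).im| ≤ 1) (hΦ : InBallAt e ε ϑ Φ) (ζ : OnePoint ℂ) :
    ‖stepAt e (opening κ) fp fm A A' R ϑ Φ ζ - ϑ‖ ≤ ε := by
  have h1 := fun k => (D.sectorBound hϑ hΦ k).norm_rightInt_le D.norm_eq D.opening_pos
    (opening_le κ) ζ
  have h2 := fun k => (D.neg.sectorBound hϑ hΦ.neg k).norm_rightInt_le D.neg.norm_eq D.opening_pos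
    (opening_le κ) ζ
  have h0 : 0 ≤ 1 / (4 * Real.pi) * (2 * (rightBound (opening κ) * jumpSize C K)) := by
    have := (norm_nonneg _).trans (h1 0)
    have := Real.pi_pos
    positivity
  refine (pi_norm_le_iff_of_nonneg (h0.trans D.le_eps)).2 fun k => ?_
  refine le_trans ?_ D.le_eps
  have := norm_prefactor_mul_le (h1 k) (h2 k)
  rw [← norm_neg]
  simpa only [stepAt, Pi.sub_apply, neg_sub, sub_sub_cancel] using this

theorem norm_stepAt_sub_stepAt_le (D : ContractionData e fp fm κ c C B K R ε A A')
    (hϑ : ∀ k, |(ϑ k).im| ≤ 1) (hΦ : InBallAt e ε ϑ Φ) (hΨ : InBallAt e ε ϑ Ψ) {M : ℝ}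
    (hM : ∀ ζ, ‖Φ ζ - Ψ ζ‖ ≤ M) (ζ : OnePoint ℂ) :
    ‖stepAt e (opening κ) fp fm A A' R ϑ Φ ζ - stepAt e (opening κ) fp fm A A' R ϑ Ψ ζ‖ ≤
      1 / 2 * M := by
  have h0 : 0 ≤ M := (norm_nonneg _).trans (hM ζ)
  have h1 := fun k => (D.plus.sectorBound_jump_sub D.norm_eq D.large (hΦ.regularAt D.eps_le hϑ)
    (hΨ.regularAt D.eps_le hϑ) hM k).norm_rightInt_le D.norm_eq D.opening_pos (opening_le κ) ζ
  have h2 := fun k => (D.minus.sectorBound_jump_sub D.neg.norm_eq D.large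
    (hΦ.neg.regularAt D.eps_le hϑ) (hΨ.neg.regularAt D.eps_le hϑ) hM k).norm_rightInt_le
    D.neg.norm_eq D.opening_pos (opening_le κ) ζ
  refine (pi_norm_le_iff_of_nonneg (by positivity)).2 fun k => ?_
  have h3 := norm_prefactor_mul_le (h1 k) (h2 k)
  rw [(D.sectorBound hϑ hΦ k).rightInt_sub (D.sectorBound hϑ hΨ k) D.norm_eq D.opening_pos
    (opening_le κ), (D.neg.sectorBound hϑ hΦ.neg k).rightInt_sub
    (D.neg.sectorBound hϑ hΨ.neg k) D.neg.norm_eq D.opening_pos (opening_le κ)] at h3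
  rw [← norm_neg]
  calc _ = _ := by
        congr 1
        simp only [stepAt, Pi.sub_apply]
        ring
    _ ≤ _ := h3
    _ = 1 / (4 * Real.pi) * (2 * (rightBound (opening κ) * jumpSize C K)) * M := by ring
    _ ≤ 1 / 2 * M := by gcongr; exact D.le_half

/-- `halfPlane e` is the counterclockwise side of `ray e` but the clockwise side of `ray (-e)`,
hence one `leftInt` and one `rightInt`. -/
theorem continuousOn_extAt (D : ContractionData e fp fm κ c C B K R ε A A')
    (hϑ : ∀ k, |(ϑ k).im| ≤ 1) (hΦ : InBallAt e ε ϑ Φ) :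
    ContinuousOn (extAt e (opening κ) fp fm A A' R ϑ Φ) (closedHalfPlane e) := by
  refine continuousOn_pi.2 fun k => ?_
  have h1 := (D.sectorBound hϑ hΦ k).continuousOn_leftInt D.norm_eq D.opening_pos (opening_le κ)
  have h2 := (D.neg.sectorBound hϑ hΦ.neg k).continuousOn_rightInt D.neg.norm_eq D.opening_pos
    (opening_le κ)
  rw [neg_neg] at h2
  exact continuousOn_const.sub (continuousOn_const.mul (h1.add h2))

theorem halfPlane_union_ray_subset (e : ℂ) (he : ‖e‖ = 1) : halfPlane e ∪ ray (-e) ⊆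
    ((↑) : ℂ → OnePoint ℂ) ⁻¹' closedHalfPlane e := by
  rintro z (hz | hz)
  · exact coe_mem_closedHalfPlane.2 (le_of_lt hz)
  · obtain ⟨s, -, rfl⟩ := hz
    refine coe_mem_closedHalfPlane.2 ?_
    rw [mul_neg, neg_mul, mul_assoc, Complex.mul_conj', he]
    simp

theorem notMem_ray_of_mem (he : ‖e‖ = 1) {z : ℂ} (hz : z ∈ halfPlane e ∪ ray (-e)) :
    z ∉ ray e := by
  rcases hz with hz | ⟨s, hs, rfl⟩
  · exact notMem_ray_of_im_ne_zero he (ne_of_gt hz)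
  · rintro ⟨t, ht, h⟩
    have he0 : e ≠ 0 := norm_ne_zero_iff.1 (by rw [he]; exact one_ne_zero)
    have h1 : (-s : ℂ) = t := mul_right_cancel₀ he0 (by rw [← h]; ring)
    have h2 : -s = t := by exact_mod_cast h1
    linarith

theorem continuousOn_stepAt (D : ContractionData e fp fm κ c C B K R ε A A')
    (hϑ : ∀ k, |(ϑ k).im| ≤ 1) (hΦ : InBallAt e ε ϑ Φ) :
    ContinuousOn (fun ζ : ℂ => stepAt e (opening κ) fp fm A A' R ϑ Φ ζ)
      (halfPlane e ∪ ray (-e)) := by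
  have h1 := ((D.continuousOn_extAt hϑ hΦ).comp OnePoint.continuous_coe.continuousOn
    fun z hz => halfPlane_union_ray_subset e D.norm_eq hz)
  refine h1.congr fun z hz => (extAt_eq_stepAt fun h => ?_).symm
  exact notMem_ray_of_mem D.norm_eq hz (coe_mem_image.1 h)

theorem differentiableOn_stepAt (D : ContractionData e fp fm κ c C B K R ε A A')
    (hϑ : ∀ k, |(ϑ k).im| ≤ 1) (hΦ : InBallAt e ε ϑ Φ) {s : Set ℂ}
    (hs : ∀ z ∈ s, (z * conj e).im ≠ 0) :
    DifferentiableOn ℂ (fun ζ : ℂ => stepAt e (opening κ) fp fm A A' R ϑ Φ ζ) s := by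
  refine differentiableOn_pi.2 fun k => ?_
  have h1 := (D.sectorBound hϑ hΦ k).differentiableOn_rightInt D.norm_eq D.opening_pos.le
    (opening_le κ) hs
  have h2 := (D.neg.sectorBound hϑ hΦ.neg k).differentiableOn_rightInt D.neg.norm_eq
    D.opening_pos.le (opening_le κ) (s := s) fun z hz => by
      rw [map_neg, mul_neg, Complex.neg_im, neg_ne_zero]; exact hs z hz
  exact (differentiableOn_const _).sub ((h1.add h2).const_mul _)

theorem inBallAt_stepAt (D : ContractionData e fp fm κ c C B K R ε A A')
    (hϑ : ∀ k, |(ϑ k).im| ≤ 1) (hΦ : InBallAt e ε ϑ Φ) :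
    InBallAt e ε ϑ (stepAt e (opening κ) fp fm A A' R ϑ Φ) := by
  refine ⟨D.norm_stepAt_sub_le hϑ hΦ, ?_⟩
  rintro σ (rfl | rfl)
  · refine ⟨D.differentiableOn_stepAt hϑ hΦ fun z hz => ne_of_gt hz, ?_⟩
    have := D.neg.continuousOn_stepAt hϑ hΦ.neg
    rwa [stepAt_neg, neg_neg] at this
  · refine ⟨D.differentiableOn_stepAt hϑ hΦ fun z hz => ne_of_lt (mem_halfPlane_neg.1 hz), ?_⟩
    rw [neg_neg]
    exact D.continuousOn_stepAt hϑ hΦ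

/-- The boundary value of the integral operator on `ray (-e)`. -/
theorem tendsto_stepAt (D : ContractionData e fp fm κ c C B K R ε A A')
    (hϑ : ∀ k, |(ϑ k).im| ≤ 1) (hΦ : InBallAt e ε ϑ Φ) {ζ : OnePoint ℂ}
    (hζ : ζ ∈ ((↑) : ℂ → OnePoint ℂ) '' ray (-e)) :
    Tendsto (stepAt e (opening κ) fp fm A A' R ϑ Φ)
      (𝓝[((↑) : ℂ → OnePoint ℂ) '' halfPlane e] ζ)
      (𝓝 (stepAt e (opening κ) fp fm A A' R ϑ Φ ζ)) := by
  obtain ⟨z, hz, rfl⟩ := hζ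
  refine (continuousWithinAt_coe_iff (f := stepAt e (opening κ) fp fm A A' R ϑ Φ)).2 ?_
  rw [preimage_image_eq _ (OnePoint.coe_injective)]
  exact (D.continuousOn_stepAt hϑ hΦ z (Or.inr hz)).mono subset_union_left

/-- `limUnder` is determined only along a nontrivial filter: `ray (-e)` lies in the closure of the
half-plane. -/
theorem neBot_nhdsWithin (he : ‖e‖ = 1) {ζ : OnePoint ℂ}
    (hζ : ζ ∈ ((↑) : ℂ → OnePoint ℂ) '' ray (-e)) :
    (𝓝[((↑) : ℂ → OnePoint ℂ) '' halfPlane e] ζ).NeBot := by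
  rw [← mem_closure_iff_nhdsWithin_neBot]
  obtain ⟨z, hz, rfl⟩ := hζ
  refine image_closure_subset_closure_image OnePoint.continuous_coe ⟨z, ?_, rfl⟩
  obtain ⟨s, -, rfl⟩ := hz
  have h1 : Tendsto (fun t : ℝ => (s * -e + t * Complex.I * e : ℂ)) (𝓝[>] 0) (𝓝 (s * -e)) := by
    have : Continuous fun t : ℝ => (s * -e + t * Complex.I * e : ℂ) := by fun_prop
    have h := (this.tendsto 0).mono_left (nhdsWithin_le_nhds (s := Ioi 0))
    simpa using h
  refine mem_closure_of_tendsto h1 ?_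
  filter_upwards [self_mem_nhdsWithin] with t ht
  show 0 < ((s * -e + t * Complex.I * e) * conj e).im
  rw [mul_neg, ← neg_mul, ← add_mul, mul_assoc, Complex.mul_conj', he]
  simpa using ht

end ContractionData

end StepAt

/-! ### Exchange of sum and integral on the rays. -/

section RaySeries

variable {σ : ℂ} {f : Fin 2 → Charge → ℚ} {κ c C B K R : ℝ} {A A' : Charge → ℂ}
  {Φ : OnePoint ℂ → Fin 2 → ℂ}

theorem setIntegral_Ioi_div_eq_rayInt (σ : ℂ) (g : ℂ → ℂ) (ζ : OnePoint ℂ) :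
    ∫ s in Ioi (0 : ℝ), kernel (s * σ) ζ * g (s * σ) / s = rayInt σ g ζ := by
  have h := integral_image_eq_integral_abs_deriv_smul (s := univ) MeasurableSet.univ
    (fun x _ => (Real.hasDerivAt_exp x).hasDerivWithinAt) Real.exp_injective.injOn
    (fun s : ℝ => kernel (s * σ) ζ * g (s * σ) / s)
  rw [image_univ, Real.range_exp, setIntegral_univ] at h
  rw [h, rayInt]
  congr 1; funext x
  have hx : (Real.exp x : ℂ) ≠ 0 := by exact_mod_cast (Real.exp_pos x).ne'
  rw [abs_of_pos (Real.exp_pos x), Complex.real_smul, expRay]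
  field_simp

theorem integrableOn_Ioi_div_iff (σ : ℂ) (g : ℂ → ℂ) (ζ : OnePoint ℂ) :
    IntegrableOn (fun s : ℝ => kernel (s * σ) ζ * g (s * σ) / s) (Ioi 0) ↔
      Integrable fun x => kernel (expRay σ x) ζ * g (expRay σ x) := by
  have h := integrableOn_image_iff_integrableOn_abs_deriv_smul (s := univ) MeasurableSet.univ
    (fun x _ => (Real.hasDerivAt_exp x).hasDerivWithinAt) Real.exp_injective.injOn
    (fun s : ℝ => kernel (s * σ) ζ * g (s * σ) / s)
  rw [image_univ, Real.range_exp, integrableOn_univ] at h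
  rw [h]
  refine iff_of_eq (congrArg (fun F => Integrable F volume) ?_)
  funext x
  have hx : (Real.exp x : ℂ) ≠ 0 := by exact_mod_cast (Real.exp_pos x).ne'
  rw [abs_of_pos (Real.exp_pos x), Complex.real_smul, expRay]
  field_simp

theorem JumpData.rayBound_term (D : JumpData σ f κ c C B A A') (hσ : ‖σ‖ = 1)
    (hL : LargeRadius κ c C B K R) (hΦ : RegularAt σ Φ) (k : Fin 2) (γ : Charge) :
    RayBound σ (majorant C K γ) fun z => (f k γ : ℂ) * semiflat R A A' γ (Φ z) z where
  cont := by
    have h1 := continuousOn_semiflat (s := ray σ) (fun h => ((mem_ray_iff hσ).1 h).1 rfl)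
      (hΦ.cont.mono subset_union_right) R A A' γ
    exact continuous_const.mul (h1.comp_continuous (continuous_expRay σ) (expRay_mem_ray σ))
  le x := by
    have := D.norm_term_le hσ hL k γ (hΦ.im_le (expRay σ x))
      (expRay_mem_sector hσ (opening_pos hL.κ_pos).le x)
    rwa [norm_expRay hσ, Real.log_exp] at this

/-- Absolute convergence of the sum of the ray integrals. -/
theorem JumpData.hasSum_rayInt (D : JumpData σ f κ c C B A A') (hσ : ‖σ‖ = 1)
    (hL : LargeRadius κ c C B K R) (hΦ : RegularAt σ Φ) (k : Fin 2) {ζ : OnePoint ℂ}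
    (hζ : ζ ∉ ((↑) : ℂ → OnePoint ℂ) '' ray σ) :
    HasSum (fun γ => rayInt σ (fun z => (f k γ : ℂ) * semiflat R A A' γ (Φ z) z) ζ)
      (rayInt σ (jump f A A' R Φ k) ζ) := by
  obtain ⟨ρ, h0, h1, hρ⟩ := exists_mem_apart hσ hζ
  have hb := fun γ => D.rayBound_term hσ hL hΦ k γ
  have h := hasSum_integral_of_summable_integral_norm
    (F := fun (γ : Charge) (x : ℝ) => kernel (expRay σ x) ζ *
      ((f k γ : ℂ) * semiflat R A A' γ (Φ (expRay σ x)) (expRay σ x)))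
    (fun γ => (hb γ).integrable hσ h0 h1 hρ) (μ := volume) ?_
  · simp only [tsum_mul_left] at h
    exact h
  · refine Summable.of_nonneg_of_le (fun γ => integral_nonneg fun x => norm_nonneg _) (fun γ => ?_)
      (((summable_majorant C K).mul_left (kernelBound ρ)).mul_right Real.pi)
    calc _ ≤ ∫ x, kernelBound ρ * majorant C K γ * logWeight x :=
          integral_mono ((hb γ).integrable hσ h0 h1 hρ).norm (integrable_logWeight.const_mul _)
            fun x => (hb γ).norm_integrand_le hσ h0 h1 hρ x
      _ = _ := by rw [integral_const_mul, integral_logWeight]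

/-- Decay is known only for charges that occur in the jump; for these the bound on the whole term
may be divided by its nonzero coefficient. -/
theorem JumpData.integrable_semiflat (D : JumpData σ f κ c C B A A') (hσ : ‖σ‖ = 1)
    (hL : LargeRadius κ c C B K R) (hΦ : RegularAt σ Φ) {k : Fin 2} {γ : Charge}
    (hγ : f k γ ≠ 0) {ζ : OnePoint ℂ} (hζ : ζ ∉ ((↑) : ℂ → OnePoint ℂ) '' ray σ) :
    Integrable fun x => kernel (expRay σ x) ζ *
      semiflat R A A' γ (Φ (expRay σ x)) (expRay σ x) := by
  obtain ⟨ρ, h0, h1, hρ⟩ := exists_mem_apart hσ hζ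
  have h := ((D.rayBound_term hσ hL hΦ k γ).integrable hσ h0 h1 hρ).const_mul (f k γ : ℂ)⁻¹
  refine h.congr (Eventually.of_forall fun x => ?_)
  have : (f k γ : ℂ) ≠ 0 := by exact_mod_cast hγ
  field_simp

end RaySeries

/-! ### Holomorphic families of contractions, their iterates and limits. -/

section Families

variable {E : Type*} [NormedAddCommGroup E] [NormedSpace ℂ E]
  {W : Set E} {e : ℂ} {fp fm : Fin 2 → Charge → ℚ} {κ c C B K R ε : ℝ}
  {A A' : E → Charge → ℂ} {ϑ : E → Fin 2 → ℂ} {Φ : E → OnePoint ℂ → Fin 2 → ℂ}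

/-- A holomorphic family of contractions. -/
structure HoloContraction (W : Set E) (e : ℂ) (fp fm : Fin 2 → Charge → ℚ) (κ c C B K R ε : ℝ)
    (A A' : E → Charge → ℂ) (ϑ : E → Fin 2 → ℂ) : Prop where
  isOpen : IsOpen W
  data : ∀ p ∈ W, ContractionData e fp fm κ c C B K R ε (A p) (A' p)
  im_le : ∀ p ∈ W, ∀ k, |(ϑ p k).im| ≤ 1
  holo : ∀ γ, DifferentiableOn ℂ (fun p => A p γ) W
  holo' : ∀ γ, DifferentiableOn ℂ (fun p => A' p γ) W
  holo_center : DifferentiableOn ℂ ϑ W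

/-- A holomorphic family of elements of the balls. -/
structure HoloFamily (W : Set E) (e ε : _) (ϑ : E → Fin 2 → ℂ) (Φ : E → OnePoint ℂ → Fin 2 → ℂ) :
    Prop where
  mem : ∀ p ∈ W, InBallAt e ε (ϑ p) (Φ p)
  holo : ∀ ζ, DifferentiableOn ℂ (fun p => Φ p ζ) W

theorem HoloFamily.neg (h : HoloFamily W e ε ϑ Φ) : HoloFamily W (-e) ε ϑ Φ :=
  ⟨fun p hp => (h.mem p hp).neg, h.holo⟩

namespace HoloContraction

theorem neg (H : HoloContraction W e fp fm κ c C B K R ε A A' ϑ) :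
    HoloContraction W (-e) fm fp κ c C B K R ε A A' ϑ :=
  ⟨H.isOpen, fun p hp => (H.data p hp).neg, H.im_le, H.holo, H.holo', H.holo_center⟩

theorem differentiableOn_jump (H : HoloContraction W e fp fm κ c C B K R ε A A' ϑ)
    (hΦ : HoloFamily W e ε ϑ Φ) (k : Fin 2) {z : ℂ} (hz : z ∈ sector e (opening κ)) :
    DifferentiableOn ℂ (fun p => jump fp (A p) (A' p) R (Φ p) k z) W := by
  refine differentiableOn_tsum_of_norm_le (summable_majorant C K) H.isOpen (fun γ => ?_)
    fun γ p hp => ?_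
  · have h0 := fun k => differentiableOn_pi.1 (hΦ.holo z) k
    have h1 := H.holo γ
    have h2 := H.holo' γ
    unfold semiflat lin
    refine (DifferentiableOn.cexp (DifferentiableOn.add (DifferentiableOn.add ?_ ?_) ?_)).const_mul _
    · simp only [div_eq_mul_inv]
      exact (h1.const_mul _).mul_const _
    · exact (((h0 0).const_mul _).add ((h0 1).const_mul _)).const_mul _
    · exact h2.const_mul _
  · exact (H.data p hp).plus.norm_term_le_majorant (H.data p hp).norm_eq (H.data p hp).large k γ
      (((hΦ.mem p hp).regularAt (H.data p hp).eps_le (H.im_le p hp)).im_le z) hz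

theorem eps_nonneg (H : HoloContraction W e fp fm κ c C B K R ε A A' ϑ) (hW : W.Nonempty) :
    0 ≤ ε := by
  obtain ⟨p, hp⟩ := hW
  have hs : 0 ≤ jumpSize C K := tsum_nonneg fun γ => majorant_nonneg (H.data p hp).large.C_nonneg K γ
  refine le_trans ?_ (H.data p hp).le_eps
  have := rightBound_pos (opening κ)
  have := Real.pi_pos
  positivity

end HoloContraction

/-- The iterates of the integral operator in a family, starting from the center of the ball. -/
noncomputable def iterAt (e : ℂ) (δ : ℝ) (fp fm : Fin 2 → Charge → ℚ) (A A' : E → Charge → ℂ)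
    (R : ℝ) (ϑ : E → Fin 2 → ℂ) : ℕ → E → OnePoint ℂ → Fin 2 → ℂ
  | 0 => fun p _ => ϑ p
  | ν + 1 => fun p => stepAt e δ fp fm (A p) (A' p) R (ϑ p) (iterAt e δ fp fm A A' R ϑ ν p)

/-- The limit of the iterates. -/
noncomputable def limitAt (e : ℂ) (δ : ℝ) (fp fm : Fin 2 → Charge → ℚ) (A A' : E → Charge → ℂ)
    (R : ℝ) (ϑ : E → Fin 2 → ℂ) (p : E) (ζ : OnePoint ℂ) : Fin 2 → ℂ :=
  limUnder atTop fun ν => iterAt e δ fp fm A A' R ϑ ν p ζ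

theorem lin_add (γ : Charge) (v w : Fin 2 → ℂ) : lin γ (v + w) = lin γ v + lin γ w := by
  simp only [lin, Pi.add_apply]; ring

/-- The vector of the periods of a torus coordinate. -/
noncomputable def period (n : Fin 2 → ℤ) : Fin 2 → ℂ := fun k => 2 * Real.pi * n k

/-- The components of `γ` are integers, so the exponent changes by an integral multiple of `2πi`. -/
theorem semiflat_add_period (R : ℝ) (A A' : Charge → ℂ) (γ : Charge) (v : Fin 2 → ℂ)
    (n : Fin 2 → ℤ) (z : ℂ) :
    semiflat R A A' γ (v + period n) z = semiflat R A A' γ v z := by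
  rw [semiflat, semiflat, Complex.exp_eq_exp_iff_exists_int]
  refine ⟨γ.1 * n 0 + γ.2 * n 1, ?_⟩
  rw [lin_add]
  simp only [lin, period]
  push_cast
  ring

theorem stepAt_add_period (δ : ℝ) (A A' : Charge → ℂ) (R : ℝ) (ϑ : Fin 2 → ℂ) (n : Fin 2 → ℤ)
    (Φ : OnePoint ℂ → Fin 2 → ℂ) (ζ : OnePoint ℂ) :
    stepAt e δ fp fm A A' R (ϑ + period n) (fun ξ => Φ ξ + period n) ζ =
      stepAt e δ fp fm A A' R ϑ Φ ζ + period n := by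
  have h : ∀ f : Fin 2 → Charge → ℚ,
      jump f A A' R (fun ξ => Φ ξ + period n) = jump f A A' R Φ := fun f => by
    funext k z
    simp only [jump, semiflat_add_period]
  funext k
  simp only [stepAt, h, Pi.add_apply]
  ring

theorem iterAt_add_period {P : Type*} {A A' : P → Charge → ℂ} {ϑ : P → Fin 2 → ℂ} {δ : ℝ} {p q : P}
    (hA : A q = A p) (hA' : A' q = A' p) {n : Fin 2 → ℤ}
    (hϑ : ϑ q = ϑ p + period n) (ν : ℕ) (ζ : OnePoint ℂ) :
    iterAt e δ fp fm A A' R ϑ ν q ζ = iterAt e δ fp fm A A' R ϑ ν p ζ + period n := by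
  induction ν generalizing ζ with
  | zero => exact hϑ
  | succ ν ih =>
    have := funext ih
    simp only [iterAt]
    rw [this, hA, hA', hϑ, stepAt_add_period]

variable [FiniteDimensional ℂ E]

namespace HoloContraction

theorem differentiableOn_rightInt_jump (H : HoloContraction W e fp fm κ c C B K R ε A A' ϑ)
    (hΦ : HoloFamily W e ε ϑ Φ) (k : Fin 2) (ζ : OnePoint ℂ) :
    DifferentiableOn ℂ
      (fun p => rightInt e (opening κ) (jump fp (A p) (A' p) R (Φ p) k) ζ) W := by
  rcases W.eq_empty_or_nonempty with rfl | ⟨p₀, hp₀⟩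
  · exact differentiableOn_empty
  exact differentiableOn_rightInt_param H.isOpen
    (fun p hp => (H.data p hp).sectorBound (H.im_le p hp) (hΦ.mem p hp) k) (H.data p₀ hp₀).norm_eq
    (H.data p₀ hp₀).opening_pos (opening_le κ) (fun z hz => H.differentiableOn_jump hΦ k hz) ζ

theorem differentiableOn_extAt (H : HoloContraction W e fp fm κ c C B K R ε A A' ϑ)
    (hΦ : HoloFamily W e ε ϑ Φ) (ζ : OnePoint ℂ) :
    DifferentiableOn ℂ
      (fun p => extAt e (opening κ) fp fm (A p) (A' p) R (ϑ p) (Φ p) ζ) W := by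
  rcases W.eq_empty_or_nonempty with rfl | ⟨p₀, hp₀⟩
  · exact differentiableOn_empty
  refine differentiableOn_pi.2 fun k => ?_
  have h1 := differentiableOn_leftInt_param H.isOpen
    (fun p hp => (H.data p hp).sectorBound (H.im_le p hp) (hΦ.mem p hp) k) (H.data p₀ hp₀).norm_eq
    (H.data p₀ hp₀).opening_pos (opening_le κ) (fun z hz => H.differentiableOn_jump hΦ k hz) ζ
  exact (differentiableOn_pi.1 H.holo_center k).sub
    ((h1.add (H.neg.differentiableOn_rightInt_jump hΦ.neg k ζ)).const_mul _)

theorem holoFamily_stepAt (H : HoloContraction W e fp fm κ c C B K R ε A A' ϑ)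
    (hΦ : HoloFamily W e ε ϑ Φ) :
    HoloFamily W e ε ϑ fun p => stepAt e (opening κ) fp fm (A p) (A' p) R (ϑ p) (Φ p) where
  mem p hp := (H.data p hp).inBallAt_stepAt (H.im_le p hp) (hΦ.mem p hp)
  holo ζ := differentiableOn_pi.2 fun k => (differentiableOn_pi.1 H.holo_center k).sub
    (((H.differentiableOn_rightInt_jump hΦ k ζ).add
      (H.neg.differentiableOn_rightInt_jump hΦ.neg k ζ)).const_mul _)

theorem holoFamily_iterAt (H : HoloContraction W e fp fm κ c C B K R ε A A' ϑ) (ν : ℕ) :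
    HoloFamily W e ε ϑ (iterAt e (opening κ) fp fm A A' R ϑ ν) := by
  induction ν with
  | zero => exact ⟨fun p hp => inBallAt_const e (H.eps_nonneg ⟨p, hp⟩) (ϑ p),
      fun ζ => H.holo_center⟩
  | succ ν ih => exact H.holoFamily_stepAt ih

/-- The first iterate is in the ball around the starting point, and every further step halves the
distance. -/
theorem dist_iterAt_succ_le (H : HoloContraction W e fp fm κ c C B K R ε A A' ϑ) {p : E}
    (hp : p ∈ W) (ν : ℕ) (ζ : OnePoint ℂ) :
    dist (iterAt e (opening κ) fp fm A A' R ϑ ν p ζ)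
      (iterAt e (opening κ) fp fm A A' R ϑ (ν + 1) p ζ) ≤ ε * (1 / 2) ^ ν := by
  induction ν generalizing ζ with
  | zero =>
    rw [dist_comm, dist_eq_norm, pow_zero, mul_one]
    exact ((H.holoFamily_iterAt 1).mem p hp).le ζ
  | succ ν ih =>
    rw [dist_eq_norm]
    refine ((H.data p hp).norm_stepAt_sub_stepAt_le (H.im_le p hp)
      ((H.holoFamily_iterAt ν).mem p hp) ((H.holoFamily_iterAt (ν + 1)).mem p hp)
      (fun ξ => (dist_eq_norm _ _).symm.trans_le (ih ξ)) ζ).trans (le_of_eq ?_)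
    ring

theorem tendsto_iterAt (H : HoloContraction W e fp fm κ c C B K R ε A A' ϑ) {p : E}
    (hp : p ∈ W) (ζ : OnePoint ℂ) :
    Tendsto (fun ν => iterAt e (opening κ) fp fm A A' R ϑ ν p ζ) atTop
      (𝓝 (limitAt e (opening κ) fp fm A A' R ϑ p ζ)) :=
  (cauchySeq_of_le_geometric (1 / 2) ε (by norm_num)
    fun ν => H.dist_iterAt_succ_le hp ν ζ).tendsto_limUnder

theorem norm_iterAt_sub_limitAt_le (H : HoloContraction W e fp fm κ c C B K R ε A A' ϑ) {p : E}
    (hp : p ∈ W) (ν : ℕ) (ζ : OnePoint ℂ) :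
    ‖iterAt e (opening κ) fp fm A A' R ϑ ν p ζ - limitAt e (opening κ) fp fm A A' R ϑ p ζ‖ ≤
      2 * ε * (1 / 2) ^ ν := by
  have := dist_le_of_le_geometric_of_tendsto (1 / 2) ε (by norm_num)
    (fun ν => H.dist_iterAt_succ_le hp ν ζ) (H.tendsto_iterAt hp ζ) ν
  rw [dist_eq_norm] at this
  refine this.trans (le_of_eq ?_)
  ring

theorem tendsto_geometric (ε : ℝ) : Tendsto (fun ν : ℕ => 2 * ε * (1 / 2 : ℝ) ^ ν) atTop (𝓝 0) := by
  simpa using (tendsto_pow_atTop_nhds_zero_of_lt_one (by norm_num : (0 : ℝ) ≤ 1 / 2)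
    (by norm_num)).const_mul (2 * ε)

theorem tendstoUniformlyOn_of_geometric {α β : Type*} [NormedAddCommGroup β] {F : ℕ → α → β}
    {G : α → β} {s : Set α} (h : ∀ ν, ∀ x ∈ s, ‖F ν x - G x‖ ≤ 2 * ε * (1 / 2) ^ ν) :
    TendstoUniformlyOn F G atTop s := by
  rw [Metric.tendstoUniformlyOn_iff]
  intro r hr
  filter_upwards [(tendsto_geometric ε).eventually (gt_mem_nhds hr)] with ν hν x hx
  rw [dist_comm, dist_eq_norm]
  exact (h ν x hx).trans_lt hν

theorem isOpen_halfPlane (σ : ℂ) : IsOpen (halfPlane σ) :=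
  isOpen_lt continuous_const (by fun_prop)

/-- The geometric rate is uniform in `ζ` and in the parameter, so holomorphy in either variable and
one-sided continuity pass to the limit. -/
theorem holoFamily_limitAt (H : HoloContraction W e fp fm κ c C B K R ε A A' ϑ) :
    HoloFamily W e ε ϑ (limitAt e (opening κ) fp fm A A' R ϑ) where
  mem p hp := by
    refine ⟨fun ζ => le_of_tendsto ((H.tendsto_iterAt hp ζ).sub_const (ϑ p)).norm
      (Eventually.of_forall fun ν => ((H.holoFamily_iterAt ν).mem p hp).le ζ), fun σ hσ => ?_⟩
    have hu : ∀ s : Set ℂ, TendstoUniformlyOn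
        (fun ν (z : ℂ) => iterAt e (opening κ) fp fm A A' R ϑ ν p z)
        (fun z : ℂ => limitAt e (opening κ) fp fm A A' R ϑ p z) atTop s := fun s =>
      tendstoUniformlyOn_of_geometric fun ν z _ => H.norm_iterAt_sub_limitAt_le hp ν z
    exact ⟨differentiableOn_of_tendstoUniformlyOn (isOpen_halfPlane σ)
      (fun ν => (((H.holoFamily_iterAt ν).mem p hp).regular σ hσ).1) (hu _),
      (hu _).continuousOn (Frequently.of_forall
        fun ν => (((H.holoFamily_iterAt ν).mem p hp).regular σ hσ).2)⟩
  holo ζ := differentiableOn_of_tendstoUniformlyOn H.isOpen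
    (fun ν => (H.holoFamily_iterAt ν).holo ζ)
    (tendstoUniformlyOn_of_geometric fun ν _ hp => H.norm_iterAt_sub_limitAt_le hp ν ζ)

/-- The limit of the iterates is a fixed point. -/
theorem stepAt_limitAt (H : HoloContraction W e fp fm κ c C B K R ε A A' ϑ) {p : E}
    (hp : p ∈ W) :
    stepAt e (opening κ) fp fm (A p) (A' p) R (ϑ p) (limitAt e (opening κ) fp fm A A' R ϑ p) =
      limitAt e (opening κ) fp fm A A' R ϑ p := by
  funext ζ
  have h1 : Tendsto (fun ν => iterAt e (opening κ) fp fm A A' R ϑ (ν + 1) p ζ) atTop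
      (𝓝 (stepAt e (opening κ) fp fm (A p) (A' p) R (ϑ p)
        (limitAt e (opening κ) fp fm A A' R ϑ p) ζ)) := by
    rw [tendsto_iff_norm_sub_tendsto_zero]
    have h2 : Tendsto (fun ν : ℕ => 1 / 2 * (2 * ε * (1 / 2 : ℝ) ^ ν)) atTop (𝓝 0) := by
      have := (tendsto_geometric ε).const_mul (1 / 2)
      rwa [mul_zero] at this
    refine squeeze_zero (fun _ => norm_nonneg _) (fun ν => ?_) h2
    exact (H.data p hp).norm_stepAt_sub_stepAt_le (H.im_le p hp)
      ((H.holoFamily_iterAt ν).mem p hp) (H.holoFamily_limitAt.mem p hp)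
      (fun ξ => H.norm_iterAt_sub_limitAt_le hp ν ξ) ζ
  exact tendsto_nhds_unique h1 ((tendsto_add_atTop_iff_nat 1).2 (H.tendsto_iterAt hp ζ))

end HoloContraction

theorem HoloContraction.limitAt_add_period
    (H : HoloContraction W e fp fm κ c C B K R ε A A' ϑ) {p q : E} (hp : p ∈ W) (hq : q ∈ W)
    (hA : A q = A p) (hA' : A' q = A' p) {n : Fin 2 → ℤ} (hϑ : ϑ q = ϑ p + period n)
    (ζ : OnePoint ℂ) :
    limitAt e (opening κ) fp fm A A' R ϑ q ζ =
      limitAt e (opening κ) fp fm A A' R ϑ p ζ + period n := by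
  refine tendsto_nhds_unique (H.tendsto_iterAt hq ζ) ?_
  simp only [iterAt_add_period hA hA' hϑ]
  exact (H.tendsto_iterAt hp ζ).add_const _

end Families

/-! ### From complexified to real parameters, and to functions on the torus. -/

section Parameters

variable {U : Set ℂ} {D : MonodromyData U} {e σ : ℂ} {f fp fm : Fin 2 → Charge → ℚ}
  {κ c C B K R ε : ℝ} {Φ Ψ : Field} {a : ℂ} {θ : ℝ × ℝ}

/-! ### The complexified parameters -/

/-- The complexification of the parameters `(a, conj a, θ₁, θ₂)`. -/
abbrev Param : Type := ℂ × ℂ × (Fin 2 → ℂ)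

/-- The neighbourhood of the real parameters to which the solution extends. -/
def paramSet (U : Set ℂ) : Set Param :=
  {p | p.1 ∈ U ∧ conj p.2.1 ∈ U ∧ ∀ k, |(p.2.2 k).im| < 1}

/-- The central charges at a complexified parameter. -/
def MonodromyData.charge (D : MonodromyData U) (p : Param) (γ : Charge) : ℂ := D.Z γ p.1

/-- The holomorphic extension of the conjugate central charges. -/
noncomputable def MonodromyData.conjCharge (D : MonodromyData U) (p : Param) (γ : Charge) : ℂ :=
  conj (D.Z γ (conj p.2.1))

/-- The vector of the torus coordinates. -/
def thetaVec (θ : ℝ × ℝ) : Fin 2 → ℂ := fun k => if k = 0 then (θ.1 : ℂ) else (θ.2 : ℂ)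

theorem theta_eq (a : ℂ) (θ : ℝ × ℝ) (ζ : OnePoint ℂ) : theta a θ ζ = thetaVec θ := rfl

theorem im_thetaVec (θ : ℝ × ℝ) (k : Fin 2) : (thetaVec θ k).im = 0 := by
  unfold thetaVec; split_ifs <;> simp

/-- The real parameters among the complexified ones. -/
noncomputable def realParam (a : ℂ) (θ : ℝ × ℝ) : Param := (a, conj a, thetaVec θ)

theorem realParam_mem (ha : a ∈ U) (θ : ℝ × ℝ) : realParam a θ ∈ paramSet U :=
  ⟨ha, by simpa [realParam] using ha, fun k => by simp [realParam, im_thetaVec]⟩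

theorem charge_realParam (D : MonodromyData U) (a : ℂ) (θ : ℝ × ℝ) :
    D.charge (realParam a θ) = fun γ => D.Z γ a := rfl

theorem conjCharge_realParam (D : MonodromyData U) (a : ℂ) (θ : ℝ × ℝ) :
    D.conjCharge (realParam a θ) = fun γ => conj (D.Z γ a) := by
  funext γ; simp [MonodromyData.conjCharge, realParam]

theorem contDiff_realParam : ContDiff ℝ ∞ fun p : ℂ × (ℝ × ℝ) => realParam p.1 p.2 := by
  have h : ContDiff ℝ ∞ fun p : ℂ × (ℝ × ℝ) => thetaVec p.2 := by
    refine contDiff_pi.2 fun k => ?_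
    unfold thetaVec
    split_ifs
    · exact Complex.ofRealCLM.contDiff.comp (contDiff_fst.comp contDiff_snd)
    · exact Complex.ofRealCLM.contDiff.comp (contDiff_snd.comp contDiff_snd)
  exact contDiff_fst.prodMk ((Complex.conjCLE.contDiff.comp contDiff_fst).prodMk h)

theorem isOpen_paramSet (hU : IsOpen U) : IsOpen (paramSet U) := by
  have h3 : IsOpen {p : Param | ∀ k, |(p.2.2 k).im| < 1} := by
    simp only [ofPred_forall]
    exact isOpen_iInter_of_finite fun k => isOpen_lt (by fun_prop) continuous_const
  exact (hU.preimage continuous_fst).inter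
    ((hU.preimage (Complex.continuous_conj.comp (continuous_fst.comp continuous_snd))).inter h3)

/-- Holomorphic functions of the complexified parameters are smooth functions of the parameters. -/
theorem contDiffOn_comp_realParam (hU : IsOpen U) {F : Param → Fin 2 → ℂ}
    (hF : DifferentiableOn ℂ F (paramSet U)) :
    ContDiffOn ℝ ∞ (fun p : ℂ × (ℝ × ℝ) => F (realParam p.1 p.2)) (U ×ˢ univ) :=
  ((contDiffOn_of_differentiableOn (isOpen_paramSet hU) hF).restrict_scalars ℝ).comp
    contDiff_realParam.contDiffOn fun _ hp => realParam_mem hp.1 _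

/-- The coordinates that replace `a` and `conj a` are unrelated; the sector bounds are used at the
two points `p.1` and `conj p.2.1` of `U`, conjugated for the latter. -/
theorem MonodromyData.JumpBounds.jumpData (h : D.JumpBounds σ f κ c C B) {p : Param}
    (hp : p ∈ paramSet U) : JumpData σ f κ c C B (D.charge p) (D.conjCharge p) where
  ne_zero := h.ne_zero
  cone k γ hγ := h.sector k γ hγ _ hp.1
  growth k γ hγ := h.growth k γ hγ _ hp.1
  cone' k γ hγ := by
    have := h.sector k γ hγ _ hp.2.1
    rw [← Complex.conj_re, map_mul, Complex.conj_conj] at this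
    rwa [conjCharge, Complex.norm_conj]
  growth' k γ hγ := by
    have := h.growth k γ hγ _ hp.2.1
    rwa [← Complex.conj_re, map_mul, Complex.conj_conj] at this
  coeff := h.coeff

theorem MonodromyData.differentiableOn_charge (D : MonodromyData U) (γ : Charge) :
    DifferentiableOn ℂ (fun p => D.charge p γ) (paramSet U) :=
  (D.Z_holo γ).comp differentiableOn_fst fun _ hp => hp.1

/-- Schwarz reflection: conjugating both argument and value preserves holomorphy. -/
theorem MonodromyData.differentiableOn_conjCharge (hU : IsOpen U) (D : MonodromyData U)
    (γ : Charge) : DifferentiableOn ℂ (fun p => D.conjCharge p γ) (paramSet U) := by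
  intro p hp
  have h1 : DifferentiableAt ℂ (conj ∘ D.Z γ ∘ conj) p.2.1 := by
    have := ((D.Z_holo γ).differentiableAt (hU.mem_nhds hp.2.1)).conj_conj
    rwa [Complex.conj_conj] at this
  have h2 : DifferentiableAt ℂ (fun p : Param => p.2.1) p :=
    differentiableAt_fst.comp p differentiableAt_snd
  exact (h1.comp p h2).differentiableWithinAt

theorem exists_exponent (κ C : ℝ) (hε : 0 < ε) : ∃ K : ℝ, 0 ≤ K ∧
    1 / (4 * Real.pi) * (2 * (rightBound (opening κ) * jumpSize C K)) < ε := by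
  have h1 : Tendsto (fun K => 1 / (4 * Real.pi) * (2 * (rightBound (opening κ) * jumpSize C K)))
      atTop (𝓝 0) := by
    have h2 := Real.tendsto_exp_neg_atTop_nhds_zero.const_mul
      (1 / (4 * Real.pi) * (2 * (rightBound (opening κ) * jumpSize C 0)))
    rw [mul_zero] at h2
    refine h2.congr fun K => ?_
    rw [jumpSize_eq C K]
    ring
  obtain ⟨K, h, h'⟩ := ((h1.eventually (gt_mem_nhds hε)).and (eventually_ge_atTop 0)).exists
  exact ⟨K, h', h⟩

theorem exists_largeRadius (hκ : 0 < κ) (hc : 0 < c) (hC : 0 ≤ C) (hB : 0 ≤ B) (hK : 0 ≤ K) :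
    ∃ R₀ : ℝ, 0 < R₀ ∧ ∀ R, R₀ ≤ R → LargeRadius κ c C B K R := by
  -- The required inequality is `B + 10 + K ≤ π R c - 2`.
  refine ⟨(B + 12 + K) / (Real.pi * c), by positivity, fun R hR => ?_⟩
  have h0 : 0 ≤ (B + 12 + K) / (Real.pi * c) := by positivity
  refine ⟨hκ, hC, hB, hK, h0.trans hR, ?_⟩
  rw [div_le_iff₀ (by positivity)] at hR
  linarith

/-- For large `R` the integral equation is a holomorphic family of contractions. -/
theorem MonodromyData.exists_holoContraction (hU : IsOpen U) (D : MonodromyData U)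
    (he : D.AdmissibleRay e) (hf : D.Isomonodromic e fp fm) (hε : 0 < ε) (hε1 : ε ≤ 1) :
    ∃ κ c C B K R₀ : ℝ, 0 < R₀ ∧ ∀ R, R₀ ≤ R → HoloContraction (paramSet U) e fp fm κ c C B K R ε
      D.charge D.conjCharge fun p => p.2.2 := by
  -- Over the empty set there is no generic parameter to yield the constants, but any values will
  -- do.
  obtain ⟨κ, c, C, B, hκ, hc, hC, hB, hJ⟩ : ∃ κ c C B : ℝ, 0 < κ ∧ 0 < c ∧ 0 ≤ C ∧ 0 ≤ B ∧
      (U.Nonempty → D.JumpBounds e fp κ c C B ∧ D.JumpBounds (-e) fm κ c C B) := by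
    rcases U.eq_empty_or_nonempty with h | h
    · exact ⟨1, 1, 0, 0, one_pos, one_pos, le_rfl, le_rfl, fun h' => (h'.ne_empty h).elim⟩
    · obtain ⟨κ, c, C, B, hκ, hc, hC, hB, h1, h2⟩ := D.exists_jumpBounds h he hf
      exact ⟨κ, c, C, B, hκ, hc, hC, hB, fun _ => ⟨h1, h2⟩⟩
  -- Below `ε` the ball is preserved; below `1/2` the map contracts by that factor. `K` is fixed
  -- first, then `R₀`.
  obtain ⟨K, hK, hK'⟩ := exists_exponent κ C (lt_min hε one_half_pos)
  obtain ⟨R₀, hR₀, hR⟩ := exists_largeRadius hκ hc hC hB hK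
  refine ⟨κ, c, C, B, K, R₀, hR₀, fun R hRR => ⟨isOpen_paramSet hU, fun p hp => ?_,
    fun p hp k => (hp.2.2 k).le, D.differentiableOn_charge, D.differentiableOn_conjCharge hU,
    (differentiable_snd.comp differentiable_snd).differentiableOn⟩⟩
  obtain ⟨h1, h2⟩ := hJ ⟨_, hp.1⟩
  exact ⟨he.1, hR R hRR, h1.jumpData hp, h2.jumpData hp, (hK'.le).trans (min_le_left _ _),
    (hK'.le).trans (min_le_right _ _), hε1⟩

/-! ### The integral equation at the real parameters -/

theorem inBall_iff : InBall U e ε Φ ↔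
    ∀ a ∈ U, ∀ θ, InBallAt e ε (thetaVec θ) (Φ a θ) :=
  ⟨fun h a ha θ => ⟨(h a ha θ).1, (h a ha θ).2⟩, fun h a ha θ => ⟨(h a ha θ).le, (h a ha θ).regular⟩⟩

theorem MonodromyData.term_eq (D : MonodromyData U) (R : ℝ) (Φ : Field) (a : ℂ) (θ : ℝ × ℝ)
    (ζ : OnePoint ℂ) (f : Fin 2 → Charge → ℚ) (k : Fin 2) (σ : ℂ) (γ : Charge) :
    D.term R Φ a θ ζ (f k) σ γ = rayInt σ (fun z => (f k γ : ℂ) *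
      semiflat R (fun γ => D.Z γ a) (fun γ => conj (D.Z γ a)) γ (Φ a θ z) z) ζ := by
  rw [MonodromyData.term, ← setIntegral_Ioi_div_eq_rayInt, ← integral_const_mul]
  congr 1; funext s
  simp only [MonodromyData.integrand, MonodromyData.Xsf, semiflat]
  ring

theorem thetaVec_im_le (θ : ℝ × ℝ) (k : Fin 2) : |(thetaVec θ k).im| ≤ 1 := by
  rw [im_thetaVec, abs_zero]; exact zero_le_one

namespace ContractionData

theorem hasSum_term
    (H : ContractionData e fp fm κ c C B K R ε (fun γ => D.Z γ a) fun γ => conj (D.Z γ a))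
    (hΦ : InBallAt e ε (thetaVec θ) (Φ a θ)) {ζ : OnePoint ℂ}
    (hζ : ζ ∉ ((↑) : ℂ → OnePoint ℂ) '' ray e) (k : Fin 2) :
    HasSum (D.term R Φ a θ ζ (fp k) e) (rightInt e (opening κ)
      (jump fp (fun γ => D.Z γ a) (fun γ => conj (D.Z γ a)) R (Φ a θ) k) ζ) := by
  rw [rightInt_of_notMem hζ]
  simp only [funext fun γ => D.term_eq R Φ a θ ζ fp k e γ]
  exact H.plus.hasSum_rayInt H.norm_eq H.large (hΦ.regularAt H.eps_le (thetaVec_im_le θ)) k hζ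

theorem integrableOn_integrand
    (H : ContractionData e fp fm κ c C B K R ε (fun γ => D.Z γ a) fun γ => conj (D.Z γ a))
    (hΦ : InBallAt e ε (thetaVec θ) (Φ a θ)) {ζ : OnePoint ℂ}
    (hζ : ζ ∉ ((↑) : ℂ → OnePoint ℂ) '' ray e) {k : Fin 2} {γ : Charge} (hγ : fp k γ ≠ 0) :
    IntegrableOn (D.integrand R Φ a θ ζ γ e) (Ioi 0) :=
  (integrableOn_Ioi_div_iff e (fun z => semiflat R (fun γ => D.Z γ a) (fun γ => conj (D.Z γ a)) γ
    (Φ a θ z) z) ζ).2 <| H.plus.integrable_semiflat H.norm_eq H.large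
      (hΦ.regularAt H.eps_le (thetaVec_im_le θ)) hγ hζ

theorem rhs_eq
    (H : ContractionData e fp fm κ c C B K R ε (fun γ => D.Z γ a) fun γ => conj (D.Z γ a))
    (hΦ : InBallAt e ε (thetaVec θ) (Φ a θ)) {ζ : OnePoint ℂ}
    (hζ : ζ ∉ ((↑) : ℂ → OnePoint ℂ) '' ray e) (hζ' : ζ ∉ ((↑) : ℂ → OnePoint ℂ) '' ray (-e)) :
    D.rhs e fp fm R Φ a θ ζ = stepAt e (opening κ) fp fm (fun γ => D.Z γ a)
      (fun γ => conj (D.Z γ a)) R (thetaVec θ) (Φ a θ) ζ := by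
  funext k
  rw [MonodromyData.rhs, (H.hasSum_term hΦ hζ k).tsum_eq, (H.neg.hasSum_term hΦ.neg hζ' k).tsum_eq]
  rfl

theorem limUnder_rhs_eq
    (H : ContractionData e fp fm κ c C B K R ε (fun γ => D.Z γ a) fun γ => conj (D.Z γ a))
    (hΦ : InBallAt e ε (thetaVec θ) (Φ a θ)) {ζ : OnePoint ℂ}
    (hζ : ζ ∈ ((↑) : ℂ → OnePoint ℂ) '' ray (-e)) :
    limUnder (𝓝[((↑) : ℂ → OnePoint ℂ) '' halfPlane e] ζ) (D.rhs e fp fm R Φ a θ) =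
      stepAt e (opening κ) fp fm (fun γ => D.Z γ a)
      (fun γ => conj (D.Z γ a)) R (thetaVec θ) (Φ a θ) ζ := by
  have := neBot_nhdsWithin H.norm_eq hζ
  refine Tendsto.limUnder_eq ((H.tendsto_stepAt (thetaVec_im_le θ) hΦ hζ).congr' ?_)
  filter_upwards [self_mem_nhdsWithin] with ξ hξ
  obtain ⟨z, hz, rfl⟩ := hξ
  have him : (z * conj e).im ≠ 0 := ne_of_gt hz
  refine (H.rhs_eq hΦ (fun h => ?_) fun h => ?_).symm
  · exact notMem_ray_of_im_ne_zero H.norm_eq him (coe_mem_image.1 h)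
  · refine notMem_ray_of_im_ne_zero H.neg.norm_eq ?_ (coe_mem_image.1 h)
    rwa [map_neg, mul_neg, Complex.neg_im, neg_ne_zero]

/-- Off the rays this is the exchange of sum and integral. On them `step` takes a one-sided limit,
which exists and equals the value of `stepAt` by one-sided continuity. -/
theorem step_eq
    (H : ContractionData e fp fm κ c C B K R ε (fun γ => D.Z γ a) fun γ => conj (D.Z γ a))
    (hΦ : InBallAt e ε (thetaVec θ) (Φ a θ)) :
    D.step e fp fm R Φ a θ = stepAt e (opening κ) fp fm (fun γ => D.Z γ a)
      (fun γ => conj (D.Z γ a)) R (thetaVec θ) (Φ a θ) := by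
  funext ζ
  rw [MonodromyData.step]
  split_ifs with h1 h2
  -- The limit on `ray e` is the one on `ray (-e)` with the roles of the two rays exchanged.
  · have h := H.neg.limUnder_rhs_eq hΦ.neg (ζ := ζ) (by rwa [neg_neg])
    have hr : D.rhs (-e) fm fp R Φ a θ = D.rhs e fp fm R Φ a θ := by
      funext ξ k
      rw [MonodromyData.rhs, MonodromyData.rhs, neg_neg, add_comm]
    rwa [hr, stepAt_neg] at h
  · exact H.limUnder_rhs_eq hΦ h2
  · exact H.rhs_eq hΦ h1 h2

end ContractionData

/-! ### Families over the real parameters -/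

namespace HoloContraction

theorem realData
    (H : HoloContraction (paramSet U) e fp fm κ c C B K R ε D.charge D.conjCharge fun p => p.2.2)
    (ha : a ∈ U) :
    ContractionData e fp fm κ c C B K R ε (fun γ => D.Z γ a) fun γ => conj (D.Z γ a) := by
  have := H.data _ (realParam_mem ha 0)
  rwa [charge_realParam, conjCharge_realParam] at this

theorem converges
    (H : HoloContraction (paramSet U) e fp fm κ c C B K R ε D.charge D.conjCharge fun p => p.2.2)
    (hΦ : InBall U e ε Φ) : D.Converges e fp fm R Φ := by
  intro a ha θ ζ hζ k
  rw [image_union, mem_union, not_or] at hζ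
  have hD := H.realData ha
  have hb := inBall_iff.1 hΦ a ha θ
  exact ⟨fun γ hγ => hD.integrableOn_integrand hb hζ.1 hγ,
    fun γ hγ => hD.neg.integrableOn_integrand hb.neg hζ.2 hγ, (hD.hasSum_term hb hζ.1 k).summable,
    (hD.neg.hasSum_term hb.neg hζ.2 k).summable⟩

theorem inBall_step
    (H : HoloContraction (paramSet U) e fp fm κ c C B K R ε D.charge D.conjCharge fun p => p.2.2)
    (hΦ : InBall U e ε Φ) : InBall U e ε (D.step e fp fm R Φ) := by
  refine inBall_iff.2 fun a ha θ => ?_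
  have hb := inBall_iff.1 hΦ a ha θ
  rw [(H.realData ha).step_eq hb]
  exact (H.realData ha).inBallAt_stepAt (thetaVec_im_le θ) hb

theorem norm_step_sub_step_le
    (H : HoloContraction (paramSet U) e fp fm κ c C B K R ε D.charge D.conjCharge fun p => p.2.2)
    (hΦ : InBall U e ε Φ) (hΨ : InBall U e ε Ψ) {M : ℝ}
    (hM : ∀ a ∈ U, ∀ θ ζ, ‖Φ a θ ζ - Ψ a θ ζ‖ ≤ M) (ha : a ∈ U) (θ : ℝ × ℝ) (ζ : OnePoint ℂ) :
    ‖D.step e fp fm R Φ a θ ζ - D.step e fp fm R Ψ a θ ζ‖ ≤ 1 / 2 * M := by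
  have hb := inBall_iff.1 hΦ a ha θ
  have hb' := inBall_iff.1 hΨ a ha θ
  rw [(H.realData ha).step_eq hb, (H.realData ha).step_eq hb']
  exact (H.realData ha).norm_stepAt_sub_stepAt_le (thetaVec_im_le θ) hb hb' (hM a ha θ) ζ

theorem iter_eq
    (H : HoloContraction (paramSet U) e fp fm κ c C B K R ε D.charge D.conjCharge fun p => p.2.2)
    (ha : a ∈ U) (θ : ℝ × ℝ) (ν : ℕ) : D.iter e fp fm R ν a θ =
      iterAt e (opening κ) fp fm D.charge D.conjCharge R (fun p => p.2.2) ν (realParam a θ) := by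
  induction ν with
  | zero => rfl
  | succ ν ih =>
    have hb := (H.holoFamily_iterAt ν).mem _ (realParam_mem ha θ)
    rw [← ih] at hb
    rw [MonodromyData.iter, (H.realData ha).step_eq hb, ih]
    simp only [iterAt]
    rw [charge_realParam, conjCharge_realParam]
    rfl

theorem inBall_iter
    (H : HoloContraction (paramSet U) e fp fm κ c C B K R ε D.charge D.conjCharge fun p => p.2.2)
    (ν : ℕ) : InBall U e ε (D.iter e fp fm R ν) := by
  refine inBall_iff.2 fun a ha θ => ?_
  rw [H.iter_eq ha]
  exact (H.holoFamily_iterAt ν).mem _ (realParam_mem ha θ)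

end HoloContraction

/-- The solution of the integral equation. -/
noncomputable def MonodromyData.solution (D : MonodromyData U) (e : ℂ) (δ : ℝ)
    (fp fm : Fin 2 → Charge → ℚ) (R : ℝ) : Field := fun a θ =>
  limitAt e δ fp fm D.charge D.conjCharge R (fun p => p.2.2) (realParam a θ)

namespace HoloContraction

theorem inBall_solution
    (H : HoloContraction (paramSet U) e fp fm κ c C B K R ε D.charge D.conjCharge fun p => p.2.2) :
    InBall U e ε (D.solution e (opening κ) fp fm R) :=
  inBall_iff.2 fun _ ha θ => H.holoFamily_limitAt.mem _ (realParam_mem ha θ)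

theorem stepAt_solution
    (H : HoloContraction (paramSet U) e fp fm κ c C B K R ε D.charge D.conjCharge fun p => p.2.2)
    (ha : a ∈ U) (θ : ℝ × ℝ) :
    stepAt e (opening κ) fp fm (fun γ => D.Z γ a) (fun γ => conj (D.Z γ a)) R (thetaVec θ)
      (D.solution e (opening κ) fp fm R a θ) = D.solution e (opening κ) fp fm R a θ := by
  have := H.stepAt_limitAt (realParam_mem ha θ)
  rwa [charge_realParam, conjCharge_realParam] at this

theorem step_solution
    (H : HoloContraction (paramSet U) e fp fm κ c C B K R ε D.charge D.conjCharge fun p => p.2.2)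
    (ha : a ∈ U) (θ : ℝ × ℝ) : D.step e fp fm R (D.solution e (opening κ) fp fm R) a θ =
      D.solution e (opening κ) fp fm R a θ := by
  rw [(H.realData ha).step_eq (inBall_iff.1 H.inBall_solution a ha θ), H.stepAt_solution ha]

theorem differentiableOn_solution
    (H : HoloContraction (paramSet U) e fp fm κ c C B K R ε D.charge D.conjCharge fun p => p.2.2)
    (ha : a ∈ U) (θ : ℝ × ℝ) :
    DifferentiableOn ℂ (fun ζ : ℂ => D.solution e (opening κ) fp fm R a θ ζ)
      (halfPlane e ∪ halfPlane (-e)) := by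
  have hb := (H.inBall_solution a ha θ).2
  exact (hb e (Or.inl rfl)).1.union_of_isOpen (hb (-e) (Or.inr rfl)).1 (isOpen_halfPlane _)
    (isOpen_halfPlane _)

theorem contDiffOn_solution (hU : IsOpen U)
    (H : HoloContraction (paramSet U) e fp fm κ c C B K R ε D.charge D.conjCharge fun p => p.2.2)
    (ζ : OnePoint ℂ) : ContDiffOn ℝ ∞
      (fun p : ℂ × (ℝ × ℝ) => D.solution e (opening κ) fp fm R p.1 p.2 ζ) (U ×ˢ univ) :=
  contDiffOn_comp_realParam hU (H.holoFamily_limitAt.holo ζ)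

theorem contDiffOn_iter (hU : IsOpen U)
    (H : HoloContraction (paramSet U) e fp fm κ c C B K R ε D.charge D.conjCharge fun p => p.2.2)
    (ν : ℕ) (ζ : OnePoint ℂ) : ContDiffOn ℝ ∞
      (fun p : ℂ × (ℝ × ℝ) => D.iter e fp fm R ν p.1 p.2 ζ) (U ×ˢ univ) :=
  (contDiffOn_comp_realParam hU ((H.holoFamily_iterAt ν).holo ζ)).congr fun p hp => by
    rw [H.iter_eq hp.1]

/-- A holomorphic family of solutions extends to the closed half-plane. -/
theorem exists_extension (hU : IsOpen U)
    (H : HoloContraction (paramSet U) e fp fm κ c C B K R ε D.charge D.conjCharge fun p => p.2.2)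
    {F : Param → OnePoint ℂ → Fin 2 → ℂ} (hF : HoloFamily (paramSet U) e ε (fun p => p.2.2) F)
    (hs : ∀ a ∈ U, ∀ θ, stepAt e (opening κ) fp fm (fun γ => D.Z γ a) (fun γ => conj (D.Z γ a)) R
      (thetaVec θ) (F (realParam a θ)) = F (realParam a θ)) :
    ∃ G : Field, (∀ a ∈ U, ∀ θ, ContinuousOn (G a θ) (closedHalfPlane e) ∧
      ∀ ζ ∈ closedHalfPlane e, ζ ∉ ((↑) : ℂ → OnePoint ℂ) '' ray e →
        G a θ ζ = F (realParam a θ) ζ) ∧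
      ∀ ζ ∈ closedHalfPlane e,
        ContDiffOn ℝ ∞ (fun p : ℂ × (ℝ × ℝ) => G p.1 p.2 ζ) (U ×ˢ univ) := by
  refine ⟨fun a θ => extAt e (opening κ) fp fm (fun γ => D.Z γ a) (fun γ => conj (D.Z γ a)) R
    (thetaVec θ) (F (realParam a θ)), fun a ha θ => ⟨?_, fun ζ _ hζ => ?_⟩, fun ζ _ => ?_⟩
  · exact (H.realData ha).continuousOn_extAt (thetaVec_im_le θ) (hF.mem _ (realParam_mem ha θ))
  · simp only
    rw [extAt_eq_stepAt hζ, hs a ha θ]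
  · refine (contDiffOn_comp_realParam hU (H.differentiableOn_extAt hF ζ)).congr fun p _ => ?_
    simp only
    rw [charge_realParam, conjCharge_realParam]
    rfl

end HoloContraction

/-! ### Elements of the Banach space -/

theorem exists_eq_add_of_coe_eq {x y : ℝ} (h : (x : Real.Angle) = y) :
    ∃ n : ℤ, x = y + 2 * Real.pi * n := by
  obtain ⟨n, hn⟩ := Real.Angle.angle_eq_iff_two_pi_dvd_sub.1 h
  exact ⟨n, by linarith⟩

/-- Quasiperiodicity: `Φ - θ` is a function on the torus. -/
def QuasiPeriodic (U : Set ℂ) (Φ : Field) : Prop :=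
  ∀ a ∈ U, ∀ (θ θ' : ℝ × ℝ) (n : Fin 2 → ℤ) (ζ : OnePoint ℂ), thetaVec θ' = thetaVec θ + period n →
    Φ a θ' ζ = Φ a θ ζ + period n

/-- The bounded function `Φ - θ`. -/
noncomputable def InBall.toBdd (hΦ : InBall U e ε Φ) : Bdd U :=
  ⟨fun x => Φ x.1 (x.2.1.1.toReal, x.2.1.2.toReal) x.2.2 - thetaVec (x.2.1.1.toReal, x.2.1.2.toReal),
    memℓp_infty ⟨ε, by
      rintro _ ⟨x, rfl⟩
      exact (hΦ x.1 x.1.2 _).1 x.2.2⟩⟩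

theorem InBall.toBdd_apply (hΦ : InBall U e ε Φ) (x : Pts U) : hΦ.toBdd x =
    Φ x.1 (x.2.1.1.toReal, x.2.1.2.toReal) x.2.2 - thetaVec (x.2.1.1.toReal, x.2.1.2.toReal) := rfl

/-- `toBdd` evaluates at the representatives of the angles in `(-π, π]`; quasiperiodicity makes the
value independent of the lift. -/
theorem InBall.represents_toBdd (hΦ : InBall U e ε Φ) (hp : QuasiPeriodic U Φ) :
    Represents Φ hΦ.toBdd := by
  intro a θ ζ
  obtain ⟨m, hm⟩ := exists_eq_add_of_coe_eq (Real.Angle.coe_toReal (θ.1 : Real.Angle))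
  obtain ⟨n, hn⟩ := exists_eq_add_of_coe_eq (Real.Angle.coe_toReal (θ.2 : Real.Angle))
  have h : thetaVec ((θ.1 : Real.Angle).toReal, (θ.2 : Real.Angle).toReal) =
      thetaVec θ + period ![m, n] := by
    funext k
    fin_cases k
    · simp [thetaVec, period, hm]
    · simp [thetaVec, period, hn]
  rw [hΦ.toBdd_apply, theta_eq]
  simp only
  rw [h, hp a a.2 θ _ _ ζ h, add_sub_add_right_eq_sub]

theorem contDiff_thetaVec : ContDiff ℝ ∞ fun p : ℂ × (ℝ × ℝ) => thetaVec p.2 :=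
  contDiff_snd.comp (contDiff_snd.comp contDiff_realParam)

/-- Such a function already lies in `smoothBdd U`, before passing to the closure. -/
theorem InBall.toBdd_mem (hΦ : InBall U e ε Φ) (hp : QuasiPeriodic U Φ)
    (hs : ∀ ζ, ContDiffOn ℝ ∞ (fun p : ℂ × (ℝ × ℝ) => Φ p.1 p.2 ζ) (U ×ˢ univ)) :
    hΦ.toBdd ∈ XSpace U := by
  refine Submodule.le_topologicalClosure _ fun ζ => ?_
  exact ⟨fun p => Φ p.1 p.2 ζ - thetaVec p.2, (hs ζ).sub contDiff_thetaVec.contDiffOn,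
    fun a θ => (hΦ.represents_toBdd hp a θ ζ).symm⟩

theorem InBall.norm_toBdd_sub_le (hΦ : InBall U e ε Φ) (hΨ : InBall U e ε Ψ) {M : ℝ} (hM : 0 ≤ M)
    (h : ∀ a ∈ U, ∀ θ ζ, ‖Φ a θ ζ - Ψ a θ ζ‖ ≤ M) : ‖hΦ.toBdd - hΨ.toBdd‖ ≤ M := by
  refine lp.norm_le_of_forall_le hM fun x => ?_
  rw [lp.coeFn_sub, Pi.sub_apply, hΦ.toBdd_apply, hΨ.toBdd_apply, sub_sub_sub_cancel_right]
  exact h _ x.1.2 _ _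

namespace HoloContraction

theorem quasiPeriodic_iter
    (H : HoloContraction (paramSet U) e fp fm κ c C B K R ε D.charge D.conjCharge fun p => p.2.2)
    (ν : ℕ) : QuasiPeriodic U (D.iter e fp fm R ν) := by
  intro a ha θ θ' n ζ h
  rw [H.iter_eq ha, H.iter_eq ha]
  exact iterAt_add_period (ϑ := fun p : Param => p.2.2) (p := realParam a θ) (q := realParam a θ')
    rfl rfl h ν ζ

theorem quasiPeriodic_solution
    (H : HoloContraction (paramSet U) e fp fm κ c C B K R ε D.charge D.conjCharge fun p => p.2.2) :
    QuasiPeriodic U (D.solution e (opening κ) fp fm R) := fun _ ha θ θ' _ ζ h =>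
  H.limitAt_add_period (realParam_mem ha θ) (realParam_mem ha θ') rfl rfl h ζ

/-- The iterates converge in the Banach space. -/
theorem exists_tendsto (hU : IsOpen U) (hε : 0 ≤ ε)
    (H : HoloContraction (paramSet U) e fp fm κ c C B K R ε D.charge D.conjCharge fun p => p.2.2) :
    ∃ (u : ℕ → XSpace U) (w : XSpace U), (∀ ν, Represents (D.iter e fp fm R ν) (u ν).1) ∧
      Represents (D.solution e (opening κ) fp fm R) w.1 ∧ Tendsto u atTop (𝓝 w) := by
  refine ⟨fun ν => ⟨(H.inBall_iter ν).toBdd, (H.inBall_iter ν).toBdd_mem (H.quasiPeriodic_iter ν)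
    (H.contDiffOn_iter hU ν)⟩, ⟨H.inBall_solution.toBdd, H.inBall_solution.toBdd_mem
    H.quasiPeriodic_solution (H.contDiffOn_solution hU)⟩,
    fun ν => (H.inBall_iter ν).represents_toBdd (H.quasiPeriodic_iter ν),
    H.inBall_solution.represents_toBdd H.quasiPeriodic_solution, ?_⟩
  rw [tendsto_iff_norm_sub_tendsto_zero]
  refine squeeze_zero (fun _ => norm_nonneg _) (fun ν => ?_) (tendsto_geometric ε)
  refine (H.inBall_iter ν).norm_toBdd_sub_le H.inBall_solution (by positivity) fun a ha θ ζ => ?_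
  rw [H.iter_eq ha]
  exact H.norm_iterAt_sub_limitAt_le (realParam_mem ha θ) ν ζ

end HoloContraction

end Parameters

end StokesRH

/-! ### The theorem. -/

theorem theorem2 {U : Set ℂ} (hU : IsOpen U) (D : StokesRH.MonodromyData U)
    (e : ℂ) (he : D.AdmissibleRay e)
    (fp fm : Fin 2 → StokesRH.Charge → ℚ) (hf : D.Isomonodromic e fp fm)
    (ε : ℝ) (hε : 0 < ε) (hε2 : ε ≤ Real.log 2) :
    ∃ R₀ : ℝ, 0 < R₀ ∧ ∀ R : ℝ, R₀ ≤ R →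
      -- the map is well defined and a contraction
      (∀ Φ, StokesRH.InBall U e ε Φ →
        D.Converges e fp fm R Φ ∧ StokesRH.InBall U e ε (D.step e fp fm R Φ)) ∧
      (∃ q : ℝ, 0 ≤ q ∧ q < 1 ∧ ∀ Φ Ψ, StokesRH.InBall U e ε Φ → StokesRH.InBall U e ε Ψ →
        ∀ M : ℝ, (∀ a ∈ U, ∀ θ ζ, ‖Φ a θ ζ - Ψ a θ ζ‖ ≤ M) →
          ∀ a ∈ U, ∀ θ ζ, ‖D.step e fp fm R Φ a θ ζ - D.step e fp fm R Ψ a θ ζ‖ ≤ q * M) ∧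
      -- the iterates
      (∀ ν, StokesRH.InBall U e ε (D.iter e fp fm R ν)) ∧
      ∃ Θ : StokesRH.Field,
        -- convergence in the Banach space
        (∃ (u : ℕ → StokesRH.XSpace U) (w : StokesRH.XSpace U),
          (∀ ν, StokesRH.Represents (D.iter e fp fm R ν) (u ν).1) ∧
          StokesRH.Represents Θ w.1 ∧
          Filter.Tendsto u Filter.atTop (nhds w)) ∧
        -- the limit solves the integral equation
        StokesRH.InBall U e ε Θ ∧
        (∀ a ∈ U, ∀ θ ζ, D.step e fp fm R Θ a θ ζ = Θ a θ ζ) ∧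
        -- it is holomorphic off the two rays, and continuous on the closed half-planes
        (∀ a ∈ U, ∀ θ, DifferentiableOn ℂ (fun ζ : ℂ => Θ a θ ζ)
          (StokesRH.halfPlane e ∪ StokesRH.halfPlane (-e))) ∧
        (∀ σ : ℂ, σ = e ∨ σ = -e → ∃ G : StokesRH.Field,
          (∀ a ∈ U, ∀ θ, ContinuousOn (G a θ) (StokesRH.closedHalfPlane σ) ∧
            ∀ ζ ∈ StokesRH.closedHalfPlane σ,
              ζ ∉ ((↑) : ℂ → OnePoint ℂ) '' StokesRH.ray σ → G a θ ζ = Θ a θ ζ) ∧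
          ∀ ζ ∈ StokesRH.closedHalfPlane σ,
            ContDiffOn ℝ (⊤ : ℕ∞) (fun p : ℂ × (ℝ × ℝ) => G p.1 p.2 ζ) (U ×ˢ Set.univ)) ∧
        -- it is smooth in the parameters
        (∀ ζ, ContDiffOn ℝ (⊤ : ℕ∞) (fun p : ℂ × (ℝ × ℝ) => Θ p.1 p.2 ζ) (U ×ˢ Set.univ)) := by
  -- Of the bound `log 2` only `ε ≤ 1` enters.
  obtain ⟨κ, c, C, B, K, R₀, hR₀, h⟩ := D.exists_holoContraction hU he hf hε
    (hε2.trans (Real.log_two_lt_d9.le.trans (by norm_num)))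
  refine ⟨R₀, hR₀, fun R hR => ?_⟩
  have H := h R hR
  refine ⟨fun Φ hΦ => ⟨H.converges hΦ, H.inBall_step hΦ⟩, ⟨1 / 2, by norm_num, by norm_num,
    fun Φ Ψ hΦ hΨ M hM a ha θ ζ => H.norm_step_sub_step_le hΦ hΨ hM ha θ ζ⟩, H.inBall_iter,
    D.solution e (StokesRH.opening κ) fp fm R, H.exists_tendsto hU hε.le, H.inBall_solution,
    fun a ha θ ζ => congrFun (H.step_solution ha θ) ζ,
    fun a ha θ => H.differentiableOn_solution ha θ, ?_, H.contDiffOn_solution hU⟩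
  rintro σ (rfl | rfl)
  · exact H.exists_extension hU H.holoFamily_limitAt fun a ha θ => H.stepAt_solution ha θ
  -- The other half-plane: exchanging the rays leaves both the operator and its fixed point
  -- unchanged.
  · refine H.neg.exists_extension hU H.holoFamily_limitAt.neg fun a ha θ => ?_
    rw [StokesRH.stepAt_neg]
    exact H.stepAt_solution ha θ
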